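/- Fix integers $r\ge 2$ and coprime $n,m\ge 1$. An $r$-uniform hypergraph is a set $A$ with a set $R[A]$ of $r$-element subsets of $A$; substructures are induced. For finite $A$ put $\delta(A)=n|A|-m|R[A]|$. For $A\subseteq B$ with $B$ finite write $A\le B$ if $\delta(A)\le\delta(B')$ for all $A\subseteq B'\subseteq B$. Let $\mathcal C_0$ be the class of finite $r$-uniform hypergraphs $B$ with $\emptyset\le B$, and $\bar{\mathcal C}_0$ the class of those $r$-uniform hypergraphs all of whose finite substructures are in $\mathcal C_0$; for $C\subseteq B\in\bar{\mathcal C}_0$ write $C\le B$ if $X\cap C\le X$ for all finite $X\subseteq B$. Let $M_0$ be the generic structure for $(\mathcal C_0,\le)$, i.e. the countable structure $M_0\in\bar{\mathcal C}_0$, unique up to isomorphism, such that $M_0$ is the union of a chain of finite $\le$-substructures and, whenever $X\le M_0$ is finite and $X\le A\in\mathcal C_0$, there is an embedding $\alpha:A\to M_0$ that is the identity on $X$ and satisfies $\alpha(A)\le M_0$. For finite $X\subseteq M_0$ let ${\rm cl}_0(X)$ be the smallest $Y$ with $X\subseteq Y\le M_0$ (it is finite), $d(X)=\delta({\rm cl}_0(X))$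 and ${\rm cl}^d(X)=\{a\in M_0: d(X\cup\{a\})=d(X)\}$. Let $G={\rm Aut}(M_0/{\rm cl}^d(\emptyset))$ be the group of automorphisms of $M_0$ that fix every element of ${\rm cl}^d(\emptyset)$. Suppose that either $r=2$ and $n>m$, or $r\ge 3$ and $n\ge m$. Then $G$ is a simple group. In fact, if $g\in G$ and $g\ne 1$, then every element of $G$ is a product of 96 elements, each of which is a conjugate in $G$ of $g$ or of $g^{-1}$. -/

import Mathlib

/-- An `r`-uniform hypergraph on `V`: a set of `r`-element subsets of `V`, i.e. an `r`-ary relation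
that is symmetric and holds only of tuples of distinct elements. -/
structure UHypergraph (r : ℕ) (V : Type*) where
  /-- the hyperedges -/
  edges : Set (Finset V)
  card_edge : ∀ e ∈ edges, e.card = r

namespace UHypergraph

variable {r : ℕ} {V W : Type*}

/-- The hyperedges `R[S]` contained in `S`. -/
def edgesIn (H : UHypergraph r V) (S : Set V) : Set (Finset V) :=
  {e | e ∈ H.edges ∧ (e : Set V) ⊆ S}

/-- The induced substructure on `X`. -/
def induce (H : UHypergraph r V) (X : Set V) : UHypergraph r X where
  edges := {e | e.map (Function.Embedding.subtype (· ∈ X)) ∈ H.edges}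
  card_edge e he := by
    have h := H.card_edge _ he
    rwa [Finset.card_map] at h

/-- `f` is an embedding of structures: an injection that preserves and reflects the relation. -/
def IsEmbedding (H : UHypergraph r V) (K : UHypergraph r W) (f : V ↪ W) : Prop :=
  ∀ e : Finset V, e.map f ∈ K.edges ↔ e ∈ H.edges

/-- The pointwise stabiliser `Aut(H/X)` of `X` in the automorphism group of `H`. -/
def autFixing (H : UHypergraph r V) (X : Set V) : Subgroup (Equiv.Perm V) where
  carrier := {g | H.IsEmbedding H g.toEmbedding ∧ ∀ x ∈ X, g x = x}
  one_mem' := by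
    refine ⟨fun e => ?_, fun x _ => rfl⟩
    have h : e.map (1 : Equiv.Perm V).toEmbedding = e := Finset.map_refl
    rw [h]
  mul_mem' := by
    rintro a b ⟨ha, ha'⟩ ⟨hb, hb'⟩
    refine ⟨fun e => ?_, fun x hx => ?_⟩
    · have h : e.map (a * b).toEmbedding = (e.map b.toEmbedding).map a.toEmbedding := by
        rw [Finset.map_map]; rfl
      rw [h, ha, hb]
    · rw [Equiv.Perm.mul_apply, hb' x hx, ha' x hx]
  inv_mem' := by
    rintro a ⟨ha, ha'⟩
    refine ⟨fun e => ?_, fun x hx => ?_⟩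
    · have h : (e.map (a⁻¹).toEmbedding).map a.toEmbedding = e := by
        rw [Finset.map_map]
        have h' : (a⁻¹).toEmbedding.trans a.toEmbedding = Function.Embedding.refl V := by
          ext x; exact Equiv.apply_symm_apply a x
        rw [h', Finset.map_refl]
      rw [← ha (e.map (a⁻¹).toEmbedding), h]
    · rw [Equiv.Perm.inv_eq_iff_eq, ha' x hx]

/-- The predimension `δ(S) = n |S| - m |R[S]|`; only meaningful for finite `S`. -/
noncomputable def predim (n m : ℕ) (H : UHypergraph r V) (S : Set V) : ℤ :=
  (n : ℤ) * S.ncard - (m : ℤ) * (H.edgesIn S).ncard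

/-- `A ≤ B` for subsets `A ⊆ B` with `B` finite. -/
def FinLe (n m : ℕ) (H : UHypergraph r V) (A B : Set V) : Prop :=
  A ⊆ B ∧ ∀ B' : Set V, A ⊆ B' → B' ⊆ B → H.predim n m A ≤ H.predim n m B'

/-- `H` belongs to the class of structures all of whose finite substructures `X` satisfy
`∅ ≤ X`. For finite `V` this is the class `𝒞₀`. -/
def InC0 (n m : ℕ) (H : UHypergraph r V) : Prop :=
  ∀ X : Set V, X.Finite → H.FinLe n m ∅ X

/-- `C ≤ H`: `X ∩ C ≤ X` for every finite subset `X` of the structure. -/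
def Strong (n m : ℕ) (H : UHypergraph r V) (C : Set V) : Prop :=
  ∀ X : Set V, X.Finite → H.FinLe n m (X ∩ C) X

/-- The smallest `Y ⊇ X` with `Y ≤ H`. -/
def cl0 (n m : ℕ) (H : UHypergraph r V) (X : Set V) : Set V :=
  ⋂₀ {Y | X ⊆ Y ∧ H.Strong n m Y}

/-- The dimension `d(X) = δ(cl₀(X))` of a finite subset `X`. -/
noncomputable def dim (n m : ℕ) (H : UHypergraph r V) (X : Set V) : ℤ :=
  H.predim n m (H.cl0 n m X)

/-- The `d`-closure `cl^d(X) = {a | d(X ∪ {a}) = d(X)}` of a finite subset `X`. -/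
def clD (n m : ℕ) (H : UHypergraph r V) (X : Set V) : Set V :=
  {a | H.dim n m (X ∪ {a}) = H.dim n m X}

/-- `H` is (a copy of) the generic structure for `(𝒞₀, ≤)`. Finite structures are taken in `Type`,
which contains a copy of every one of them. -/
structure IsGeneric (n m : ℕ) (H : UHypergraph r V) : Prop where
  countable : Countable V
  inC0 : H.InC0 n m
  chain : ∃ A : ℕ → Set V, Monotone A ∧ (∀ i, (A i).Finite ∧ H.Strong n m (A i)) ∧
    ⋃ i, A i = Set.univ
  extension : ∀ X : Set V, X.Finite → H.Strong n m X →
    ∀ (W : Type) [Finite W] (K : UHypergraph r W), K.InC0 n m →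
    ∀ j : X ↪ W, (H.induce X).IsEmbedding K j → K.Strong n m (Set.range j) →
    ∃ α : W ↪ V, K.IsEmbedding H α ∧ (∀ x : X, α (j x) = x) ∧ H.Strong n m (Set.range α)

end UHypergraph

/-!
The dimension `d` is a monotone submodular function on the finite subsets of `M₀`, and it defines an
independence relation which is invariant under automorphisms. Amalgamation in `M₀` shows that
independent conjugates exist and that independence is stationary: two automorphisms with
independent supports have a common extension. The decisive point is that every `g ≠ 1` moves
maximally: over each finite `X`, every finite `A` has a conjugate `B` such that `B` is independent
from `gB` over `X`, and `gB` is independent from `XB` over `gX`. To see this, one picks a long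
sequence of points which `g` moves as freely as possible, and embeds into `M₀` the structure
obtained from `M₀` by adding edges that make `B` algebraic over these points, but keep it
independent from their images under `g`.

A back-and-forth between two words in four conjugates of `g` each then writes every element of the
group as a quotient of two such words, that is, as a product of eight conjugates of `g` and `g⁻¹`;
the pairs `g g⁻¹` make up the remaining factors.
-/

noncomputable section

open scoped Pointwise

/-! ### Dimension functions and independence -/

section Dimension

variable {V : Type*} [DecidableEq V] {d : Finset V → ℤ}

/-- A dimension function: a monotone submodular function on the finite subsets of `V`. Points
may have dimension greater than `1`, so `dimClosure` need not have the exchange property. -/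
structure IsDimension (d : Finset V → ℤ) : Prop where
  mono : ∀ A B, A ⊆ B → d A ≤ d B
  submod : ∀ A B, d (A ∪ B) + d (A ∩ B) ≤ d A + d B

/-- The closure of a finite set: the points whose addition does not increase the dimension. -/
def dimClosure (d : Finset V → ℤ) (A : Finset V) : Set V :=
  {a | d (insert a A) = d A}

/-- Independence of `A` from `C` over `B`, stated as the inequality opposite to submodularity. -/
def DimIndep (d : Finset V → ℤ) (A B C : Finset V) : Prop :=
  d (A ∪ B) + d (B ∪ C) ≤ d (A ∪ B ∪ C) + d B

theorem subset_dimClosure (d : Finset V → ℤ) (A : Finset V) : (A : Set V) ⊆ dimClosure d A :=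
  fun _ ha => congrArg d (Finset.insert_eq_of_mem ha)

namespace IsDimension

theorem add_le_add_of_subset (hd : IsDimension d) {A B C D : Finset V} (hCA : C ⊆ A)
    (hCB : C ⊆ B) (hD : D ⊆ A ∪ B) : d D + d C ≤ d A + d B := by
  have := hd.submod A B
  have := hd.mono _ _ (Finset.subset_inter hCA hCB)
  have := hd.mono _ _ hD
  omega

theorem mem_dimClosure_iff (hd : IsDimension d) {A : Finset V} {a : V} :
    a ∈ dimClosure d A ↔ d (insert a A) ≤ d A :=
  (hd.mono A (insert a A) (Finset.subset_insert _ _)).ge_iff_eq'.symm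

theorem dimClosure_mono (hd : IsDimension d) {A B : Finset V} (h : A ⊆ B) :
    dimClosure d A ⊆ dimClosure d B := by
  intro a ha
  rw [hd.mem_dimClosure_iff] at ha ⊢
  have := hd.add_le_add_of_subset (A := insert a A) (B := B) (C := A) (D := insert a B)
    (Finset.subset_insert _ _) h (by grind)
  omega

theorem union_eq (hd : IsDimension d) {A C : Finset V} (h : (C : Set V) ⊆ dimClosure d A) :
    d (A ∪ C) = d A := by
  induction C using Finset.induction_on with
  | empty => rw [Finset.union_empty]
  | insert c C _ ih =>
    rw [Finset.coe_insert, Set.insert_subset_iff] at h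
    have hc : c ∈ dimClosure d (A ∪ C) := hd.dimClosure_mono Finset.subset_union_left h.1
    rw [Finset.union_insert]
    exact Eq.trans hc (ih h.2)

theorem subset_dimClosure_of_union_le (hd : IsDimension d) {A C : Finset V}
    (h : d (A ∪ C) ≤ d A) : (C : Set V) ⊆ dimClosure d A := fun c hc =>
  hd.mem_dimClosure_iff.2 ((hd.mono _ _ (by grind)).trans h)

end IsDimension

namespace DimIndep

variable {A A' B B' C C' D : Finset V}

theorem symm (h : DimIndep d A B C) : DimIndep d C B A := by
  unfold DimIndep at *
  rw [show C ∪ B ∪ A = A ∪ B ∪ C by grind, Finset.union_comm C B, Finset.union_comm B A]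
  omega

theorem of_base (d : Finset V → ℤ) (A B : Finset V) : DimIndep d A B B := by
  simp [DimIndep]

theorem trans (h₁ : DimIndep d A B C) (h₂ : DimIndep d A (B ∪ C) D) :
    DimIndep d A B (C ∪ D) := by
  unfold DimIndep at *
  simp only [← Finset.union_assoc] at *
  omega

theorem trans_of_subset (hB : B ⊆ B') (h₁ : DimIndep d A B B') (h₂ : DimIndep d A B' C) :
    DimIndep d A B (B' ∪ C) :=
  h₁.trans (by rwa [Finset.union_eq_right.2 hB])

theorem add_eq (h : DimIndep d A B C) (hd : IsDimension d) :
    d (A ∪ B ∪ C) + d B = d (A ∪ B) + d (B ∪ C) := by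
  have := hd.add_le_add_of_subset (A := A ∪ B) (B := B ∪ C) (C := B) (D := A ∪ B ∪ C)
    Finset.subset_union_right Finset.subset_union_left (by grind)
  unfold DimIndep at h
  omega

theorem mono_right (h : DimIndep d A B C) (hd : IsDimension d) (hC : C' ⊆ B ∪ C) :
    DimIndep d A B C' := by
  unfold DimIndep at *
  have := hd.add_le_add_of_subset (A := A ∪ B ∪ C') (B := B ∪ C) (C := B ∪ C') (D := A ∪ B ∪ C)
    (by grind) (by grind) (by grind)
  omega

theorem mono (h : DimIndep d A B C) (hd : IsDimension d) (hA : A' ⊆ A ∪ B) (hC : C' ⊆ B ∪ C) :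
    DimIndep d A' B C' :=
  ((h.mono_right hd hC).symm.mono_right hd (by rwa [Finset.union_comm])).symm

theorem sub_eq (h : DimIndep d A B C) (hd : IsDimension d) (hC : C' ⊆ C) (hB : B ⊆ C')
    (hA : A' ⊆ A) : d (C' ∪ A') - d C' = d (B ∪ A') - d B := by
  have heq := (h.mono hd (hA.trans Finset.subset_union_left)
    (hC.trans Finset.subset_union_right)).add_eq hd
  rw [Finset.union_assoc, Finset.union_eq_right.2 hB, Finset.union_comm A' C',
    Finset.union_comm A' B] at heq
  linarith

theorem enlarge_base (h : DimIndep d A B C) (hd : IsDimension d) (hB : B ⊆ B')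
    (hB' : B' ⊆ B ∪ C) : DimIndep d A B' C := by
  have h₁ := (h.mono_right hd hB').add_eq hd
  have h₂ := h.add_eq hd
  rw [show A ∪ B ∪ B' = A ∪ B' by grind, Finset.union_eq_right.2 hB] at h₁
  unfold DimIndep
  rw [show A ∪ B' ∪ C = A ∪ B ∪ C by grind, show B' ∪ C = B ∪ C by grind]
  omega

theorem of_subset_dimClosure_right (h : DimIndep d A B C) (hd : IsDimension d)
    (hC : (C' : Set V) ⊆ dimClosure d (B ∪ C)) : DimIndep d A B C' := by
  have hCC' : DimIndep d A B (C ∪ C') := by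
    have := hd.union_eq hC
    have := hd.mono (A ∪ B ∪ C) (A ∪ B ∪ (C ∪ C')) (by grind)
    unfold DimIndep at *
    rw [← Finset.union_assoc B]
    omega
  exact hCC'.mono_right hd (by grind)

theorem dimClosure_inter_subset (h : DimIndep d A B C) (hd : IsDimension d) (hA : B ⊆ A)
    (hC : B ⊆ C) : dimClosure d A ∩ dimClosure d C ⊆ dimClosure d B := by
  rintro x ⟨hxA, hxC⟩
  rw [hd.mem_dimClosure_iff] at *
  have := hd.add_le_add_of_subset (A := insert x A) (B := insert x C) (C := insert x B)
    (D := A ∪ C) (Finset.insert_subset_insert _ hA) (Finset.insert_subset_insert _ hC) (by grind)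
  unfold DimIndep at h
  rw [Finset.union_eq_left.2 hA, Finset.union_eq_right.2 hC] at h
  omega

end DimIndep

end Dimension

/-! ### Groups acting with a stationary independence relation -/

section DimAction

variable {Γ V : Type*} [Group Γ] [MulAction Γ V] [DecidableEq V] {d : Finset V → ℤ}

/-- `h` fixes the closure of `B` pointwise. -/
def FixesClosure (d : Finset V → ℤ) (B : Finset V) (h : Γ) : Prop :=
  ∀ x ∈ dimClosure d B, h • x = x

/-- `f'` is a conjugate of `f` over `P`, that is, by an element fixing the closure of `P`. -/
def ConjOver (d : Finset V → ℤ) (P : Finset V) (f f' : Γ) : Prop :=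
  ∃ b : Γ, FixesClosure d P b ∧ f' = b * f * b⁻¹

/-- A group `Γ` acting on `V` with an invariant dimension function whose independence relation has
extensions (`exists_indep`) and is stationary (`exists_extension`), every nontrivial element of
which moves all types over finite sets as independently as possible (`exists_moved`), and which
contains the limits of its convergent sequences (`exists_limit`). -/
structure DimAction (Γ : Type*) {V : Type*} [Group Γ] [MulAction Γ V] [DecidableEq V]
    (d : Finset V → ℤ) : Prop where
  isDimension : IsDimension d
  dim_smul : ∀ (g : Γ) (A : Finset V), d (g • A) = d A
  exists_indep : ∀ A B C : Finset V, ∃ h : Γ, FixesClosure d B h ∧ DimIndep d (h • A) B C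
  exists_extension : ∀ (A B C : Finset V) (h : Γ), B ⊆ A → B ⊆ C → FixesClosure d B h →
    DimIndep d A B C → DimIndep d (h • A) B C →
    ∃ k : Γ, (∀ x ∈ dimClosure d A, k • x = h • x) ∧ FixesClosure d C k
  exists_moved : ∀ f : Γ, f ≠ 1 → ∀ X A : Finset V, ∃ h : Γ, FixesClosure d X h ∧
    DimIndep d (h • A) X (f • X ∪ f • h • A) ∧ DimIndep d (f • h • A) (f • X) (X ∪ h • A)
  exists_limit : ∀ (p : ℕ → Γ) (F : ℕ → Finset V), Monotone F → (∀ x, ∃ i, x ∈ F i) →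
    (∀ i, ∀ x ∈ F i, p (i + 1) • x = p i • x) → (∀ x, ∃ i, (p i)⁻¹ • x ∈ F i) →
    ∃ q : Γ, ∀ i, ∀ x ∈ F i, q • x = p i • x
  fixesClosure_empty : ∀ g : Γ, FixesClosure d ∅ g

theorem smul_finset_congr {g h : Γ} {A : Finset V} (H : ∀ x ∈ A, g • x = h • x) :
    g • A = h • A :=
  Finset.image_congr H

namespace FixesClosure

variable {A B C : Finset V} {g h : Γ}

theorem mul (hg : FixesClosure d B g) (hh : FixesClosure d B h) : FixesClosure d B (g * h) :=
  fun x hx => by rw [mul_smul, hh x hx, hg x hx]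

theorem inv (hh : FixesClosure d B h) : FixesClosure d B h⁻¹ :=
  fun x hx => by rw [inv_smul_eq_iff, hh x hx]

theorem anti (hh : FixesClosure d C h) (hd : IsDimension d) (hB : B ⊆ C) : FixesClosure d B h :=
  fun x hx => hh x (hd.dimClosure_mono hB hx)

theorem smul_eq (hh : FixesClosure d B h) (hA : A ⊆ B) : h • A = A := by
  rw [smul_finset_congr (h := 1) fun x hx => by
    rw [hh x (subset_dimClosure d B (hA hx)), one_smul], one_smul]

end FixesClosure

namespace ConjOver

variable {P Q B : Finset V} {f f' f'' : Γ}

theorem trans (h : ConjOver d P f f') (h' : ConjOver d P f' f'') : ConjOver d P f f'' := by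
  obtain ⟨b, hb, rfl⟩ := h
  obtain ⟨c, hc, rfl⟩ := h'
  exact ⟨c * b, hc.mul hb, by group⟩

theorem inv (h : ConjOver d P f f') : ConjOver d P f⁻¹ f'⁻¹ := by
  obtain ⟨b, hb, rfl⟩ := h
  exact ⟨b, hb, by group⟩

theorem ne_one (h : ConjOver d P f f') (hf : f ≠ 1) : f' ≠ 1 := by
  obtain ⟨b, -, rfl⟩ := h
  exact mt conj_eq_one_iff.1 hf

theorem anti (h : ConjOver d Q f f') (hd : IsDimension d) (hP : P ⊆ Q) : ConjOver d P f f' := by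
  obtain ⟨b, hb, rfl⟩ := h
  exact ⟨b, hb.anti hd hP, rfl⟩

theorem smul_finset_eq (h : ConjOver d Q f f') (hB : B ⊆ Q) (hfB : f • B ⊆ Q) :
    f' • B = f • B := by
  obtain ⟨b, hb, rfl⟩ := h
  rw [mul_smul, mul_smul, hb.inv.smul_eq hB, hb.smul_eq hfB]

end ConjOver

namespace DimAction

theorem smul_mem_dimClosure_iff (hΓ : DimAction Γ d) {g : Γ} {A : Finset V} {x : V} :
    g • x ∈ dimClosure d (g • A) ↔ x ∈ dimClosure d A := by
  simp only [dimClosure, Set.mem_ofPred_eq, ← Finset.smul_finset_insert, hΓ.dim_smul]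

theorem smul_mem_dimClosure (hΓ : DimAction Γ d) (g : Γ) {A : Finset V} {x : V}
    (hx : x ∈ dimClosure d A) : g • x ∈ dimClosure d (g • A) :=
  hΓ.smul_mem_dimClosure_iff.2 hx

end DimAction

theorem ConjOver.smul_eq_of_mem_dimClosure {P A : Finset V} {f f' : Γ} (h : ConjOver d P f f')
    (hΓ : DimAction Γ d) (hA : A ⊆ P) (hfA : f • A ⊆ P) {x : V} (hx : x ∈ dimClosure d A) :
    f' • x = f • x := by
  obtain ⟨b, hb, rfl⟩ := h
  rw [mul_smul, mul_smul, hb.inv x (hΓ.isDimension.dimClosure_mono hA hx),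
    hb _ (hΓ.isDimension.dimClosure_mono hfA (hΓ.smul_mem_dimClosure f hx))]

namespace DimIndep

variable {A B C K : Finset V}

theorem smul (h : DimIndep d A B C) (hΓ : DimAction Γ d) (g : Γ) :
    DimIndep d (g • A) (g • B) (g • C) := by
  unfold DimIndep at *
  simpa only [← Finset.smul_finset_union, hΓ.dim_smul] using h

theorem smul_of_fixes (h : DimIndep d A B C) (hΓ : DimAction Γ d) {g : Γ}
    (hg : FixesClosure d K g) (hB : B ⊆ K) (hC : C ⊆ K) : DimIndep d (g • A) B C := by
  simpa only [hg.smul_eq hB, hg.smul_eq hC] using h.smul hΓ g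

end DimIndep

namespace DimAction

theorem exists_conjOver_moved (hΓ : DimAction Γ d) {f : Γ} (hf : f ≠ 1) (X A : Finset V) :
    ∃ f', ConjOver d X f f' ∧ DimIndep d A X (f' • X ∪ f' • A) ∧
      DimIndep d (f' • A) (f' • X) (X ∪ A) := by
  obtain ⟨h, hX, hA, hfA⟩ := hΓ.exists_moved f hf X A
  have hX₁ := hX.smul_eq subset_rfl
  have hX₂ := hX.inv.smul_eq subset_rfl
  refine ⟨h⁻¹ * f * h, ⟨h⁻¹, hX.inv, by rw [inv_inv]⟩, ?_, ?_⟩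
  · simpa only [Finset.smul_finset_union, inv_smul_smul, hX₂, mul_smul, hX₁] using hA.smul hΓ h⁻¹
  · simpa only [Finset.smul_finset_union, inv_smul_smul, hX₂, mul_smul, hX₁] using hfA.smul hΓ h⁻¹

theorem exists_conjOver_indep (hΓ : DimAction Γ d) {f : Γ} (hf : f ≠ 1) {K X A : Finset V}
    (hX : X ⊆ K) (hfX : f • X ⊆ K) (h : DimIndep d A X K) (R : Finset V) :
    ∃ f', ConjOver d K f f' ∧ DimIndep d (f' • A) (f • X) (K ∪ A ∪ R) := by
  obtain ⟨f₁, hf₁, -, hmoved⟩ := hΓ.exists_conjOver_moved hf K A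
  have hindep : DimIndep d (f₁ • A) (f • X) (K ∪ A) := by
    rw [← hf₁.smul_finset_eq hX hfX]
    exact ((h.smul hΓ f₁).trans_of_subset (Finset.smul_finset_subset_smul_finset hX)
      hmoved).mono_right hΓ.isDimension (by grind)
  obtain ⟨b, hb, hbR⟩ := hΓ.exists_indep (f₁ • A) (K ∪ A) R
  have hbA : (b * f₁ * b⁻¹) • A = b • f₁ • A := by
    rw [mul_smul, mul_smul, hb.inv.smul_eq Finset.subset_union_right]
  refine ⟨b * f₁ * b⁻¹, hf₁.trans ⟨b, hb.anti hΓ.isDimension (by grind), rfl⟩, ?_⟩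
  rw [hbA]
  exact (hindep.smul_of_fixes hΓ hb (by grind) subset_rfl).trans_of_subset (by grind) hbR

theorem exists_conjOver_eqOn (hΓ : DimAction Γ d) {f τ : Γ} (hf : f ≠ 1) {P X A : Finset V}
    (hXA : X ⊆ A) (hτ : ∀ x ∈ dimClosure d X, τ • x = f • x)
    (hA : DimIndep d A X (P ∪ f • X)) (hτA : DimIndep d (τ • A) (f • X) (P ∪ X ∪ A)) :
    ∃ f', ConjOver d P f f' ∧ ∀ x ∈ dimClosure d A, f' • x = τ • x := by
  have hd := hΓ.isDimension
  set K := P ∪ X ∪ f • X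
  obtain ⟨f₁, hf₁, hf₁A⟩ := hΓ.exists_conjOver_indep hf (K := K) (A := A) (by grind) (by grind)
    (hA.mono_right hd (by grind)) ∅
  rw [Finset.union_empty] at hf₁A
  have hf₁X : ∀ x ∈ dimClosure d X, f₁ • x = f • x := fun x =>
    hf₁.smul_eq_of_mem_dimClosure hΓ (by grind) (by grind)
  have hXf₁A : f • X ⊆ f₁ • A := by
    rw [← hf₁.smul_finset_eq (by grind) (by grind)]
    exact Finset.smul_finset_subset_smul_finset hXA
  have hfix : FixesClosure d (f • X) (τ * f₁⁻¹) := by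
    intro y hy
    obtain ⟨x, rfl⟩ : ∃ x, f • x = y := MulAction.surjective f y
    have hx := hΓ.smul_mem_dimClosure_iff.1 hy
    rw [mul_smul, ← hf₁X x hx, inv_smul_smul, hτ x hx, hf₁X x hx]
  have hτf₁A : (τ * f₁⁻¹) • f₁ • A = τ • A := by rw [mul_smul, inv_smul_smul]
  obtain ⟨c, hc, hcK⟩ := hΓ.exists_extension (f₁ • A) (f • X) (K ∪ A) (τ * f₁⁻¹) hXf₁A
    (by grind) hfix hf₁A (by rw [hτf₁A]; exact hτA.mono_right hd (by grind))
  refine ⟨c * f₁ * c⁻¹, (hf₁.anti hd (by grind)).trans ⟨c, hcK.anti hd (by grind), rfl⟩,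
    fun x hx => ?_⟩
  rw [mul_smul, mul_smul, hcK.inv x (hd.dimClosure_mono Finset.subset_union_right hx),
    hc _ (hΓ.smul_mem_dimClosure f₁ hx), mul_smul, inv_smul_smul]

end DimAction

end DimAction

section Words

variable {Γ V : Type*} [Group Γ] [MulAction Γ V] [DecidableEq V] {d : Finset V → ℤ}

namespace DimAction

theorem exists_conjOver_extend (hΓ : DimAction Γ d) {a₁ a₂ b₁ b₂ u : Γ} (ha₁ : a₁ ≠ 1)
    (ha₂ : a₂ ≠ 1) (hb₁ : b₁ ≠ 1) (hb₂ : b₂ ≠ 1) {P Z X : Finset V} (hP : P ⊆ Z)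
    (huP : P ⊆ u • Z) (hZX : Z ⊆ X) (hu : ∀ x ∈ dimClosure d Z, b₂ • b₁ • u • x = a₂ • a₁ • x)
    (ha : DimIndep d (a₁ • Z) Z (a₂ • a₁ • Z ∪ X))
    (hb : DimIndep d (b₁ • u • Z) (u • Z) (a₂ • a₁ • Z ∪ u • X)) :
    ∃ a₁' a₂' b₁' b₂', ConjOver d P a₁ a₁' ∧ ConjOver d P a₂ a₂' ∧ ConjOver d P b₁ b₁' ∧
      ConjOver d P b₂ b₂' ∧ ∀ x ∈ dimClosure d X, b₂' • b₁' • u • x = a₂' • a₁' • x := by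
  have hd := hΓ.isDimension
  set Z₁ := a₁ • Z
  set Z₂ := a₂ • Z₁
  set Z' := u • Z
  set Z₃ := b₁ • Z'
  have hb₂Z₃ : b₂ • Z₃ = Z₂ := by
    simp only [Z₃, Z', Z₂, Z₁, ← mul_smul]
    exact smul_finset_congr fun x hx => by
      simpa only [mul_smul] using hu x (subset_dimClosure d Z hx)
  obtain ⟨a₁', ca₁, ia₁⟩ := hΓ.exists_conjOver_indep ha₁ (K := Z ∪ Z₁) (X := Z) (A := X)
    (by grind) (by grind) (ha.symm.mono hd (by grind) (by grind)) (Z₂ ∪ Z₃ ∪ Z' ∪ u • X)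
  obtain ⟨b₁', cb₁, ib₁⟩ := hΓ.exists_conjOver_indep hb₁ (K := Z' ∪ Z₃) (X := Z') (A := u • X)
    (by grind) (by grind) (hb.symm.mono hd (by grind) (by grind)) (Z ∪ Z₁ ∪ Z₂ ∪ a₁' • X)
  obtain ⟨a₂', ca₂, ia₂⟩ := hΓ.exists_conjOver_indep ha₂ (K := P ∪ Z₁ ∪ Z₂) (X := Z₁)
    (A := a₁' • X) (by grind) (by grind) (ia₁.mono_right hd (by grind)) (Z₃ ∪ b₁' • u • X)
  have hZ₃ : Z₃ ⊆ b₁' • u • X := by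
    rw [show Z₃ = b₁' • Z' from (cb₁.smul_finset_eq (by grind) (by grind)).symm]
    exact Finset.smul_finset_subset_smul_finset (Finset.smul_finset_subset_smul_finset hZX)
  have hτ : ∀ y ∈ dimClosure d Z₃, (a₂' * a₁' * (b₁' * u)⁻¹) • y = b₂ • y := by
    intro y hy
    obtain ⟨x, rfl⟩ : ∃ x, b₁ • u • x = y := ⟨u⁻¹ • b₁⁻¹ • y, by simp only [smul_inv_smul]⟩
    have hx : x ∈ dimClosure d Z := hΓ.smul_mem_dimClosure_iff.1 (hΓ.smul_mem_dimClosure_iff.1 hy)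
    rw [← cb₁.smul_eq_of_mem_dimClosure hΓ (A := Z') (by grind) (by grind)
      (hΓ.smul_mem_dimClosure u hx), ← mul_smul b₁', mul_smul _ _ ((b₁' * u) • x), inv_smul_smul,
      mul_smul, ca₁.smul_eq_of_mem_dimClosure hΓ (A := Z) (by grind) (by grind) hx,
      ca₂.smul_eq_of_mem_dimClosure hΓ (A := Z₁) (by grind) (by grind)
      (hΓ.smul_mem_dimClosure a₁ hx), mul_smul,
      cb₁.smul_eq_of_mem_dimClosure hΓ (A := Z') (by grind) (by grind)
      (hΓ.smul_mem_dimClosure u hx), hu x hx]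
  have hτX : (a₂' * a₁' * (b₁' * u)⁻¹) • b₁' • u • X = a₂' • a₁' • X := by
    rw [← mul_smul b₁', mul_smul, inv_smul_smul, mul_smul]
  obtain ⟨b₂', cb₂, hb₂'⟩ := hΓ.exists_conjOver_eqOn hb₂ (P := P) hZ₃ hτ
    (by rw [hb₂Z₃]; exact ib₁.mono_right hd (by grind))
    (by rw [hb₂Z₃, hτX]; exact ia₂.mono_right hd (by grind))
  refine ⟨a₁', a₂', b₁', b₂', ca₁.anti hd (by grind), ca₂.anti hd (by grind),
    cb₁.anti hd (by grind), cb₂, fun x hx => ?_⟩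
  rw [hb₂' _ (hΓ.smul_mem_dimClosure b₁' (hΓ.smul_mem_dimClosure u hx)), ← mul_smul b₁',
    mul_smul _ _ ((b₁' * u) • x), inv_smul_smul, mul_smul]

theorem exists_conjOver_indep_trajectory (hΓ : DimAction Γ d) {a₁ a₂ : Γ} {Z : Finset V}
    (h : DimIndep d (a₁ • Z) Z (a₂ • a₁ • Z)) (T : Finset V) :
    ∃ a₁' a₂', ConjOver d Z a₁ a₁' ∧ ConjOver d Z a₂ a₂' ∧
      (∀ x ∈ dimClosure d Z, a₂' • a₁' • x = a₂ • a₁ • x) ∧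
      DimIndep d (a₁' • Z) Z (a₂ • a₁ • Z ∪ T) := by
  have hd := hΓ.isDimension
  obtain ⟨c, hc, hcT⟩ := hΓ.exists_indep (a₁ • Z) (Z ∪ a₂ • a₁ • Z) T
  have hcZ : FixesClosure d Z c := hc.anti hd Finset.subset_union_left
  refine ⟨c * a₁ * c⁻¹, c * a₂ * c⁻¹, ⟨c, hcZ, rfl⟩, ⟨c, hcZ, rfl⟩, fun x hx => ?_, ?_⟩
  · simp only [mul_smul, inv_smul_smul]
    rw [hcZ.inv x hx]
    exact hc _ (hd.dimClosure_mono Finset.subset_union_right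
      (hΓ.smul_mem_dimClosure _ (hΓ.smul_mem_dimClosure _ hx)))
  · rw [mul_smul, mul_smul, hcZ.inv.smul_eq subset_rfl]
    exact (h.smul_of_fixes hΓ hc (by grind) (by grind)).trans hcT

theorem exists_conjOver_eqOn_of_indep (hΓ : DimAction Γ d) {a₁ a₂ b₁ b₂ u : Γ} (ha₁ : a₁ ≠ 1)
    (ha₂ : a₂ ≠ 1) (hb₁ : b₁ ≠ 1) (hb₂ : b₂ ≠ 1) {P Z : Finset V} (hP : P ⊆ Z)
    (huP : P ⊆ u • Z) (hu : ∀ x ∈ dimClosure d Z, b₂ • b₁ • u • x = a₂ • a₁ • x)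
    (ha : DimIndep d (a₁ • Z) Z (a₂ • a₁ • Z))
    (hb : DimIndep d (b₁ • u • Z) (u • Z) (b₂ • b₁ • u • Z)) (T : Finset V) :
    ∃ a₁' a₂' b₁' b₂', ConjOver d P a₁ a₁' ∧ ConjOver d P a₂ a₂' ∧ ConjOver d P b₁ b₁' ∧
      ConjOver d P b₂ b₂' ∧ ∀ x ∈ dimClosure d T, b₂' • b₁' • u • x = a₂' • a₁' • x := by
  have hd := hΓ.isDimension
  obtain ⟨c₁, c₂, hc₁, hc₂, hc, hcT⟩ := hΓ.exists_conjOver_indep_trajectory ha (Z ∪ T)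
  obtain ⟨e₁, e₂, he₁, he₂, he, heT⟩ := hΓ.exists_conjOver_indep_trajectory hb (u • (Z ∪ T))
  have hcZ : c₂ • c₁ • Z = a₂ • a₁ • Z := by
    simp only [← mul_smul]
    exact smul_finset_congr fun x hx => by
      simpa only [mul_smul] using hc x (subset_dimClosure d Z hx)
  have huZ : b₂ • b₁ • u • Z = a₂ • a₁ • Z := by
    simp only [← mul_smul]
    exact smul_finset_congr fun x hx => by
      simpa only [mul_smul] using hu x (subset_dimClosure d Z hx)
  obtain ⟨a₁', a₂', b₁', b₂', ca₁, ca₂, cb₁, cb₂, hX⟩ := hΓ.exists_conjOver_extend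
    (hc₁.ne_one ha₁) (hc₂.ne_one ha₂) (he₁.ne_one hb₁) (he₂.ne_one hb₂) hP huP
    (Finset.subset_union_left (s₂ := T))
    (fun x hx => by rw [he _ (hΓ.smul_mem_dimClosure u hx), hu x hx, hc x hx])
    (by rwa [hcZ]) (by rwa [hcZ, ← huZ])
  exact ⟨a₁', a₂', b₁', b₂', (hc₁.anti hd hP).trans ca₁, (hc₂.anti hd hP).trans ca₂,
    (he₁.anti hd huP).trans cb₁, (he₂.anti hd huP).trans cb₂,
    fun x hx => hX x (hd.dimClosure_mono Finset.subset_union_right hx)⟩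

end DimAction

/-- The trajectory `Q ↦ a₁ • Q ↦ a₂ • a₁ • Q` is independent enough from `C` for `a₁` and `a₂` to
be conjugated over `Q` so that the images of some larger set contain `C`. -/
def CanAbsorb (d : Finset V → ℤ) (a₁ a₂ : Γ) (Q C : Finset V) : Prop :=
  DimIndep d (a₁ • Q) Q (a₂ • a₁ • Q ∪ C) ∧
    ∃ E ⊆ Q, a₂⁻¹ • E ⊆ Q ∧ DimIndep d C E (Q ∪ a₁ • Q ∪ a₂ • a₁ • Q)

namespace DimAction

theorem exists_conjOver_smul_smul_eq (hΓ : DimAction Γ d) {a₁ a₂ : Γ} (ha₂ : a₂ ≠ 1)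
    {Q C : Finset V} (h : CanAbsorb d a₁ a₂ Q C) :
    ∃ a₁' a₂' Z, ConjOver d Q a₁ a₁' ∧ ConjOver d Q a₂ a₂' ∧ Q ⊆ Z ∧
      a₂' • a₁' • Z = a₂ • a₁ • Q ∪ C ∧ DimIndep d (a₁' • Z) Z (a₂' • a₁' • Z) := by
  have hd := hΓ.isDimension
  obtain ⟨hD, E, hEQ, haE, hE⟩ := h
  set D := a₁ • Q with hDdef
  set A := a₂ • D with hAdef
  obtain ⟨b₂, hb₂, hb₂C⟩ := hΓ.exists_conjOver_indep (inv_ne_one.2 ha₂) (K := Q ∪ D ∪ A)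
    (by grind) (by grind) hE ∅
  have hb₂A : b₂ • A = D := by
    rw [hb₂.smul_finset_eq (by grind) (by rw [hAdef, inv_smul_smul]; grind), hAdef, inv_smul_smul]
  set Z₁ := D ∪ b₂ • C with hZ₁
  have hAC : DimIndep d (A ∪ C) Q Z₁ := by
    refine hD.symm.trans ?_
    exact (hb₂C.enlarge_base hd (B' := Q ∪ D) (by grind) (by grind)).symm.mono hd
      (by grind) (by grind)
  obtain ⟨c, hc, hcAC⟩ := hΓ.exists_indep (a₁⁻¹ • Z₁) (Q ∪ Z₁) (A ∪ C)
  have hQ : Q ⊆ c • a₁⁻¹ • Z₁ := by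
    rw [← hc.smul_eq (show Q ⊆ Q ∪ Z₁ by grind)]
    refine Finset.smul_finset_subset_smul_finset ?_
    rw [hZ₁, Finset.smul_finset_union, hDdef, inv_smul_smul]
    exact Finset.subset_union_left
  have hZ : (c * a₁ * c⁻¹) • c • a₁⁻¹ • Z₁ = Z₁ := by
    rw [mul_smul, mul_smul, inv_smul_smul, smul_inv_smul, hc.smul_eq (by grind)]
  have hb₂Z₁ : b₂⁻¹ • Z₁ = A ∪ C := by
    rw [hZ₁, Finset.smul_finset_union, inv_smul_smul, ← hb₂A, inv_smul_smul]
  refine ⟨c * a₁ * c⁻¹, b₂⁻¹, c • a₁⁻¹ • Z₁, ⟨c, hc.anti hd (by grind), rfl⟩, ?_, hQ, ?_, ?_⟩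
  · simpa only [inv_inv] using (hb₂.anti hd (by grind)).inv
  · rw [hZ, hb₂Z₁]
  · rw [hZ, hb₂Z₁]
    exact ((hAC.trans hcAC.symm).enlarge_base hd hQ (by grind)).symm.mono hd
      (by grind) (by grind)

theorem exists_conjOver_canAbsorb (hΓ : DimAction Γ d) {a₁ a₂ b₁ b₂ : Γ} (ha₁ : a₁ ≠ 1)
    (ha₂ : a₂ ≠ 1) (hb₁ : b₁ ≠ 1) (hb₂ : b₂ ≠ 1) (P : Finset V) :
    ∃ a₁' a₂' b₁' b₂' Q, ConjOver d P a₁ a₁' ∧ ConjOver d P a₂ a₂' ∧ ConjOver d P b₁ b₁' ∧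
      ConjOver d P b₂ b₂' ∧ P ⊆ Q ∧ CanAbsorb d a₁' a₂' Q (b₂' • b₁' • Q) ∧
      CanAbsorb d b₁' b₂' Q (a₂' • a₁' • Q) := by
  have hd := hΓ.isDimension
  set Q := P ∪ a₂ • P ∪ b₂ • P ∪ b₂⁻¹ • a₂ • P ∪ a₂⁻¹ • b₂ • P
  have hPQ : P ⊆ Q := by grind
  obtain ⟨a₁', ca₁, ia₁, -⟩ := hΓ.exists_conjOver_moved ha₁ P Q
  obtain ⟨b₁', cb₁, ib₁, -⟩ := hΓ.exists_conjOver_moved hb₁ P Q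
  set D := a₁' • Q
  set E := b₁' • Q
  obtain ⟨a₂', ca₂, ia₂⟩ := hΓ.exists_conjOver_indep ha₂ (A := D) hPQ (by grind)
    (ia₁.symm.mono hd (by grind) (by grind)) E
  obtain ⟨b₂', cb₂, ib₂⟩ := hΓ.exists_conjOver_indep hb₂ (A := E) hPQ (by grind)
    (ib₁.symm.mono hd (by grind) (by grind)) (D ∪ a₂' • D)
  set A := a₂' • D
  set B := b₂' • E
  have eA : a₂'⁻¹ • b₂ • P ⊆ Q := by
    rw [ca₂.inv.smul_finset_eq (by grind) (by grind)]; grind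
  have eB : b₂'⁻¹ • a₂ • P ⊆ Q := by
    rw [cb₂.inv.smul_finset_eq (by grind) (by grind)]; grind
  have iB : DimIndep d B Q (D ∪ A ∪ E) :=
    (ib₂.enlarge_base hd (B' := Q) (by grind) (by grind)).mono_right hd (by grind)
  have iA : DimIndep d A Q (D ∪ E) :=
    (ia₂.enlarge_base hd (B' := Q) (by grind) (by grind)).mono_right hd (by grind)
  have iDE : DimIndep d (D ∪ E) Q (A ∪ B) := by
    refine (iA.symm.mono hd (by grind) (by grind)).trans ?_
    exact (iB.enlarge_base hd (B' := Q ∪ A) (by grind) (by grind)).symm.mono hd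
      (by grind) (by grind)
  have iAE : DimIndep d A (a₂ • P) (Q ∪ E ∪ B) := by
    refine (ia₂.mono_right hd (C' := Q ∪ E) (by grind)).trans ?_
    exact (iB.enlarge_base hd (B' := a₂ • P ∪ (Q ∪ E)) (by grind) (by grind)).symm.mono hd
      (by grind) (by grind)
  refine ⟨a₁', a₂', b₁', b₂', Q, ca₁, ca₂.anti hd hPQ, cb₁, cb₂.anti hd hPQ, hPQ,
    ⟨iDE.mono hd (by grind) (by grind), b₂ • P, by grind, eA, ?_⟩,
    ⟨iDE.mono hd (by grind) (by grind), a₂ • P, by grind, eB, iAE⟩⟩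
  exact ib₂.mono_right hd (by grind)

theorem exists_conjOver_meet (hΓ : DimAction Γ d) {a₁ a₂ b₁ b₂ : Γ} (ha₁ : a₁ ≠ 1)
    (ha₂ : a₂ ≠ 1) (hb₁ : b₁ ≠ 1) (hb₂ : b₂ ≠ 1) (P : Finset V) :
    ∃ a₁' a₂' b₁' b₂' Z Z', ConjOver d P a₁ a₁' ∧ ConjOver d P a₂ a₂' ∧ ConjOver d P b₁ b₁' ∧
      ConjOver d P b₂ b₂' ∧ P ⊆ Z ∧ P ⊆ Z' ∧ b₂' • b₁' • Z' = a₂' • a₁' • Z ∧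
      DimIndep d (a₁' • Z) Z (a₂' • a₁' • Z) ∧ DimIndep d (b₁' • Z') Z' (b₂' • b₁' • Z') := by
  have hd := hΓ.isDimension
  obtain ⟨a₁', a₂', b₁', b₂', Q, ca₁, ca₂, cb₁, cb₂, hPQ, hA, hB⟩ :=
    hΓ.exists_conjOver_canAbsorb ha₁ ha₂ hb₁ hb₂ P
  obtain ⟨a₁'', a₂'', Z, ca₁', ca₂', hZ, haZ, iZ⟩ :=
    hΓ.exists_conjOver_smul_smul_eq (ca₂.ne_one ha₂) hA
  obtain ⟨b₁'', b₂'', Z', cb₁', cb₂', hZ', hbZ', iZ'⟩ :=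
    hΓ.exists_conjOver_smul_smul_eq (cb₂.ne_one hb₂) hB
  exact ⟨a₁'', a₂'', b₁'', b₂'', Z, Z', ca₁.trans (ca₁'.anti hd hPQ),
    ca₂.trans (ca₂'.anti hd hPQ), cb₁.trans (cb₁'.anti hd hPQ), cb₂.trans (cb₂'.anti hd hPQ),
    hPQ.trans hZ, hPQ.trans hZ', by rw [haZ, hbZ', Finset.union_comm], iZ, iZ'⟩

end DimAction

end Words

section Products

variable {Γ V : Type*} [Group Γ] [MulAction Γ V] [DecidableEq V] {d : Finset V → ℤ}

/-- The family of conjugates `h i * g * (h i)⁻¹` of `g`. -/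
def conjFamily (g : Γ) (h : Fin 4 → Γ) : Fin 4 → Γ :=
  fun i => h i * g * (h i)⁻¹

/-- The quotient of the half-words `c₃ c₂` and `c₁ c₀`. Solving for this quotient amounts to making
two half-words agree. -/
def word (c : Fin 4 → Γ) : Γ :=
  (c 3 * c 2)⁻¹ * (c 1 * c 0)

/-- `h'` arises from `h` by left multiplication with elements fixing the closure of `P`. -/
def Near (d : Finset V → ℤ) (P : Finset V) (h h' : Fin 4 → Γ) : Prop :=
  ∀ i, ∃ b : Γ, FixesClosure d P b ∧ h' i = b * h i

/-- Every element agreeing with the word in the conjugates `conjFamily g h` on the closure of `Y`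
can be approximated by words in `conjFamily g h'` with `h'` near `h`. -/
def Adjustable (d : Finset V → ℤ) (g : Γ) (h : Fin 4 → Γ) (P Y : Finset V) : Prop :=
  ∀ u : Γ, (∀ x ∈ dimClosure d Y, word (conjFamily g h) • x = u • x) →
    ∀ T : Finset V, ∃ h', Near d P h h' ∧
      ∀ x ∈ dimClosure d T, word (conjFamily g h') • x = u • x

omit [DecidableEq V] in
theorem word_smul_eq_iff {c : Fin 4 → Γ} {x y : V} :
    word c • x = y ↔ c 3 • c 2 • y = c 1 • c 0 • x := by
  rw [word, mul_smul, inv_smul_eq_iff, eq_comm, mul_smul, mul_smul]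

namespace Near

variable {g : Γ} {P Q : Finset V} {h h' h'' : Fin 4 → Γ}

theorem trans (hh' : Near d P h h') (hh'' : Near d P h' h'') : Near d P h h'' := fun i => by
  obtain ⟨b, hb, e⟩ := hh' i
  obtain ⟨c, hc, e'⟩ := hh'' i
  exact ⟨c * b, hc.mul hb, by rw [e', e, mul_assoc]⟩

theorem anti (hh' : Near d Q h h') (hd : IsDimension d) (hP : P ⊆ Q) : Near d P h h' := fun i => by
  obtain ⟨b, hb, e⟩ := hh' i
  exact ⟨b, hb.anti hd hP, e⟩

theorem smul_eq (hh' : Near d P h h') {F : Finset V} {i : Fin 4} (hF : h i • F ⊆ P) :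
    h' i • F = h i • F := by
  obtain ⟨b, hb, e⟩ := hh' i
  rw [e, mul_smul, hb.smul_eq hF]

theorem conjOver (hh' : Near d P h h') (i : Fin 4) :
    ConjOver d P (conjFamily g h i) (conjFamily g h' i) := by
  obtain ⟨b, hb, e⟩ := hh' i
  exact ⟨b, hb, by rw [conjFamily, conjFamily, e]; group⟩

end Near

theorem exists_near_conjFamily_eq {g : Γ} {P : Finset V} {h c : Fin 4 → Γ}
    (H : ∀ i, ConjOver d P (conjFamily g h i) (c i)) :
    ∃ h', Near d P h h' ∧ conjFamily g h' = c := by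
  choose b hb e using H
  exact ⟨fun i => b i * h i, fun i => ⟨b i, hb i, rfl⟩, funext fun i => by
    rw [e, conjFamily, conjFamily]; group⟩

theorem conjFamily_ne_one {g : Γ} (hg : g ≠ 1) (h : Fin 4 → Γ) (i : Fin 4) :
    conjFamily g h i ≠ 1 :=
  mt conj_eq_one_iff.1 hg

theorem Adjustable.mono {g : Γ} {h : Fin 4 → Γ} {P Y Y' : Finset V} (H : Adjustable d g h P Y)
    (hd : IsDimension d) (hY : Y ⊆ Y') : Adjustable d g h P Y' :=
  fun u hu => H u fun x hx => hu x (hd.dimClosure_mono hY hx)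

namespace DimAction

theorem adjustable_of_indep (hΓ : DimAction Γ d) {g : Γ} (hg : g ≠ 1) {h c : Fin 4 → Γ}
    (hc : conjFamily g h = c) {P Z Z' : Finset V} (hPZ : P ⊆ Z) (hPZ' : P ⊆ Z')
    (hZ : c 3 • c 2 • Z' = c 1 • c 0 • Z) (h₀ : DimIndep d (c 0 • Z) Z (c 1 • c 0 • Z))
    (h₂ : DimIndep d (c 2 • Z') Z' (c 3 • c 2 • Z')) : Adjustable d g h P Z := by
  subst hc
  intro u hu T
  have huZ : u • Z = Z' := by
    rw [← smul_finset_congr fun x hx => hu x (subset_dimClosure d Z hx), word, mul_smul,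
      inv_smul_eq_iff, mul_smul, mul_smul, hZ]
  rw [← huZ] at hPZ' h₂
  have hne := conjFamily_ne_one hg h
  obtain ⟨a₁, a₂, b₁, b₂, ca₁, ca₂, cb₁, cb₂, hT⟩ := hΓ.exists_conjOver_eqOn_of_indep (hne 0)
    (hne 1) (hne 2) (hne 3) hPZ hPZ' (fun x hx => word_smul_eq_iff.1 (hu x hx)) h₀ h₂ T
  obtain ⟨h', hh', e⟩ := exists_near_conjFamily_eq (c := ![a₁, a₂, b₁, b₂])
    (Fin.forall_fin_succ.2 ⟨ca₁, Fin.forall_fin_succ.2 ⟨ca₂, Fin.forall_fin_two.2 ⟨cb₁, cb₂⟩⟩⟩)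
  exact ⟨h', hh', fun x hx => word_smul_eq_iff.2 (by rw [e]; exact hT x hx)⟩

theorem adjustable_empty (hΓ : DimAction Γ d) {g : Γ} (hg : g ≠ 1) (h : Fin 4 → Γ) :
    Adjustable d g h ∅ ∅ :=
  hΓ.adjustable_of_indep hg rfl subset_rfl subset_rfl (by simp only [Finset.smul_finset_empty])
    (by simpa only [Finset.smul_finset_empty] using .of_base d ∅ ∅)
    (by simpa only [Finset.smul_finset_empty] using .of_base d ∅ ∅)

theorem exists_adjustable (hΓ : DimAction Γ d) {g : Γ} (hg : g ≠ 1) (h : Fin 4 → Γ)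
    (P : Finset V) : ∃ h' Y, Near d P h h' ∧ Adjustable d g h' P Y := by
  have hne := conjFamily_ne_one hg h
  obtain ⟨a₁, a₂, b₁, b₂, Z, Z', ca₁, ca₂, cb₁, cb₂, hZ, hZ', hZZ', ha, hb⟩ :=
    hΓ.exists_conjOver_meet (hne 0) (hne 1) (hne 2) (hne 3) P
  obtain ⟨h', hh', e⟩ := exists_near_conjFamily_eq (c := ![a₁, a₂, b₁, b₂])
    (Fin.forall_fin_succ.2 ⟨ca₁, Fin.forall_fin_succ.2 ⟨ca₂, Fin.forall_fin_two.2 ⟨cb₁, cb₂⟩⟩⟩)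
  exact ⟨h', Z, hh', hΓ.adjustable_of_indep hg e hZ hZ' hZZ' ha hb⟩

theorem exists_forall_near_word_smul_eq (hΓ : DimAction Γ d) (g : Γ) (h : Fin 4 → Γ)
    (Y : Finset V) : ∃ P, ∀ h', Near d P h h' → ∀ x ∈ dimClosure d Y,
      word (conjFamily g h') • x = word (conjFamily g h) • x := by
  set c := conjFamily g h
  set u := word c
  refine ⟨Y ∪ c 0 • Y ∪ c 1 • c 0 • Y ∪ (u • Y ∪ c 2 • u • Y ∪ c 3 • c 2 • u • Y),
    fun h' hh' x hx => ?_⟩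
  rw [word_smul_eq_iff]
  have hc : ∀ i, ConjOver d _ (c i) (conjFamily g h' i) := hh'.conjOver
  have hx₀ := hΓ.smul_mem_dimClosure (c 0) hx
  have hu := hΓ.smul_mem_dimClosure u hx
  have hu₂ := hΓ.smul_mem_dimClosure (c 2) hu
  rw [(hc 0).smul_eq_of_mem_dimClosure hΓ (by grind) (by grind) hx,
    (hc 1).smul_eq_of_mem_dimClosure hΓ (by grind) (by grind) hx₀,
    (hc 2).smul_eq_of_mem_dimClosure hΓ (by grind) (by grind) hu,
    (hc 3).smul_eq_of_mem_dimClosure hΓ (by grind) (by grind) hu₂]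
  exact word_smul_eq_iff.1 rfl

end DimAction

/-- The pair `(P', h')` refines `(P, h)`: `h'` is near `h`, and the new base contains `F` and its
images under `h'`, so that later refinements no longer change `h'` on `F` nor `h'⁻¹` on `F`. -/
structure Refines (d : Finset V → ℤ) (F P : Finset V) (h : Fin 4 → Γ) (P' : Finset V)
    (h' : Fin 4 → Γ) : Prop where
  near : Near d P h h'
  base_subset : P ⊆ P'
  subset : F ⊆ P'
  smul_subset : ∀ i, h' i • F ⊆ P'

theorem Refines.trans_near {F P P' : Finset V} {h h' h'' : Fin 4 → Γ}
    (H : Refines d F P h P' h') (hd : IsDimension d) (hh : Near d P' h' h'') :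
    Refines d F P h P' h'' where
  near := H.near.trans (hh.anti hd H.base_subset)
  base_subset := H.base_subset
  subset := H.subset
  smul_subset i := by rw [hh.smul_eq (H.smul_subset i)]; exact H.smul_subset i

theorem Near.trans_refines {F P P' : Finset V} {h h' h'' : Fin 4 → Γ} (hh : Near d P h h')
    (H : Refines d F P h' P' h'') : Refines d F P h P' h'' where
  near := hh.trans H.near
  base_subset := H.base_subset
  subset := H.subset
  smul_subset := H.smul_subset

/-- An approximate solution `left`, `right` of the equation
`word (conjFamily g left) = word (conjFamily g right) * k`, valid on the closure of `domain`. The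
left-hand side can be adjusted without changing it on `leftBase`; `rightBase` is the part of the
right-hand side that has been decided. -/
structure ApproxSol (d : Finset V → ℤ) (g k : Γ) where
  left : Fin 4 → Γ
  right : Fin 4 → Γ
  leftBase : Finset V
  rightBase : Finset V
  domain : Finset V
  adjustable : Adjustable d g left leftBase domain
  eqOn : ∀ x ∈ dimClosure d domain,
    word (conjFamily g left) • x = word (conjFamily g right) • k • x

namespace DimAction

theorem exists_refines_right (hΓ : DimAction Γ d) {g k : Γ} (hg : g ≠ 1) {h h' : Fin 4 → Γ}
    {P Y : Finset V} (Q F : Finset V) (hadj : Adjustable d g h P Y)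
    (heq : ∀ x ∈ dimClosure d Y,
      word (conjFamily g h) • x = word (conjFamily g h') • k • x) :
    ∃ h₁ h₁' P' Y', Near d P h h₁ ∧ Refines d F Q h' P' h₁' ∧ F ⊆ Y' ∧
      Adjustable d g h₁' P' Y' ∧ ∀ x ∈ dimClosure d Y',
        word (conjFamily g h₁') • x = word (conjFamily g h₁) • k⁻¹ • x := by
  have hd := hΓ.isDimension
  obtain ⟨P₀, hP₀⟩ := hΓ.exists_forall_near_word_smul_eq g h' (k • Y)
  set P' := Q ∪ F ∪ P₀ ∪ Finset.univ.biUnion fun i => h' i • F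
  have hF (i : Fin 4) : h' i • F ⊆ P' :=
    (Finset.subset_biUnion_of_mem (fun i => h' i • F) (Finset.mem_univ i)).trans
      Finset.subset_union_right
  obtain ⟨h₁', Y₀, hh', hadj'⟩ := hΓ.exists_adjustable hg h' P'
  obtain ⟨h₁, hh, e⟩ := hadj (word (conjFamily g h₁') * k) (fun x hx => by
    rw [heq x hx, mul_smul]
    exact (hP₀ h₁' (hh'.anti hd (by grind)) _ (hΓ.smul_mem_dimClosure k hx)).symm)
    (k⁻¹ • (Y₀ ∪ F))
  refine ⟨h₁, h₁', P', Y₀ ∪ F, hh, ⟨hh'.anti hd (by grind), by grind, by grind, fun i => ?_⟩,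
    Finset.subset_union_right, hadj'.mono hd Finset.subset_union_left, fun x hx => ?_⟩
  · rw [hh'.smul_eq (hF i)]
    exact hF i
  · rw [e _ (hΓ.smul_mem_dimClosure k⁻¹ hx), mul_smul, smul_inv_smul]

theorem exists_refinement (hΓ : DimAction Γ d) {g k : Γ} (hg : g ≠ 1) (s : ApproxSol d g k)
    (F : Finset V) : ∃ t : ApproxSol d g k, Refines d F s.leftBase s.left t.leftBase t.left ∧
      Refines d F s.rightBase s.right t.rightBase t.right ∧ F ⊆ t.domain := by
  obtain ⟨h₁, h₁', Q', Y', hh₁, hQ', -, hadj', heq'⟩ :=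
    hΓ.exists_refines_right hg s.rightBase F s.adjustable s.eqOn
  obtain ⟨h₂', h₂, P', Y, hh₂', hP', hF, hadj, heq⟩ :=
    hΓ.exists_refines_right hg s.leftBase F hadj' heq'
  exact ⟨⟨h₂, h₂', P', Q', Y, hadj, by simpa only [inv_inv] using heq⟩, hh₁.trans_refines hP',
    hQ'.trans_near hΓ.isDimension hh₂', hF⟩

theorem exists_limit_of_refines (hΓ : DimAction Γ d) {F : ℕ → Finset V} (hF : Monotone F)
    (hF' : ∀ x, ∃ i, x ∈ F i) {P : ℕ → Finset V} {h : ℕ → Fin 4 → Γ}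
    (H : ∀ n, Refines d (F n) (P n) (h n) (P (n + 1)) (h (n + 1))) :
    ∃ q : Fin 4 → Γ, ∀ i (x : V), ∀ᶠ n in Filter.atTop,
      h n i • x = q i • x ∧ (h n i)⁻¹ • x = (q i)⁻¹ • x := by
  have hP : Monotone P := monotone_nat_of_le_succ fun n => (H n).base_subset
  have hinv (i : Fin 4) : ∃ q : Γ, ∀ n, ∀ x ∈ P n, q • x = (h n i)⁻¹ • x := by
    refine hΓ.exists_limit (fun n => (h n i)⁻¹) P hP (fun x => ?_) (fun n x hx => ?_) fun x => ?_
    · obtain ⟨j, hj⟩ := hF' x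
      exact ⟨j + 1, (H j).subset hj⟩
    · obtain ⟨b, hb, e⟩ := (H n).near i
      rw [e, mul_inv_rev, mul_smul, hb.inv x (subset_dimClosure d _ hx)]
    · obtain ⟨j, hj⟩ := hF' x
      exact ⟨j + 1, by
        rw [inv_inv]; exact (H j).smul_subset i (Finset.smul_mem_smul_finset hj)⟩
  choose q hq using hinv
  refine ⟨fun i => (q i)⁻¹, fun i x => ?_⟩
  obtain ⟨j, hj⟩ := hF' x
  filter_upwards [Filter.eventually_ge_atTop (j + 1)] with n hn
  obtain ⟨l, rfl⟩ : ∃ l, n = l + 1 := ⟨n - 1, by omega⟩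
  have hx : h (l + 1) i • x ∈ P (l + 1) :=
    (H l).smul_subset i (Finset.smul_mem_smul_finset (hF (by omega) hj))
  exact ⟨by rw [eq_inv_smul_iff, hq i _ _ hx, inv_smul_smul],
    by rw [inv_inv, hq i _ x (hP hn ((H j).subset hj))]⟩

end DimAction

omit [DecidableEq V] in
theorem eventually_word_smul_eq (g : Γ) {h : ℕ → Fin 4 → Γ} {q : Fin 4 → Γ}
    (H : ∀ i (x : V), ∀ᶠ n in Filter.atTop,
      h n i • x = q i • x ∧ (h n i)⁻¹ • x = (q i)⁻¹ • x) (x : V) :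
    ∀ᶠ n in Filter.atTop, word (conjFamily g (h n)) • x = word (conjFamily g q) • x := by
  have hconj (i : Fin 4) (x : V) :
      ∀ᶠ n in Filter.atTop, conjFamily g (h n) i • x = conjFamily g q i • x := by
    filter_upwards [H i x, H i (g • (q i)⁻¹ • x)] with n hx hgx
    simp only [conjFamily, mul_smul]
    rw [hx.2, hgx.1]
  set c := conjFamily g q
  filter_upwards [hconj 0 x, hconj 1 (c 0 • x), hconj 2 (word c • x),
    hconj 3 (c 2 • word c • x)] with n h₀ h₁ h₂ h₃
  rw [word_smul_eq_iff, h₀, h₁, h₂, h₃]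
  exact word_smul_eq_iff.1 rfl

omit [DecidableEq V] in
theorem exists_monotone_finset_cover (V : Type*) [Countable V] :
    ∃ F : ℕ → Finset V, Monotone F ∧ ∀ x, ∃ i, x ∈ F i := by
  obtain ⟨e, he⟩ := exists_injective_nat V
  refine ⟨fun n => ((Set.finite_Iio n).preimage he.injOn).toFinset, fun a b hab => ?_,
    fun x => ⟨e x + 1, by simp⟩⟩
  rw [Set.Finite.toFinset_subset_toFinset]
  exact Set.preimage_mono (Set.Iio_subset_Iio hab)

namespace DimAction

theorem exists_word_eq [Countable V] [FaithfulSMul Γ V] (hΓ : DimAction Γ d) {g : Γ} (hg : g ≠ 1)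
    (k : Γ) : ∃ q q' : Fin 4 → Γ, k = (word (conjFamily g q'))⁻¹ * word (conjFamily g q) := by
  obtain ⟨F, hF, hF'⟩ := exists_monotone_finset_cover V
  choose next hnextL hnextR hnextD using fun (s : ApproxSol d g k) => hΓ.exists_refinement hg s
  let s₀ : ApproxSol d g k := ⟨1, 1, ∅, ∅, ∅, hΓ.adjustable_empty hg 1, fun x hx => by
    rw [← mul_smul, hΓ.fixesClosure_empty _ x hx, hΓ.fixesClosure_empty _ x hx]⟩
  let s : ℕ → ApproxSol d g k := fun n => Nat.rec s₀ (fun n t => next t (F n)) n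
  obtain ⟨q, hq⟩ := hΓ.exists_limit_of_refines hF hF' (P := fun n => (s n).leftBase)
    (h := fun n => (s n).left) fun n => hnextL (s n) (F n)
  obtain ⟨q', hq'⟩ := hΓ.exists_limit_of_refines hF hF' (P := fun n => (s n).rightBase)
    (h := fun n => (s n).right) fun n => hnextR (s n) (F n)
  refine ⟨q, q', FaithfulSMul.eq_of_smul_eq_smul (α := V) fun x => ?_⟩
  obtain ⟨j, hj⟩ := hF' x
  obtain ⟨n, hn, hx, hkx⟩ := ((Filter.eventually_ge_atTop (j + 1)).and
    ((eventually_word_smul_eq g hq x).and (eventually_word_smul_eq g hq' (k • x)))).exists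
  obtain ⟨l, rfl⟩ : ∃ l, n = l + 1 := ⟨n - 1, by omega⟩
  have hxl : x ∈ (s (l + 1)).domain := hnextD (s l) (F l) (hF (by omega) hj)
  rw [mul_smul, eq_inv_smul_iff, ← hx, ← hkx]
  exact ((s (l + 1)).eqOn x (subset_dimClosure d _ hxl)).symm

end DimAction

theorem exists_list_prod_eq_word (g : Γ) (h : Fin 4 → Γ) :
    ∃ l : List Γ, l.length = 4 ∧ (∀ x ∈ l, IsConj g x ∨ IsConj g⁻¹ x) ∧
      l.prod = word (conjFamily g h) := by
  have hc (i : Fin 4) : IsConj g (conjFamily g h i) := isConj_iff.2 ⟨h i, rfl⟩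
  have hc' (i : Fin 4) : IsConj g⁻¹ (conjFamily g h i)⁻¹ :=
    isConj_iff.2 ⟨h i, by rw [conjFamily]; group⟩
  generalize conjFamily g h = c at hc hc' ⊢
  exact ⟨[(c 2)⁻¹, (c 3)⁻¹, c 1, c 0], rfl, by simp only [List.forall_mem_cons]; grind,
    by simp [word, mul_assoc]⟩

namespace DimAction

theorem exists_list_prod_eq [Countable V] [FaithfulSMul Γ V] (hΓ : DimAction Γ d) {g : Γ}
    (hg : g ≠ 1) (k : Γ) (N : ℕ) : ∃ l : List Γ, l.length = 8 + 2 * N ∧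
      (∀ x ∈ l, IsConj g x ∨ IsConj g⁻¹ x) ∧ l.prod = k := by
  obtain ⟨q, q', rfl⟩ := hΓ.exists_word_eq hg k
  obtain ⟨l, hl, hconj, hprod⟩ := exists_list_prod_eq_word g q
  obtain ⟨l', hl', hconj', hprod'⟩ := exists_list_prod_eq_word g q'
  have hinv : ∀ x ∈ (l'.map (·⁻¹)).reverse, IsConj g x ∨ IsConj g⁻¹ x := by
    simp only [List.mem_reverse, List.forall_mem_map]
    intro x hx
    rcases hconj' x hx with h | h
    · obtain ⟨c, rfl⟩ := isConj_iff.1 h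
      exact .inr (isConj_iff.2 ⟨c, by group⟩)
    · obtain ⟨c, rfl⟩ := isConj_iff.1 h
      exact .inl (isConj_iff.2 ⟨c, by group⟩)
  have hpad : ∀ x ∈ (List.replicate N [g, g⁻¹]).flatten, IsConj g x ∨ IsConj g⁻¹ x := by
    intro x hx
    obtain ⟨m, hm, hx⟩ := List.mem_flatten.1 hx
    rw [List.eq_of_mem_replicate hm, List.mem_pair] at hx
    rcases hx with rfl | rfl
    exacts [.inl (.refl _), .inr (.refl _)]
  refine ⟨(List.replicate N [g, g⁻¹]).flatten ++ ((l'.map (·⁻¹)).reverse ++ l), ?_, ?_, ?_⟩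
  · simp [hl, hl']; omega
  · simp only [List.forall_mem_append]
    exact ⟨hpad, hinv, hconj⟩
  · simp only [List.prod_append, List.prod_flatten, List.map_replicate, List.prod_replicate,
      ← List.prod_inv_reverse, hprod, hprod', List.prod_pair, mul_inv_cancel, one_pow, one_mul]

end DimAction

theorem isSimpleGroup_of_exists_list [Nontrivial Γ]
    (H : ∀ g : Γ, g ≠ 1 → ∀ k : Γ, ∃ l : List Γ, (∀ x ∈ l, IsConj g x ∨ IsConj g⁻¹ x) ∧
      l.prod = k) : IsSimpleGroup Γ where
  eq_bot_or_eq_top_of_normal N hN := by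
    refine N.bot_or_exists_ne_one.imp_right fun ⟨g, hgN, hg⟩ => N.eq_top_iff'.2 fun k => ?_
    obtain ⟨l, hl, rfl⟩ := H g hg k
    refine N.list_prod_mem fun x hx => ?_
    rcases hl x hx with h | h <;> obtain ⟨c, rfl⟩ := isConj_iff.1 h
    exacts [hN.conj_mem g hgN c, hN.conj_mem _ (N.inv_mem hgN) c]

end Products

/-! ### The predimension and the dimension of finite subsets of a hypergraph -/

namespace UHypergraph

section FinDimension

variable {r n m : ℕ} {V : Type*} {H : UHypergraph r V}

open Classical in
/-- The hyperedges contained in a finite set, as a `Finset`; compare `UHypergraph.edgesIn`. -/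
def finEdgesIn (H : UHypergraph r V) (A : Finset V) : Finset (Finset V) :=
  A.powerset.filter (· ∈ H.edges)

/-- The predimension of a finite set; compare `UHypergraph.predim`. -/
def finPredim (n m : ℕ) (H : UHypergraph r V) (A : Finset V) : ℤ :=
  n * A.card - m * (H.finEdgesIn A).card

/-- The hyperedges contained in `A ∪ B` but neither in `A` nor in `B`. -/
def crossEdges [DecidableEq V] (H : UHypergraph r V) (A B : Finset V) : Finset (Finset V) :=
  H.finEdgesIn (A ∪ B) \ (H.finEdgesIn A ∪ H.finEdgesIn B)

/-- Nonnegativity of the predimension: membership in `𝒞̄₀`, see `inC0_iff_predimNonneg`. -/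
def PredimNonneg (n m : ℕ) (H : UHypergraph r V) : Prop :=
  ∀ A, 0 ≤ H.finPredim n m A

/-- The dimension of a finite set, described as the least predimension of a finite superset; it
agrees with `UHypergraph.dim` by `PredimNonneg.dim_coe`. -/
def finDim (n m : ℕ) (H : UHypergraph r V) (A : Finset V) : ℤ :=
  sInf {x | ∃ B, A ⊆ B ∧ x = H.finPredim n m B}

/-- Strongness of a finite set, tested on finite supersets only; see `strong_coe_iff`. -/
def FinStrong (n m : ℕ) (H : UHypergraph r V) (Z : Finset V) : Prop :=
  ∀ B, Z ⊆ B → H.finPredim n m Z ≤ H.finPredim n m B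

theorem mem_finEdgesIn {A e : Finset V} : e ∈ H.finEdgesIn A ↔ e ⊆ A ∧ e ∈ H.edges := by
  simp [finEdgesIn]

theorem mem_crossEdges [DecidableEq V] {A B e : Finset V} :
    e ∈ H.crossEdges A B ↔ e ∈ H.edges ∧ e ⊆ A ∪ B ∧ ¬ e ⊆ A ∧ ¬ e ⊆ B := by
  simp only [crossEdges, Finset.mem_sdiff, Finset.mem_union, mem_finEdgesIn]
  tauto

theorem finPredim_union_add_inter [DecidableEq V] (n m : ℕ) (H : UHypergraph r V)
    (A B : Finset V) :
    H.finPredim n m (A ∪ B) + H.finPredim n m (A ∩ B) + m * (H.crossEdges A B).card =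
      H.finPredim n m A + H.finPredim n m B := by
  have hV := Finset.card_union_add_card_inter A B
  have hE := Finset.card_union_add_card_inter (H.finEdgesIn A) (H.finEdgesIn B)
  have hinter : H.finEdgesIn A ∩ H.finEdgesIn B = H.finEdgesIn (A ∩ B) := by
    ext e
    simp only [Finset.mem_inter, mem_finEdgesIn, Finset.subset_inter_iff]
    tauto
  have hcross : (H.crossEdges A B).card + (H.finEdgesIn A ∪ H.finEdgesIn B).card =
      (H.finEdgesIn (A ∪ B)).card := by
    refine Finset.card_sdiff_add_card_eq_card fun e he => ?_
    simp only [Finset.mem_union, mem_finEdgesIn] at he ⊢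
    grind
  rw [hinter] at hE
  unfold finPredim
  zify at hV hE hcross
  linear_combination (n : ℤ) * hV - (m : ℤ) * hE + (m : ℤ) * hcross

theorem finPredim_submod [DecidableEq V] (n m : ℕ) (H : UHypergraph r V) (A B : Finset V) :
    H.finPredim n m (A ∪ B) + H.finPredim n m (A ∩ B) ≤
      H.finPredim n m A + H.finPredim n m B := by
  rw [← H.finPredim_union_add_inter n m A B]
  exact le_add_of_nonneg_right (by positivity)

theorem finPredim_empty (n m : ℕ) (H : UHypergraph r V) (hr : r ≠ 0) :
    H.finPredim n m ∅ = 0 := by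
  have : H.finEdgesIn ∅ = ∅ := by
    refine Finset.eq_empty_of_forall_notMem fun e he => ?_
    obtain ⟨h, he⟩ := mem_finEdgesIn.1 he
    rw [Finset.subset_empty] at h
    subst h
    exact hr (H.card_edge _ he).symm
  simp [finPredim, this]

theorem finPredim_singleton_le (n m : ℕ) (H : UHypergraph r V) (v : V) :
    H.finPredim n m {v} ≤ n := by
  have : (0 : ℤ) ≤ m * (H.finEdgesIn {v}).card := by positivity
  simp only [finPredim, Finset.card_singleton]
  push_cast
  omega

theorem le_finDim {A : Finset V} {c : ℤ} (h : ∀ B, A ⊆ B → c ≤ H.finPredim n m B) :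
    c ≤ H.finDim n m A :=
  le_csInf ⟨_, A, subset_rfl, rfl⟩ (by rintro _ ⟨B, hB, rfl⟩; exact h B hB)

theorem FinStrong.finPredim_inter_le [DecidableEq V] {Z : Finset V} (h : H.FinStrong n m Z)
    (B : Finset V) : H.finPredim n m (B ∩ Z) ≤ H.finPredim n m B := by
  have := H.finPredim_submod n m B Z
  have := h (B ∪ Z) Finset.subset_union_right
  omega

theorem FinStrong.inter [DecidableEq V] {Y Z : Finset V} (hY : H.FinStrong n m Y)
    (hZ : H.FinStrong n m Z) : H.FinStrong n m (Y ∩ Z) := by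
  intro B hB
  have h₁ := hY.finPredim_inter_le B
  have h₂ := hZ.finPredim_inter_le (B ∩ Y)
  rw [Finset.inter_assoc, Finset.inter_eq_right.2 hB] at h₂
  exact h₂.trans h₁

namespace PredimNonneg

variable (hp : H.PredimNonneg n m)
include hp

theorem finDim_le {A B : Finset V} (h : A ⊆ B) : H.finDim n m A ≤ H.finPredim n m B :=
  csInf_le ⟨0, by rintro _ ⟨C, -, rfl⟩; exact hp C⟩ ⟨B, h, rfl⟩

theorem exists_finPredim_eq_finDim (A : Finset V) :
    ∃ Z, A ⊆ Z ∧ H.finPredim n m Z = H.finDim n m A := by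
  obtain ⟨Z, hZ, h⟩ := Int.csInf_mem (s := {x | ∃ B, A ⊆ B ∧ x = H.finPredim n m B})
    ⟨_, A, subset_rfl, rfl⟩ ⟨0, by rintro _ ⟨C, -, rfl⟩; exact hp C⟩
  exact ⟨Z, hZ, h.symm⟩

theorem isDimension [DecidableEq V] : IsDimension (H.finDim n m) where
  mono A B h := le_finDim fun _ hC => hp.finDim_le (h.trans hC)
  submod A B := by
    obtain ⟨Y, hY, hYA⟩ := hp.exists_finPredim_eq_finDim A
    obtain ⟨Z, hZ, hZB⟩ := hp.exists_finPredim_eq_finDim B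
    have := H.finPredim_submod n m Y Z
    have := hp.finDim_le (Finset.union_subset_union hY hZ)
    have := hp.finDim_le (Finset.inter_subset_inter hY hZ)
    omega

theorem finDim_nonneg (A : Finset V) : 0 ≤ H.finDim n m A :=
  le_finDim fun B _ => hp B

theorem finStrong_of_finPredim_le {Z : Finset V} (h : H.finPredim n m Z ≤ H.finDim n m Z) :
    H.FinStrong n m Z :=
  fun _ hB => h.trans (hp.finDim_le hB)

end PredimNonneg

theorem FinStrong.finDim_eq (hp : H.PredimNonneg n m) {Z : Finset V} (h : H.FinStrong n m Z) :
    H.finDim n m Z = H.finPredim n m Z :=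
  le_antisymm (hp.finDim_le subset_rfl) (le_finDim h)

theorem FinStrong.exists_hull_subset (hp : H.PredimNonneg n m) {D Y : Finset V}
    (hD : H.FinStrong n m D) (hY : Y ⊆ D) :
    ∃ T, Y ⊆ T ∧ T ⊆ D ∧ H.FinStrong n m T ∧ H.finPredim n m T = H.finDim n m Y := by
  classical
  obtain ⟨Z, hZ, hZY⟩ := hp.exists_finPredim_eq_finDim Y
  have hle : H.finPredim n m (Z ∩ D) ≤ H.finDim n m Y := hZY ▸ hD.finPredim_inter_le Z
  have hYZD := Finset.subset_inter hZ hY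
  exact ⟨Z ∩ D, hYZD, Finset.inter_subset_right,
    fun B hB => hle.trans (hp.finDim_le (hYZD.trans hB)), hle.antisymm (hp.finDim_le hYZD)⟩

namespace PredimNonneg

variable (hp : H.PredimNonneg n m)
include hp

theorem exists_hull (A : Finset V) :
    ∃ Z, A ⊆ Z ∧ H.FinStrong n m Z ∧ H.finPredim n m Z = H.finDim n m A := by
  obtain ⟨Z, hZ, h⟩ := hp.exists_finPredim_eq_finDim A
  exact ⟨Z, hZ, fun B hB => h.trans_le (hp.finDim_le (hZ.trans hB)), h⟩

theorem exists_least_hull (X : Finset V) :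
    ∃ Z, X ⊆ Z ∧ H.FinStrong n m Z ∧ H.finPredim n m Z = H.finDim n m X ∧
      ∀ Y, X ⊆ Y → H.FinStrong n m Y → Z ⊆ Y := by
  classical
  obtain ⟨Y, hXY, hY, hYX⟩ := hp.exists_hull X
  obtain ⟨Z, ⟨hXZ, hZ⟩, hmin⟩ := (measure (Finset.card (α := V))).wf.has_min
    {Z | X ⊆ Z ∧ H.FinStrong n m Z} ⟨Y, hXY, hY⟩
  have hleast : ∀ Y, X ⊆ Y → H.FinStrong n m Y → Z ⊆ Y := fun Y hXY hY =>
    Finset.inter_eq_left.1 <| Finset.eq_of_subset_of_card_le Finset.inter_subset_left <|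
      not_lt.1 <| hmin (Z ∩ Y) ⟨Finset.subset_inter hXZ hXY, hZ.inter hY⟩
  exact ⟨Z, hXZ, hZ, ((hZ Y (hleast Y hXY hY)).trans_eq hYX).antisymm (hp.finDim_le hXZ), hleast⟩

section FreeAmalgam

variable [DecidableEq V] {X Y : Finset V}
  (h : H.finPredim n m X + H.finPredim n m Y - H.finPredim n m (X ∩ Y) ≤ H.finDim n m (X ∪ Y))
include h

theorem finStrong_union : H.FinStrong n m (X ∪ Y) :=
  hp.finStrong_of_finPredim_le (by have := H.finPredim_submod n m X Y; omega)

theorem subset_or_subset_of_mem_edges (hm : m ≠ 0) {e : Finset V} (he : e ∈ H.edges)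
    (heXY : e ⊆ X ∪ Y) : e ⊆ X ∨ e ⊆ Y := by
  by_contra! hc
  have hcard : 0 < (H.crossEdges X Y).card :=
    Finset.card_pos.2 ⟨e, mem_crossEdges.2 ⟨he, heXY, hc.1, hc.2⟩⟩
  have : (0 : ℤ) < m * (H.crossEdges X Y).card := by positivity
  have := H.finPredim_union_add_inter n m X Y
  have := hp.finDim_le (subset_refl (X ∪ Y))
  omega

end FreeAmalgam

end PredimNonneg

theorem predim_coe (A : Finset V) : H.predim n m A = H.finPredim n m A := by
  have : H.edgesIn A = (H.finEdgesIn A : Set (Finset V)) := by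
    ext e
    simp [edgesIn, mem_finEdgesIn, and_comm]
  rw [predim, finPredim, this, Set.ncard_coe_finset, Set.ncard_coe_finset]

theorem inC0_iff_predimNonneg (hr : r ≠ 0) : H.InC0 n m ↔ H.PredimNonneg n m := by
  have h0 : H.predim n m ∅ = 0 := by
    rw [← Finset.coe_empty, predim_coe, H.finPredim_empty n m hr]
  refine ⟨fun h A => ?_, fun h X hX => ⟨Set.empty_subset _, fun B _ hB => ?_⟩⟩
  · have := (h A A.finite_toSet).2 A (Set.empty_subset _) subset_rfl
    rwa [h0, predim_coe] at this
  · lift B to Finset V using hX.subset hB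
    rw [h0, predim_coe]
    exact h B

theorem strong_coe_iff {Z : Finset V} : H.Strong n m Z ↔ H.FinStrong n m Z := by
  classical
  refine ⟨fun h B hB => ?_, fun h X hX => ⟨Set.inter_subset_left, fun B hB hB' => ?_⟩⟩
  · have := (h B B.finite_toSet).2 B Set.inter_subset_left subset_rfl
    rwa [Set.inter_eq_right.2 (Finset.coe_subset.2 hB), predim_coe, predim_coe] at this
  · lift X to Finset V using hX
    lift B to Finset V using X.finite_toSet.subset hB'
    have hXB : X ∩ Z = B ∩ Z := by
      rw [← Finset.coe_inter] at hB
      norm_cast at hB hB'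
      grind
    rw [← Finset.coe_inter, predim_coe, predim_coe, hXB]
    exact h.finPredim_inter_le B

theorem FinStrong.filter_of_strong {Z : Finset V} (hZ : H.FinStrong n m Z) {Y : Set V}
    [DecidablePred (· ∈ Y)] (hY : H.Strong n m Y) : H.FinStrong n m (Z.filter (· ∈ Y)) := by
  classical
  intro B hB
  have h := (hY Z Z.finite_toSet).2 ↑(B ∩ Z) ?_ (by simp)
  · rw [show (Z : Set V) ∩ Y = ↑(Z.filter (· ∈ Y)) by ext; simp, predim_coe, predim_coe] at h
    exact h.trans (hZ.finPredim_inter_le B)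
  · rintro x ⟨hxZ, hxY⟩
    exact Finset.mem_coe.2 (Finset.mem_inter.2 ⟨hB (Finset.mem_filter.2 ⟨hxZ, hxY⟩), hxZ⟩)

namespace PredimNonneg

variable (hp : H.PredimNonneg n m)
include hp

theorem exists_cl0_coe_eq (X : Finset V) :
    ∃ Z : Finset V, H.cl0 n m X = Z ∧ H.finPredim n m Z = H.finDim n m X := by
  classical
  obtain ⟨Z, hXZ, hZ, hZX, hleast⟩ := hp.exists_least_hull X
  have hZcl : (Z : Set V) ∈ {Y | ↑X ⊆ Y ∧ H.Strong n m Y} :=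
    ⟨Finset.coe_subset.2 hXZ, strong_coe_iff.2 hZ⟩
  refine ⟨Z, (Set.sInter_subset_of_mem hZcl).antisymm (Set.subset_sInter ?_), hZX⟩
  rintro Y ⟨hXY, hY⟩
  have hZY := hleast (Z.filter (· ∈ Y)) (fun x hx => Finset.mem_filter.2 ⟨hXZ hx, hXY hx⟩)
    (hZ.filter_of_strong hY)
  exact fun z hz => (Finset.mem_filter.1 (hZY hz)).2

theorem dim_coe (X : Finset V) : H.dim n m X = H.finDim n m X := by
  obtain ⟨Z, hcl, hZ⟩ := hp.exists_cl0_coe_eq X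
  rw [dim, hcl, predim_coe, hZ]

theorem clD_empty [DecidableEq V] : H.clD n m ∅ = dimClosure (H.finDim n m) ∅ := by
  ext a
  have h₀ := hp.dim_coe (∅ : Finset V)
  have h₁ := hp.dim_coe ({a} : Finset V)
  rw [Finset.coe_empty] at h₀
  rw [Finset.coe_singleton] at h₁
  simp only [clD, dimClosure, Set.mem_ofPred_eq, Set.empty_union, h₀, h₁, insert_empty_eq]

end PredimNonneg

end FinDimension

end UHypergraph

/-! ### Partial isomorphisms and automorphisms -/

namespace UHypergraph

section IsoOn

variable {r n m : ℕ} {U V W : Type*} [DecidableEq U] [DecidableEq V] [DecidableEq W]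
  {K : UHypergraph r W} {H : UHypergraph r V}

/-- `f` restricts to an isomorphism of the structure induced on `D` with the one on its image. -/
def IsoOn (K : UHypergraph r W) (H : UHypergraph r V) (f : W → V) (D : Finset W) : Prop :=
  Set.InjOn f D ∧ ∀ e, e ⊆ D → (e.image f ∈ H.edges ↔ e ∈ K.edges)

namespace IsoOn

variable {f : W → V} {A B D : Finset W}

omit [DecidableEq W] in
theorem mono (h : IsoOn K H f D) (hA : A ⊆ D) : IsoOn K H f A :=
  ⟨h.1.mono (Finset.coe_subset.2 hA), fun e he => h.2 e (he.trans hA)⟩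

omit [DecidableEq W] in
theorem comp {L : UHypergraph r U} {g : V → U} (hg : IsoOn H L g (D.image f))
    (h : IsoOn K H f D) : IsoOn K L (g ∘ f) D := by
  refine ⟨hg.1.comp h.1 fun x hx => Finset.mem_coe.2 (Finset.mem_image_of_mem f hx),
    fun e he => ?_⟩
  rw [← Finset.image_image, hg.2 _ (Finset.image_subset_image he), h.2 e he]

omit [DecidableEq W] in
theorem image_subset_image_iff (h : IsoOn K H f D) (hA : A ⊆ D) (hB : B ⊆ D) :
    A.image f ⊆ B.image f ↔ A ⊆ B := by
  have := h.1.image_subset_image_iff (Finset.coe_subset.2 hA) (Finset.coe_subset.2 hB)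
  rwa [← Finset.coe_image, ← Finset.coe_image, Finset.coe_subset, Finset.coe_subset] at this

omit [DecidableEq W] in
theorem finEdgesIn_image (h : IsoOn K H f D) :
    H.finEdgesIn (D.image f) = (K.finEdgesIn D).image (Finset.image f) := by
  ext e
  simp only [mem_finEdgesIn, Finset.mem_image]
  constructor
  · rintro ⟨hefD, he⟩
    obtain ⟨e, heD, rfl⟩ := Finset.subset_image_iff.1 hefD
    exact ⟨e, ⟨heD, (h.2 e heD).1 he⟩, rfl⟩
  · rintro ⟨e, ⟨heD, he⟩, rfl⟩
    exact ⟨Finset.image_subset_image heD, (h.2 e heD).2 he⟩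

omit [DecidableEq W] in
theorem finPredim_image (h : IsoOn K H f D) (hA : A ⊆ D) :
    H.finPredim n m (A.image f) = K.finPredim n m A := by
  have hinj : Set.InjOn (Finset.image f) (K.finEdgesIn A : Set (Finset W)) := by
    intro e he e' he' hee'
    have heD := (mem_finEdgesIn.1 he).1.trans hA
    have heD' := (mem_finEdgesIn.1 he').1.trans hA
    exact ((h.image_subset_image_iff heD heD').1 hee'.subset).antisymm
      ((h.image_subset_image_iff heD' heD).1 hee'.symm.subset)
  rw [finPredim, finPredim, (h.mono hA).finEdgesIn_image, Finset.card_image_of_injOn hinj,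
    Finset.card_image_of_injOn (h.mono hA).1]

theorem exists_inverse [Nonempty W] (h : IsoOn K H f D) :
    ∃ g : V → W, IsoOn H K g (D.image f) ∧ ∀ x ∈ D, g (f x) = x := by
  have hleft : ∀ x ∈ D, Function.invFunOn f D (f x) = x :=
    fun x hx => h.1.leftInvOn_invFunOn hx
  refine ⟨Function.invFunOn f D, ⟨?_, fun e he => ?_⟩, hleft⟩
  · rintro _ hfx _ hfy hxy
    obtain ⟨x, hx, rfl⟩ := Finset.mem_image.1 hfx
    obtain ⟨y, hy, rfl⟩ := Finset.mem_image.1 hfy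
    rw [← hleft x hx, hxy, hleft y hy]
  · obtain ⟨e, heD, rfl⟩ := Finset.subset_image_iff.1 he
    have hcomp : Set.EqOn (Function.invFunOn f D ∘ f) id e := fun x hx => hleft x (heD hx)
    rw [Finset.image_image, Finset.image_congr hcomp, Finset.image_id, h.2 e heD]

omit [DecidableEq W] in
theorem finDim_image (hK : K.PredimNonneg n m) (hH : H.PredimNonneg n m) (h : IsoOn K H f D)
    (hD : K.FinStrong n m D) (hfD : H.FinStrong n m (D.image f)) (hA : A ⊆ D) :
    H.finDim n m (A.image f) = K.finDim n m A := by
  apply le_antisymm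
  · obtain ⟨T, hAT, hTD, -, hT⟩ := hD.exists_hull_subset hK hA
    rw [← hT, ← h.finPredim_image hTD]
    exact hH.finDim_le (Finset.image_subset_image hAT)
  · obtain ⟨fT, hAT, hfT, -, hT⟩ := hfD.exists_hull_subset hH (Finset.image_subset_image hA)
    obtain ⟨T, hTD, rfl⟩ := Finset.subset_image_iff.1 hfT
    rw [← hT, h.finPredim_image hTD]
    exact hK.finDim_le ((h.image_subset_image_iff hA hTD).1 hAT)

omit [DecidableEq W] in
theorem finStrong_image (h : IsoOn K H f D) (hD : H.FinStrong n m (D.image f)) (hA : A ⊆ D)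
    (hAK : K.FinStrong n m A) : H.FinStrong n m (A.image f) := by
  intro B hB
  refine le_trans ?_ (hD.finPredim_inter_le B)
  obtain ⟨T, hTD, hT⟩ :=
    Finset.subset_image_iff.1 (Finset.inter_subset_right (s₁ := B) (s₂ := D.image f))
  have hAT : A.image f ⊆ T.image f :=
    hT ▸ Finset.subset_inter hB (Finset.image_subset_image hA)
  rw [← hT, h.finPredim_image hTD, h.finPredim_image hA]
  exact hAK T ((h.image_subset_image_iff hA hTD).1 hAT)

end IsoOn

theorem perm_inv_apply_self {α : Type*} (p : Equiv.Perm α) (x : α) : p⁻¹ (p x) = x :=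
  p.symm_apply_apply x

theorem perm_apply_inv_self {α : Type*} (p : Equiv.Perm α) (x : α) : p (p⁻¹ x) = x :=
  p.apply_symm_apply x

theorem image_inv_image (p : Equiv.Perm V) (A : Finset V) : (A.image p).image ⇑p⁻¹ = A :=
  inv_smul_smul p A

theorem image_image_inv (p : Equiv.Perm V) (A : Finset V) : (A.image ⇑p⁻¹).image p = A :=
  smul_inv_smul p A

/-- `p` is an automorphism of `H`, in terms of images; compare `UHypergraph.IsEmbedding`. -/
def IsAut (H : UHypergraph r V) (p : Equiv.Perm V) : Prop :=
  ∀ e : Finset V, e.image p ∈ H.edges ↔ e ∈ H.edges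

theorem isAut_iff_isEmbedding {p : Equiv.Perm V} :
    H.IsAut p ↔ H.IsEmbedding H p.toEmbedding := by
  simp only [IsAut, IsEmbedding, Finset.map_eq_image, Equiv.coe_toEmbedding]

theorem isAut_one : H.IsAut 1 := fun e => by
  rw [Equiv.Perm.coe_one, Finset.image_id]

namespace IsAut

variable {p : Equiv.Perm V}

theorem inv (hp : H.IsAut p) : H.IsAut p⁻¹ := fun e => by
  rw [← hp, image_image_inv]

theorem mul {q : Equiv.Perm V} (hp : H.IsAut p) (hq : H.IsAut q) : H.IsAut (p * q) := fun e => by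
  rw [Equiv.Perm.coe_mul, ← Finset.image_image, hp, hq]

theorem isoOn (hp : H.IsAut p) (D : Finset V) : IsoOn H H p D :=
  ⟨p.injective.injOn, fun e _ => hp e⟩

omit [DecidableEq W] in
theorem finPredim_image (hp : H.IsAut p) (A : Finset V) :
    H.finPredim n m (A.image p) = H.finPredim n m A :=
  (hp.isoOn A).finPredim_image subset_rfl

theorem finDim_image_le (hH : H.PredimNonneg n m) (hp : H.IsAut p) (A : Finset V) :
    H.finDim n m (A.image p) ≤ H.finDim n m A := by
  obtain ⟨Z, hAZ, hZ⟩ := hH.exists_finPredim_eq_finDim A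
  rw [← hZ, ← hp.finPredim_image]
  exact hH.finDim_le (Finset.image_subset_image hAZ)

theorem finDim_image (hH : H.PredimNonneg n m) (hp : H.IsAut p) (A : Finset V) :
    H.finDim n m (A.image p) = H.finDim n m A := by
  refine (hp.finDim_image_le hH A).antisymm ?_
  simpa only [image_inv_image] using hp.inv.finDim_image_le hH (A.image p)

theorem finStrong_image (hp : H.IsAut p) {A : Finset V} (hA : H.FinStrong n m A) :
    H.FinStrong n m (A.image p) := by
  intro B hB
  rw [hp.finPredim_image, ← hp.inv.finPredim_image B]
  refine hA _ ?_
  simpa only [image_inv_image] using Finset.image_subset_image (f := ⇑p⁻¹) hB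

end IsAut

end IsoOn

/-! ### Realizing strong extensions in the generic structure -/

section Realize

variable {r n m : ℕ} {U V W : Type*}

/-- The structure pulled back along an injection. -/
def comap [DecidableEq W] (K : UHypergraph r W) (f : U → W) (hf : Function.Injective f) :
    UHypergraph r U where
  edges := {e | e.image f ∈ K.edges}
  card_edge e he := by rw [← K.card_edge _ he, Finset.card_image_of_injective _ hf]

theorem isoOn_comap [DecidableEq W] (K : UHypergraph r W) {f : U → W}
    (hf : Function.Injective f) (D : Finset U) : IsoOn (K.comap f hf) K f D :=
  ⟨hf.injOn, fun _ _ => Iff.rfl⟩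

theorem PredimNonneg.comap [DecidableEq W] {K : UHypergraph r W} (hK : K.PredimNonneg n m)
    {f : U → W} (hf : Function.Injective f) : (K.comap f hf).PredimNonneg n m := by
  classical
  exact fun A => (hK (A.image f)).trans_eq ((isoOn_comap K hf A).finPredim_image subset_rfl)

/-- The hypergraph without edges. -/
def edgeless (r : ℕ) (W : Type*) : UHypergraph r W where
  edges := ∅
  card_edge _ h := h.elim

theorem predimNonneg_edgeless (r n m : ℕ) (W : Type*) : (edgeless r W).PredimNonneg n m := by
  intro A
  have : (edgeless r W).finEdgesIn A = ∅ := by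
    ext e
    simp [mem_finEdgesIn, edgeless]
  simp only [finPredim, this, Finset.card_empty, Nat.cast_zero, mul_zero, sub_zero]
  positivity

theorem PredimNonneg.finStrong_empty {H : UHypergraph r V} (hp : H.PredimNonneg n m)
    (hr : r ≠ 0) : H.FinStrong n m ∅ := fun B _ => by
  rw [finPredim_empty n m H hr]
  exact hp B

theorem isoOn_empty [DecidableEq V] {K : UHypergraph r W} {H : UHypergraph r V} (hr : r ≠ 0)
    (f : W → V) : IsoOn K H f ∅ := by
  refine ⟨by simp, fun e he => ?_⟩
  obtain rfl := Finset.subset_empty.1 he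
  exact iff_of_false (fun h => hr (H.card_edge _ h).symm) fun h => hr (K.card_edge _ h).symm

namespace IsGeneric

variable {H : UHypergraph r V} (hH : H.IsGeneric n m) (hr : r ≠ 0)
include hH hr

theorem predimNonneg : H.PredimNonneg n m :=
  (inC0_iff_predimNonneg hr).1 hH.inC0

theorem exists_realization_of_fintype [DecidableEq V] {W : Type} [Fintype W] [DecidableEq W]
    {S : Finset V} (hS : H.FinStrong n m S) {K : UHypergraph r W} (hK : K.PredimNonneg n m)
    {j : V → W} (hj : IsoOn H K j S) (hjS : K.FinStrong n m (S.image j)) :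
    ∃ f : W → V, IsoOn K H f Finset.univ ∧ (∀ x ∈ S, f (j x) = x) ∧
      H.FinStrong n m (Finset.univ.image f) := by
  let j' : (S : Set V) ↪ W := ⟨fun x => j x, hj.1.injective⟩
  obtain ⟨f, hf, hfj, hfs⟩ := hH.extension S S.finite_toSet (strong_coe_iff.2 hS) W K
    ((inC0_iff_predimNonneg hr).2 hK) j'
    (fun e => by
      have he : e.map (Function.Embedding.subtype (· ∈ (S : Set V))) ⊆ S := fun x hx => by
        obtain ⟨y, -, rfl⟩ := Finset.mem_map.1 hx
        exact y.2
      rw [show e.map j' = (e.map (Function.Embedding.subtype (· ∈ (S : Set V)))).image j by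
        rw [Finset.map_eq_image, Finset.map_eq_image, Finset.image_image]; rfl]
      exact hj.2 _ he)
    (by
      rw [show Set.range j' = ((S.image j : Finset W) : Set W) by
        rw [Finset.coe_image, Set.image_eq_range]; rfl]
      exact strong_coe_iff.2 hjS)
  refine ⟨f, ⟨f.injective.injOn, fun e _ => ?_⟩, fun x hx => hfj ⟨x, hx⟩, ?_⟩
  · rw [← Finset.map_eq_image, hf e]
  · rwa [← strong_coe_iff, Finset.coe_image, Finset.coe_univ, Set.image_univ]

theorem nonempty : Nonempty V := by
  classical
  have hK := predimNonneg_edgeless r n m (Fin 1)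
  obtain ⟨f, -⟩ := hH.exists_realization_of_fintype hr
    ((hH.predimNonneg hr).finStrong_empty hr) hK (isoOn_empty hr fun _ => 0)
    (by simpa only [Finset.image_empty] using hK.finStrong_empty hr)
  exact ⟨f 0⟩

theorem exists_realization [DecidableEq V] [DecidableEq W] {S : Finset V}
    (hS : H.FinStrong n m S) {K : UHypergraph r W} (hK : K.PredimNonneg n m) {D : Finset W}
    {j : V → W} (hj : IsoOn H K j S) (hjD : S.image j ⊆ D) (hjS : K.FinStrong n m (S.image j)) :
    ∃ f : W → V, IsoOn K H f D ∧ (∀ x ∈ S, f (j x) = x) ∧ H.FinStrong n m (D.image f) := by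
  obtain ⟨v⟩ := hH.nonempty hr
  obtain rfl | hD := D.eq_empty_or_nonempty
  · obtain rfl := Finset.image_eq_empty.1 (Finset.subset_empty.1 hjD)
    exact ⟨fun _ => v, isoOn_empty hr _, by simp,
      by simpa only [Finset.image_empty] using (hH.predimNonneg hr).finStrong_empty hr⟩
  let ι : Fin D.card → W := fun i => D.equivFin.symm i
  have hι : Function.Injective ι := Subtype.val_injective.comp D.equivFin.symm.injective
  have hιD : Finset.univ.image ι = D := by
    ext w
    refine ⟨fun h => ?_, fun h => Finset.mem_image.2 ⟨D.equivFin ⟨w, h⟩, by simp, by simp [ι]⟩⟩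
    obtain ⟨i, -, rfl⟩ := Finset.mem_image.1 h
    exact (D.equivFin.symm i).2
  have : Nonempty (Fin D.card) := Fin.pos_iff_nonempty.1 hD.card_pos
  obtain ⟨g, hg, hgι⟩ := (isoOn_comap K hι Finset.univ).exists_inverse
  have hgD : (Finset.univ.image ι).image g = Finset.univ := by
    have hcomp : Set.EqOn (g ∘ ι) id (Finset.univ : Finset (Fin D.card)) := hgι
    rw [Finset.image_image, Finset.image_congr hcomp, Finset.image_id]
  rw [hιD] at hg hgD
  obtain ⟨f, hf, hfj, hfs⟩ := hH.exists_realization_of_fintype hr hS (hK.comap hι)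
    ((hg.mono hjD).comp hj) (by
      rw [← Finset.image_image]
      refine hg.finStrong_image (fun B hB => ?_) hjD hjS
      rw [hgD] at hB ⊢
      rw [Finset.univ_subset_iff.1 hB])
  refine ⟨f ∘ g, (hgD ▸ hf).comp hg, hfj, ?_⟩
  rwa [← Finset.image_image, hgD]

end IsGeneric

end Realize

end UHypergraph

/-! ### Back and forth -/

section Chains

variable {V : Type*}

theorem exists_perm_of_chain {f : ℕ → V → V} {F : ℕ → Finset V} (hF : Monotone F)
    (hcov : ∀ x, ∃ i, x ∈ F i) (hf : ∀ i, ∀ x ∈ F i, f (i + 1) x = f i x)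
    (hinj : ∀ i, Set.InjOn (f i) (F i)) (hsurj : ∀ y, ∃ i, ∃ x ∈ F i, f i x = y) :
    ∃ p : Equiv.Perm V, ∀ i, ∀ x ∈ F i, p x = f i x := by
  have hstable : ∀ i k, ∀ x ∈ F i, f (i + k) x = f i x := by
    intro i k
    induction k with
    | zero => exact fun _ _ => rfl
    | succ k ih =>
      intro x hx
      rw [← ih x hx, ← add_assoc, hf _ x (hF (by omega) hx)]
  choose N hN using hcov
  have hlim : ∀ i, ∀ x ∈ F i, f (N x) x = f i x := fun i x hx => by
    rw [← hstable i (N x) x hx, ← hstable (N x) i x (hN x), add_comm]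
  refine ⟨Equiv.ofBijective (fun x => f (N x) x) ⟨fun x y hxy => ?_, fun y => ?_⟩, hlim⟩
  · have hx := hF (le_max_left (N x) (N y)) (hN x)
    have hy := hF (le_max_right (N x) (N y)) (hN y)
    exact hinj _ hx hy ((hlim _ x hx).symm.trans (hxy.trans (hlim _ y hy)))
  · obtain ⟨i, x, hx, rfl⟩ := hsurj y
    exact ⟨x, hlim i x hx⟩

theorem exists_subset_of_chain {F : ℕ → Finset V} (hF : Monotone F) (hcov : ∀ x, ∃ i, x ∈ F i)
    (e : Finset V) : ∃ i, e ⊆ F i := by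
  choose N hN using hcov
  exact ⟨e.sup N, fun x hx => hF (Finset.le_sup hx) (hN x)⟩

end Chains

namespace UHypergraph

variable {r n m : ℕ} {V W : Type*} [DecidableEq V] {H : UHypergraph r V}

theorem exists_isAut_of_chain {f : ℕ → V → V} {F : ℕ → Finset V} (hF : Monotone F)
    (hcov : ∀ x, ∃ i, x ∈ F i) (hf : ∀ i, ∀ x ∈ F i, f (i + 1) x = f i x)
    (hiso : ∀ i, IsoOn H H (f i) (F i)) (hsurj : ∀ y, ∃ i, ∃ x ∈ F i, f i x = y) :
    ∃ p : Equiv.Perm V, H.IsAut p ∧ ∀ i, ∀ x ∈ F i, p x = f i x := by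
  obtain ⟨p, hp⟩ := exists_perm_of_chain hF hcov hf (fun i => (hiso i).1) hsurj
  refine ⟨p, fun e => ?_, hp⟩
  obtain ⟨i, hi⟩ := exists_subset_of_chain hF hcov e
  rw [Finset.image_congr (g := f i) (fun x hx => hp i x (hi hx)), (hiso i).2 e hi]

theorem exists_isAut_of_back_and_forth [Countable V] [Nonempty V]
    {P : Finset V → (V → V) → Prop} (hiso : ∀ F f, P F f → IsoOn H H f F)
    (forth : ∀ F f, P F f → ∀ v, ∃ F' f', P F' f' ∧ F ⊆ F' ∧ v ∈ F' ∧ ∀ x ∈ F, f' x = f x)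
    (back : ∀ F f, P F f → ∀ v, ∃ F' f', P F' f' ∧ F ⊆ F' ∧ (∃ x ∈ F', f' x = v) ∧
      ∀ x ∈ F, f' x = f x) {F : Finset V} {f : V → V} (h : P F f) :
    ∃ p : Equiv.Perm V, H.IsAut p ∧ (∀ x ∈ F, p x = f x) ∧
      ∀ v, ∃ F' f', P F' f' ∧ v ∈ F' ∧ ∀ x ∈ F', p x = f' x := by
  obtain ⟨v, hv⟩ := exists_surjective_nat V
  let State := {s : Finset V × (V → V) // P s.1 s.2}
  have step : ∀ (s : State) (v : V), ∃ t : State, s.1.1 ⊆ t.1.1 ∧ v ∈ t.1.1 ∧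
      (∃ x ∈ t.1.1, t.1.2 x = v) ∧ ∀ x ∈ s.1.1, t.1.2 x = s.1.2 x := by
    rintro ⟨⟨F, f⟩, h⟩ v
    obtain ⟨F₁, f₁, h₁, hF₁, hv₁, hf₁⟩ := forth F f h v
    obtain ⟨F₂, f₂, h₂, hF₂, hv₂, hf₂⟩ := back F₁ f₁ h₁ v
    exact ⟨⟨⟨F₂, f₂⟩, h₂⟩, hF₁.trans hF₂, hF₂ hv₁, hv₂,
      fun x hx => (hf₂ x (hF₁ hx)).trans (hf₁ x hx)⟩
  choose next hmono hdom hran hagree using step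
  let s : ℕ → State := fun i => Nat.rec ⟨⟨F, f⟩, h⟩ (fun i t => next t (v i)) i
  obtain ⟨p, hp, hps⟩ := exists_isAut_of_chain (H := H) (f := fun i => (s i).1.2)
    (F := fun i => (s i).1.1) (monotone_nat_of_le_succ fun i => hmono (s i) (v i))
    (hv.forall.2 fun i => ⟨i + 1, hdom (s i) (v i)⟩) (fun i => hagree (s i) (v i))
    (fun i => hiso _ _ (s i).2) (hv.forall.2 fun i => ⟨i + 1, hran (s i) (v i)⟩)
  exact ⟨p, hp, hps 0,
    hv.forall.2 fun i => ⟨_, _, (s (i + 1)).2, hdom (s i) (v i), hps (i + 1)⟩⟩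

/-- An isomorphism between the finite strong sets `F` and `f F`: the stages of the back and forth
construction proving homogeneity. -/
structure StrongIso (n m : ℕ) (H : UHypergraph r V) (F : Finset V) (f : V → V) : Prop where
  finStrong : H.FinStrong n m F
  isoOn : IsoOn H H f F
  finStrong_image : H.FinStrong n m (F.image f)

namespace StrongIso

variable {F : Finset V} {f : V → V}

theorem exists_inverse [Nonempty V] (h : StrongIso n m H F f) :
    ∃ g, StrongIso n m H (F.image f) g ∧ (∀ x ∈ F, g (f x) = x) ∧ (F.image f).image g = F := by
  obtain ⟨g, hg, hgf⟩ := h.isoOn.exists_inverse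
  have hFg : (F.image f).image g = F := by
    have hcomp : Set.EqOn (g ∘ f) id F := hgf
    rw [Finset.image_image, Finset.image_congr hcomp, Finset.image_id]
  exact ⟨g, ⟨h.finStrong_image, hg, by rw [hFg]; exact h.finStrong⟩, hgf, hFg⟩

variable (hH : H.IsGeneric n m) (hr : r ≠ 0)
include hH hr

theorem forth (h : StrongIso n m H F f) (v : V) :
    ∃ F' f', StrongIso n m H F' f' ∧ F ⊆ F' ∧ v ∈ F' ∧ ∀ x ∈ F, f' x = f x := by
  have := hH.nonempty hr
  have hp := hH.predimNonneg hr
  obtain ⟨T, hT, hTs, -⟩ := hp.exists_hull (insert v F)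
  obtain ⟨g, hg, hgf, hFg⟩ := h.exists_inverse
  have hFT : F ⊆ T := (Finset.subset_insert _ _).trans hT
  obtain ⟨f', hf', hf'g, hf's⟩ := hH.exists_realization hr hg.finStrong hp (D := T) hg.isoOn
    (by rwa [hFg]) (by rw [hFg]; exact h.finStrong)
  refine ⟨T, f', ⟨hTs, hf', hf's⟩, hFT, hT (Finset.mem_insert_self _ _), fun x hx => ?_⟩
  simpa only [hgf x hx] using hf'g (f x) (Finset.mem_image_of_mem f hx)

theorem back (h : StrongIso n m H F f) (v : V) :
    ∃ F' f', StrongIso n m H F' f' ∧ F ⊆ F' ∧ (∃ x ∈ F', f' x = v) ∧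
      ∀ x ∈ F, f' x = f x := by
  have := hH.nonempty hr
  obtain ⟨g, hg, hgf, -⟩ := h.exists_inverse
  obtain ⟨T, g', hg', hFT, hvT, hg'g⟩ := hg.forth hH hr v
  obtain ⟨f', hf', hf'g', -⟩ := hg'.exists_inverse
  have hg'f : ∀ x ∈ F, g' (f x) = x := fun x hx => by
    rw [hg'g _ (Finset.mem_image_of_mem f hx), hgf x hx]
  have hfT : ∀ x ∈ F, f x ∈ T := fun x hx => hFT (Finset.mem_image_of_mem f hx)
  refine ⟨T.image g', f', hf', fun x hx => ?_, ⟨g' v, Finset.mem_image_of_mem _ hvT, hf'g' v hvT⟩,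
    fun x hx => ?_⟩
  · simpa only [hg'f x hx] using Finset.mem_image_of_mem g' (hfT x hx)
  · simpa only [hg'f x hx] using hf'g' _ (hfT x hx)

theorem exists_isAut (h : StrongIso n m H F f) :
    ∃ p : Equiv.Perm V, H.IsAut p ∧ ∀ x ∈ F, p x = f x := by
  have := hH.nonempty hr
  have := hH.countable
  obtain ⟨p, hp, hpf, -⟩ := exists_isAut_of_back_and_forth (H := H) (fun _ _ h => h.isoOn)
    (fun _ _ h => h.forth hH hr) (fun _ _ h => h.back hH hr) h
  exact ⟨p, hp, hpf⟩

end StrongIso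

omit [DecidableEq V] in
theorem IsoOn.congr [DecidableEq W] {K : UHypergraph r V} {L : UHypergraph r W} {f g : V → W}
    {D : Finset V} (h : IsoOn K L f D) (hfg : Set.EqOn f g D) : IsoOn K L g D := by
  refine ⟨h.1.congr hfg, fun e he => ?_⟩
  rw [← Finset.image_congr (hfg.mono (Finset.coe_subset.2 he)), h.2 e he]

theorem IsoOn.union [DecidableEq W] {K : UHypergraph r W} {f : W → V} {A B : Finset W}
    (hA : IsoOn K H f A) (hB : IsoOn K H f B) (hf : Set.InjOn f (A ∪ B : Finset W))
    (hK : ∀ e ∈ K.edges, e ⊆ A ∪ B → e ⊆ A ∨ e ⊆ B)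
    (hH : ∀ e ∈ H.edges, e ⊆ A.image f ∪ B.image f → e ⊆ A.image f ∨ e ⊆ B.image f) :
    IsoOn K H f (A ∪ B) := by
  refine ⟨hf, fun e he => ⟨fun h => ?_, fun h => ?_⟩⟩
  · have hsub : ∀ D ⊆ A ∪ B, e.image f ⊆ D.image f → e ⊆ D := fun D hD heD x hx => by
      obtain ⟨y, hy, hxy⟩ := Finset.mem_image.1 (heD (Finset.mem_image_of_mem f hx))
      rwa [← hf (hD hy) (he hx) hxy]
    obtain heA | heB := hH _ h (Finset.image_union (f := f) A B ▸ Finset.image_subset_image he)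
    · exact (hA.2 e (hsub A Finset.subset_union_left heA)).1 h
    · exact (hB.2 e (hsub B Finset.subset_union_right heB)).1 h
  · exact (hK e h he).elim (fun heA => (hA.2 e heA).2 h) fun heB => (hB.2 e heB).2 h

theorem IsGeneric.exists_isAut_eqOn_union (hH : H.IsGeneric n m) (hr : r ≠ 0) (hm : m ≠ 0)
    {f : V → V} {A B : Finset V} (hA : IsoOn H H f A) (hB : IsoOn H H f B)
    (hf : Set.InjOn f (A ∪ B : Finset V))
    (hAB : H.finPredim n m A + H.finPredim n m B - H.finPredim n m (A ∩ B) ≤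
      H.finDim n m (A ∪ B))
    (hfAB : H.finPredim n m A + H.finPredim n m B - H.finPredim n m (A ∩ B) ≤
      H.finDim n m ((A ∪ B).image f)) :
    ∃ s : Equiv.Perm V, H.IsAut s ∧ ∀ x ∈ A ∪ B, s x = f x := by
  have hp := hH.predimNonneg hr
  rw [Finset.coe_union] at hf
  rw [← hA.finPredim_image subset_rfl, ← hB.finPredim_image subset_rfl,
    ← hA.finPredim_image Finset.inter_subset_left, Finset.image_inter_of_injOn A B hf,
    Finset.image_union] at hfAB
  have hiso : IsoOn H H f (A ∪ B) := hA.union hB (by rwa [Finset.coe_union])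
    (fun e he => hp.subset_or_subset_of_mem_edges hAB hm he)
    (fun e he => hp.subset_or_subset_of_mem_edges hfAB hm he)
  exact StrongIso.exists_isAut hH hr ⟨hp.finStrong_union hAB, hiso, by
    rw [Finset.image_union]; exact hp.finStrong_union hfAB⟩

end UHypergraph

/-! ### Stationarity of independence -/

namespace UHypergraph

variable {r n m : ℕ} {V : Type*} [DecidableEq V] {H : UHypergraph r V}

/-- The map `σ` agrees with automorphisms of `H` on arbitrarily large finite strong subsets of the
possibly infinite set `Z`, each of them of the dimension of the finite set `B`. Such a map extends
to an automorphism; `mem_image_iff` makes the extensions of `σ` on `B` avoid `σ '' Z` off `Z`. -/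
structure LocallyAut (n m : ℕ) (H : UHypergraph r V) (Z : Set V) (σ : V → V) (B : Finset V) :
    Prop where
  exists_hull : ∀ T₀ : Finset V, (T₀ : Set V) ⊆ Z → ∃ T, T₀ ∪ B ⊆ T ∧ (T : Set V) ⊆ Z ∧
    H.FinStrong n m T ∧ H.finPredim n m T = H.finDim n m B ∧
    ∃ q : Equiv.Perm V, H.IsAut q ∧ ∀ x ∈ T, q x = σ x
  mem_image_iff : ∀ p : Equiv.Perm V, H.IsAut p → (∀ x ∈ B, p x = σ x) →
    ∀ x, p x ∈ σ '' Z ↔ x ∈ Z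

/-- A stage of the back and forth construction extending `σ : Z → V` to an automorphism: only the
restriction of `p` to the finite strong set `F` is kept. -/
structure ExtensionStage (n m : ℕ) (H : UHypergraph r V) (Z : Set V) (σ : V → V) (B F : Finset V)
    (p : Equiv.Perm V) : Prop where
  isAut : H.IsAut p
  finStrong : H.FinStrong n m F
  base_subset : B ⊆ F
  eq_of_mem : ∀ x ∈ F, x ∈ Z → p x = σ x

variable {Z : Set V} {σ τ : V → V} {B F : Finset V} {p : Equiv.Perm V}

namespace LocallyAut

theorem base_subset (h : LocallyAut n m H Z σ B) : (B : Set V) ⊆ Z := by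
  obtain ⟨T, hT, hTZ, -⟩ := h.exists_hull ∅ (by simp)
  exact fun x hx => hTZ (hT (Finset.mem_union_right _ hx))

theorem injOn (h : LocallyAut n m H Z σ B) : Set.InjOn σ Z := by
  intro x hx y hy hxy
  obtain ⟨T, hT, -, -, -, q, -, hq⟩ :=
    h.exists_hull {x, y} (by simp [Set.insert_subset_iff, hx, hy])
  rw [← hq x (hT (by simp)), ← hq y (hT (by simp))] at hxy
  exact q.injective hxy

theorem inverse (h : LocallyAut n m H Z σ B) (hp : H.PredimNonneg n m) (hτ : Set.LeftInvOn τ σ Z) :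
    LocallyAut n m H (σ '' Z) τ (B.image σ) where
  exists_hull T₀ hT₀ := by
    obtain ⟨T₁, hT₁, rfl⟩ := Finset.subset_set_image_iff.1 hT₀
    obtain ⟨T, hT, hTZ, hTs, hTd, q, hq, hqσ⟩ := h.exists_hull T₁ hT₁
    have hTq : T.image σ = T.image q := Finset.image_congr fun x hx => (hqσ x hx).symm
    have hBq : B.image σ = B.image q := Finset.image_congr fun x hx =>
      (hqσ x (hT (Finset.mem_union_right _ hx))).symm
    refine ⟨T.image σ, ?_, ?_, ?_, ?_, q⁻¹, hq.inv, ?_⟩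
    · rw [← Finset.image_union]
      exact Finset.image_subset_image hT
    · rw [Finset.coe_image]
      exact Set.image_mono hTZ
    · rw [hTq]
      exact hq.finStrong_image hTs
    · rw [hTq, hBq, hq.finPredim_image, hq.finDim_image hp, hTd]
    · refine Finset.forall_mem_image.2 fun x hx => ?_
      rw [hτ (hTZ hx), ← hqσ x hx, perm_inv_apply_self]
  mem_image_iff p hpa hpB x := by
    have hpB' : ∀ b ∈ B, p⁻¹ b = σ b := fun b hb => by
      rw [Equiv.Perm.inv_eq_iff_eq, hpB _ (Finset.mem_image_of_mem σ hb), hτ (h.base_subset hb)]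
    have := h.mem_image_iff p⁻¹ hpa.inv hpB' (p x)
    rw [perm_inv_apply_self] at this
    rw [hτ.image_image, this]

end LocallyAut

namespace ExtensionStage

theorem inverse (h : ExtensionStage n m H Z σ B F p) (hσ : LocallyAut n m H Z σ B)
    (hτ : Set.LeftInvOn τ σ Z) :
    ExtensionStage n m H (σ '' Z) τ (B.image σ) (F.image p) p⁻¹ where
  isAut := h.isAut.inv
  finStrong := h.isAut.finStrong_image h.finStrong
  base_subset := by
    rw [Finset.image_congr (g := p) fun b hb =>
      (h.eq_of_mem b (h.base_subset hb) (hσ.base_subset hb)).symm]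
    exact Finset.image_subset_image h.base_subset
  eq_of_mem := by
    refine Finset.forall_mem_image.2 fun x hx hxZ => ?_
    have hpB : ∀ b ∈ B, p b = σ b := fun b hb =>
      h.eq_of_mem b (h.base_subset hb) (hσ.base_subset hb)
    have hxZ' := (hσ.mem_image_iff p h.isAut hpB x).1 hxZ
    rw [perm_inv_apply_self, h.eq_of_mem x hx hxZ', hτ hxZ']

theorem injOn_piecewise (h : ExtensionStage n m H Z σ B F p) (hσ : LocallyAut n m H Z σ B)
    {T : Finset V} (hT : (T : Set V) ⊆ Z) :
    Set.InjOn (F.piecewise p σ) (F ∪ T : Finset V) := by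
  have hpB : ∀ b ∈ B, p b = σ b := fun b hb =>
    h.eq_of_mem b (h.base_subset hb) (hσ.base_subset hb)
  have hpσ : ∀ x ∈ F, ∀ t ∈ Z, p x = σ t → x = t := fun x hx t ht hxt => by
    have hxZ := (hσ.mem_image_iff p h.isAut hpB x).1 ⟨t, ht, hxt.symm⟩
    rw [h.eq_of_mem x hx hxZ] at hxt
    exact hσ.injOn hxZ ht hxt
  have hZ : ∀ x ∈ F ∪ T, x ∉ F → x ∈ Z := fun x hx hxF =>
    hT ((Finset.mem_union.1 hx).resolve_left hxF)
  intro x hx y hy hxy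
  by_cases hxF : x ∈ F <;> by_cases hyF : y ∈ F <;>
    simp only [Finset.piecewise, hxF, hyF, if_true, if_false] at hxy
  · exact p.injective hxy
  · exact hpσ x hxF y (hZ y hy hyF) hxy
  · exact (hpσ y hyF x (hZ x hx hxF) hxy.symm).symm
  · exact hσ.injOn (hZ x hx hxF) (hZ y hy hyF) hxy

variable (hH : H.IsGeneric n m) (hr : r ≠ 0) (hm : m ≠ 0)
include hH hr hm

theorem forth (h : ExtensionStage n m H Z σ B F p) (hσ : LocallyAut n m H Z σ B) (v : V) :
    ∃ F' p', ExtensionStage n m H Z σ B F' p' ∧ F ⊆ F' ∧ v ∈ F' ∧ ∀ x ∈ F, p' x = p x := by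
  classical
  have hp := hH.predimNonneg hr
  obtain ⟨F', hF', hFs', -⟩ := hp.exists_hull (insert v F)
  have hFF' : F ⊆ F' := (Finset.subset_insert _ _).trans hF'
  obtain ⟨T, hT, hTZ, -, hTd, q, hq, hqσ⟩ := hσ.exists_hull (F'.filter (· ∈ Z))
    fun x hx => (Finset.mem_filter.1 hx).2
  have hBT : B ⊆ F ∩ T := Finset.subset_inter h.base_subset (Finset.subset_union_right.trans hT)
  set u := F.piecewise p σ
  have huF : Set.EqOn p u F := fun x hx => (Finset.piecewise_eq_of_mem F p σ hx).symm
  have huT : Set.EqOn σ u T := fun x hx => by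
    by_cases hxF : x ∈ F
    · rw [← huF hxF, h.eq_of_mem x hxF (hTZ hx)]
    · exact (Finset.piecewise_eq_of_notMem F p σ hxF).symm
  have hdim : H.finPredim n m F + H.finPredim n m T - H.finPredim n m (F ∩ T) ≤
      H.finDim n m F := by
    have := hp.finDim_le hBT
    rw [h.finStrong.finDim_eq hp]
    lia
  obtain ⟨s, hs, hsu⟩ := hH.exists_isAut_eqOn_union hr hm ((h.isAut.isoOn F).congr huF)
    ((hq.isoOn T).congr fun x hx => (hqσ x hx).trans (huT hx)) (h.injOn_piecewise hσ hTZ)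
    (hdim.trans (hp.isDimension.mono _ _ Finset.subset_union_left)) (hdim.trans (by
      rw [← h.isAut.finDim_image hp, Finset.image_congr huF]
      exact hp.isDimension.mono _ _ (Finset.image_subset_image Finset.subset_union_left)))
  refine ⟨F', s, ⟨hs, hFs', h.base_subset.trans hFF', fun x hx hxZ => ?_⟩, hFF',
    hF' (Finset.mem_insert_self _ _), fun x hx => ?_⟩
  · have hxT : x ∈ T := hT (Finset.mem_union_left _ (Finset.mem_filter.2 ⟨hx, hxZ⟩))
    rw [hsu x (Finset.mem_union_right _ hxT), huT hxT]
  · rw [hsu x (Finset.mem_union_left _ hx), huF hx]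

theorem back (h : ExtensionStage n m H Z σ B F p) (hσ : LocallyAut n m H Z σ B) (v : V) :
    ∃ F' p', ExtensionStage n m H Z σ B F' p' ∧ F ⊆ F' ∧ (∃ x ∈ F', p' x = v) ∧
      ∀ x ∈ F, p' x = p x := by
  have := hH.nonempty hr
  have hp := hH.predimNonneg hr
  have hτ : Set.LeftInvOn (Function.invFunOn σ Z) σ Z := hσ.injOn.leftInvOn_invFunOn
  have hστ : Set.LeftInvOn σ (Function.invFunOn σ Z) (σ '' Z) := by
    rintro _ ⟨z, hz, rfl⟩
    rw [hτ hz]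
  obtain ⟨T, s, hs, hFT, hvT, hsp⟩ := (h.inverse hσ hτ).forth hH hr hm (hσ.inverse hp hτ) v
  have hs' := hs.inverse (hσ.inverse hp hτ) hστ
  have hBB : (B.image σ).image (Function.invFunOn σ Z) = B := by
    have hcomp : Set.EqOn (Function.invFunOn σ Z ∘ σ) id B := fun b hb => hτ (hσ.base_subset hb)
    rw [Finset.image_image, Finset.image_congr hcomp, Finset.image_id]
  rw [hτ.image_image, hBB] at hs'
  have hsx : ∀ x ∈ F, s (p x) = x := fun x hx => by
    rw [hsp _ (Finset.mem_image_of_mem p hx), perm_inv_apply_self]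
  refine ⟨T.image s, s⁻¹, hs', fun x hx => ?_,
    ⟨s v, Finset.mem_image_of_mem s hvT, perm_inv_apply_self _ _⟩,
    fun x hx => by rw [Equiv.Perm.inv_eq_iff_eq, hsx x hx]⟩
  rw [← hsx x hx]
  exact Finset.mem_image_of_mem s (hFT (Finset.mem_image_of_mem p hx))

theorem exists_isAut (h : ExtensionStage n m H Z σ B F p) (hσ : LocallyAut n m H Z σ B) :
    ∃ s : Equiv.Perm V, H.IsAut s ∧ (∀ x ∈ F, s x = p x) ∧ ∀ x ∈ Z, s x = σ x := by
  have := hH.nonempty hr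
  have := hH.countable
  obtain ⟨s, hs, hsp, hsσ⟩ := exists_isAut_of_back_and_forth (H := H) (F := F) (f := p)
    (P := fun F f => ∃ p : Equiv.Perm V, f = p ∧ ExtensionStage n m H Z σ B F p)
    (by
      rintro F _ ⟨p, rfl, h⟩
      exact h.isAut.isoOn F)
    (by
      rintro F _ ⟨p, rfl, h⟩ v
      obtain ⟨F', p', h', hF⟩ := h.forth hH hr hm hσ v
      exact ⟨F', p', ⟨p', rfl, h'⟩, hF⟩)
    (by
      rintro F _ ⟨p, rfl, h⟩ v
      obtain ⟨F', p', h', hF⟩ := h.back hH hr hm hσ v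
      exact ⟨F', p', ⟨p', rfl, h'⟩, hF⟩) ⟨p, rfl, h⟩
  refine ⟨s, hs, hsp, fun x hx => ?_⟩
  obtain ⟨F', _, ⟨p', rfl, h'⟩, hxF, hsp'⟩ := hsσ x
  rw [hsp' x hxF, h'.eq_of_mem x hxF hx]

end ExtensionStage

section

variable (hp : H.PredimNonneg n m)
include hp

theorem IsAut.mem_dimClosure_image (h : H.IsAut p) {A : Finset V} {x : V} :
    p x ∈ dimClosure (H.finDim n m) (A.image p) ↔ x ∈ dimClosure (H.finDim n m) A := by
  simp only [dimClosure, Set.mem_ofPred_eq]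
  rw [← Finset.image_insert, h.finDim_image hp, h.finDim_image hp]

theorem PredimNonneg.exists_hull_dimClosure {T₀ : Finset V}
    (h : (T₀ : Set V) ⊆ dimClosure (H.finDim n m) B) :
    ∃ T, T₀ ∪ B ⊆ T ∧ (T : Set V) ⊆ dimClosure (H.finDim n m) B ∧ H.FinStrong n m T ∧
      H.finPredim n m T = H.finDim n m B := by
  obtain ⟨T, hT, hTs, hTd⟩ := hp.exists_hull (T₀ ∪ B)
  rw [Finset.union_comm T₀, hp.isDimension.union_eq h] at hTd
  refine ⟨T, hT, hp.isDimension.subset_dimClosure_of_union_le ?_, hTs, hTd⟩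
  rw [Finset.union_eq_right.2 (Finset.subset_union_right.trans hT), hTs.finDim_eq hp, hTd]

theorem PredimNonneg.exists_hull_dimClosure_union {A C T₀ : Finset V}
    (hT₀ : (T₀ : Set V) ⊆ dimClosure (H.finDim n m) A ∪ dimClosure (H.finDim n m) C) :
    ∃ S T, T₀ ⊆ S ∪ T ∧ (A ⊆ S ∧ C ⊆ T) ∧
      ((S : Set V) ⊆ dimClosure (H.finDim n m) A ∧ (T : Set V) ⊆ dimClosure (H.finDim n m) C) ∧
      (H.finPredim n m S = H.finDim n m A ∧ H.finPredim n m T = H.finDim n m C) ∧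
      H.finDim n m (S ∪ T) = H.finDim n m (A ∪ C) := by
  classical
  have hd := hp.isDimension
  obtain ⟨S, hS, hSA, -, hSd⟩ := hp.exists_hull_dimClosure (B := A)
    (T₀ := T₀.filter (· ∈ dimClosure (H.finDim n m) A)) fun x hx => (Finset.mem_filter.1 hx).2
  obtain ⟨T, hT, hTC, -, hTd⟩ := hp.exists_hull_dimClosure (B := C)
    (T₀ := T₀.filter (· ∈ dimClosure (H.finDim n m) C)) fun x hx => (Finset.mem_filter.1 hx).2
  have hAS : A ⊆ S := Finset.subset_union_right.trans hS
  have hCT : C ⊆ T := Finset.subset_union_right.trans hT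
  have hST : ((S ∪ T : Finset V) : Set V) ⊆ dimClosure (H.finDim n m) (A ∪ C) := by
    rw [Finset.coe_union]
    exact Set.union_subset (hSA.trans (hd.dimClosure_mono Finset.subset_union_left))
      (hTC.trans (hd.dimClosure_mono Finset.subset_union_right))
  refine ⟨S, T, fun x hx => ?_, ⟨hAS, hCT⟩, ⟨hSA, hTC⟩, ⟨hSd, hTd⟩, ?_⟩
  · rcases hT₀ hx with hxA | hxC
    · exact Finset.mem_union_left _ (hS (Finset.mem_union_left _ (Finset.mem_filter.2 ⟨hx, hxA⟩)))
    · exact Finset.mem_union_right _ (hT (Finset.mem_union_left _ (Finset.mem_filter.2 ⟨hx, hxC⟩)))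
  · rw [← hd.union_eq hST, Finset.union_eq_right.2 (Finset.union_subset_union hAS hCT)]

theorem IsAut.mem_image_dimClosure_iff {q : Equiv.Perm V} (h : H.IsAut p) (hq : H.IsAut q)
    {A : Finset V} (hpq : ∀ a ∈ A, q a = p a) {x : V} :
    q x ∈ p '' dimClosure (H.finDim n m) A ↔ x ∈ dimClosure (H.finDim n m) A := by
  rw [← hq.mem_dimClosure_image hp, Finset.image_congr (g := p) hpq]
  constructor
  · rintro ⟨y, hy, hyx⟩
    rw [← hyx]
    exact (h.mem_dimClosure_image hp).2 hy
  · refine fun hx => ⟨p⁻¹ (q x), ?_, perm_apply_inv_self _ _⟩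
    rwa [← h.mem_dimClosure_image hp, perm_apply_inv_self]

end

variable (hH : H.IsGeneric n m) (hr : r ≠ 0) (hm : m ≠ 0)
include hH hr hm

theorem IsAut.exists_eqOn_dimClosure_fixed (h : H.IsAut p) (hF : H.FinStrong n m F) (hB : B ⊆ F)
    (hfix : ∀ x ∈ F, x ∈ dimClosure (H.finDim n m) B → p x = x) :
    ∃ s : Equiv.Perm V, H.IsAut s ∧ (∀ x ∈ F, s x = p x) ∧
      ∀ x ∈ dimClosure (H.finDim n m) B, s x = x := by
  have hp := hH.predimNonneg hr
  refine ExtensionStage.exists_isAut (σ := id) hH hr hm ⟨h, hF, hB, hfix⟩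
    ⟨fun T₀ hT₀ => ?_, fun q hq hqB x => isAut_one.mem_image_dimClosure_iff hp hq hqB⟩
  obtain ⟨T, hT, hTB, hTs, hTd⟩ := hp.exists_hull_dimClosure hT₀
  exact ⟨T, hT, hTB, hTs, hTd, 1, isAut_one, fun x _ => rfl⟩

/-- The amalgam of two automorphisms `p`, `q` over the closures of `A` and `C`. The two dimension
inequalities say that `A` and `C`, and their images, are independent over `B`. -/
theorem locallyAut_union {q : Equiv.Perm V} {A C : Finset V} (hBA : B ⊆ A) (hBC : B ⊆ C)
    (hpa : H.IsAut p) (hqa : H.IsAut q)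
    (hpσ : Set.EqOn p σ (dimClosure (H.finDim n m) A))
    (hqσ : Set.EqOn q σ (dimClosure (H.finDim n m) C))
    (hσ : Set.InjOn σ (dimClosure (H.finDim n m) A ∪ dimClosure (H.finDim n m) C))
    (hAC : H.finDim n m A + H.finDim n m C ≤ H.finDim n m (A ∪ C) + H.finDim n m B)
    (hσAC : H.finDim n m A + H.finDim n m C ≤
      H.finDim n m ((A ∪ C).image σ) + H.finDim n m B) :
    LocallyAut n m H (dimClosure (H.finDim n m) A ∪ dimClosure (H.finDim n m) C) σ (A ∪ C) where
  exists_hull T₀ hT₀ := by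
    have hp := hH.predimNonneg hr
    have hd := hp.isDimension
    obtain ⟨S, T, hT₀ST, ⟨hAS, hCT⟩, ⟨hSA, hTC⟩, ⟨hSd, hTd⟩, hdim⟩ :=
      hp.exists_hull_dimClosure_union hT₀
    have hST : A ∪ C ⊆ S ∪ T := Finset.union_subset_union hAS hCT
    have hSTsub : ((S ∪ T : Finset V) : Set V) ⊆
        dimClosure (H.finDim n m) A ∪ dimClosure (H.finDim n m) C := by
      rw [Finset.coe_union]
      exact Set.union_subset_union hSA hTC
    have hB := hp.finDim_le (Finset.subset_inter (hBA.trans hAS) (hBC.trans hCT))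
    have hfree : H.finPredim n m S + H.finPredim n m T - H.finPredim n m (S ∩ T) ≤
        H.finDim n m (S ∪ T) := by
      lia
    obtain ⟨s, hs, hsσ⟩ := hH.exists_isAut_eqOn_union hr hm
      ((hpa.isoOn S).congr (hpσ.mono hSA)) ((hqa.isoOn T).congr (hqσ.mono hTC))
      (hσ.mono hSTsub) hfree (by
        have := hd.mono _ _ (Finset.image_subset_image (f := σ) hST)
        lia)
    have hSTs := hp.finStrong_union hfree
    exact ⟨S ∪ T, Finset.union_subset hT₀ST hST, hSTsub, hSTs,
      by rw [← hSTs.finDim_eq hp, hdim], s, hs, hsσ⟩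
  mem_image_iff s hs hsσ x := by
    have hp := hH.predimNonneg hr
    rw [Set.image_union, ← hpσ.image_eq, ← hqσ.image_eq, Set.mem_union, Set.mem_union,
      hpa.mem_image_dimClosure_iff hp hs fun a ha => by
        rw [hsσ a (Finset.mem_union_left _ ha), hpσ (subset_dimClosure _ _ ha)],
      hqa.mem_image_dimClosure_iff hp hs fun c hc => by
        rw [hsσ c (Finset.mem_union_right _ hc), hqσ (subset_dimClosure _ _ hc)]]

theorem IsAut.exists_of_dimIndep (h : H.IsAut p) {A C : Finset V} (hBA : B ⊆ A) (hBC : B ⊆ C)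
    (hB : ∀ x ∈ dimClosure (H.finDim n m) B, p x = x) (hA : DimIndep (H.finDim n m) A B C)
    (hpA : DimIndep (H.finDim n m) (A.image p) B C) :
    ∃ s : Equiv.Perm V, H.IsAut s ∧ (∀ x ∈ dimClosure (H.finDim n m) A, s x = p x) ∧
      ∀ x ∈ dimClosure (H.finDim n m) C, s x = x := by
  classical
  have hp := hH.predimNonneg hr
  have hd := hp.isDimension
  set clA := dimClosure (H.finDim n m) A
  have hBp : B ⊆ A.image p := fun x hx => by
    rw [← hB x (subset_dimClosure _ _ hx)]
    exact Finset.mem_image_of_mem p (hBA hx)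
  have hfix : ∀ x ∈ clA, ∀ y ∈ dimClosure (H.finDim n m) C, p x = y → x = y := fun x hx y hy hxy =>
    p.injective (hxy.trans (hB y (hpA.dimClosure_inter_subset hd hBp hBC
      ⟨hxy ▸ (h.mem_dimClosure_image hp).2 hx, hy⟩)).symm)
  let σ : V → V := clA.piecewise p id
  have hσA : Set.EqOn p σ clA := fun x hx => (Set.piecewise_eq_of_mem clA p id hx).symm
  have hσC : Set.EqOn (1 : Equiv.Perm V) σ (dimClosure (H.finDim n m) C) := fun x hx => by
    by_cases hxA : x ∈ clA
    · rw [← hσA hxA, hB x (hA.dimClosure_inter_subset hd hBA hBC ⟨hxA, hx⟩), Equiv.Perm.one_apply]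
    · exact (Set.piecewise_eq_of_notMem clA p id hxA).symm
  have hinj : Set.InjOn σ (clA ∪ dimClosure (H.finDim n m) C) := by
    rintro x (hx | hx) y (hy | hy) hxy
    · exact p.injective (by rwa [hσA hx, hσA hy])
    · exact hfix x hx y hy ((hσA hx).trans (hxy.trans (hσC hy).symm))
    · exact (hfix y hy x hx ((hσA hy).trans (hxy.symm.trans (hσC hx).symm))).symm
    · exact (hσC hx).trans (hxy.trans (hσC hy).symm)
  have himage : (A ∪ C).image σ = A.image p ∪ C := by
    rw [Finset.image_union,
      Finset.image_congr (f := σ) (g := p) fun a ha => (hσA (subset_dimClosure _ _ ha)).symm,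
      Finset.image_congr (f := σ) (g := id) fun c hc => (hσC (subset_dimClosure _ _ hc)).symm,
      Finset.image_id]
  have hloc : LocallyAut n m H (clA ∪ dimClosure (H.finDim n m) C) σ (A ∪ C) := by
    rw [DimIndep, Finset.union_eq_left.2 hBA, Finset.union_eq_right.2 hBC] at hA
    rw [DimIndep, Finset.union_eq_left.2 hBp, Finset.union_eq_right.2 hBC,
      h.finDim_image hp, ← himage] at hpA
    exact locallyAut_union hH hr hm hBA hBC h isAut_one hσA hσC hinj hA hpA
  obtain ⟨T, hT, -, hTs, -, q, hq, hqσ⟩ := hloc.exists_hull ∅ (by simp)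
  obtain ⟨s, hs, -, hsσ⟩ := ExtensionStage.exists_isAut hH hr hm
    ⟨hq, hTs, Finset.subset_union_right.trans hT, fun x hx _ => hqσ x hx⟩ hloc
  exact ⟨s, hs, fun x hx => (hsσ x (Or.inl hx)).trans (hσA hx).symm,
    fun x hx => (hsσ x (Or.inr hx)).trans (hσC hx).symm⟩

end UHypergraph

/-! ### Free amalgamation and existence of independent conjugates -/

namespace UHypergraph

section EdgeCover

variable {r n m : ℕ} {W : Type*} [DecidableEq W] {K : UHypergraph r W} {P Q : Finset W}
  (hK : ∀ e ∈ K.edges, e ⊆ P ∨ e ⊆ Q)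
include hK

theorem finPredim_inter_add_inter_le (A : Finset W) :
    K.finPredim n m (A ∩ P) + K.finPredim n m (A ∩ Q) ≤
      K.finPredim n m A + K.finPredim n m (A ∩ (P ∩ Q)) := by
  have hedge : ∀ e ∈ K.edges, e ⊆ A → e ⊆ A ∩ P ∨ e ⊆ A ∩ Q := fun e he heA =>
    (hK e he).imp (Finset.subset_inter heA) (Finset.subset_inter heA)
  have hsub : A ∩ P ∪ A ∩ Q ⊆ A := Finset.union_subset Finset.inter_subset_left
    Finset.inter_subset_left
  have hcross : K.crossEdges (A ∩ P) (A ∩ Q) = ∅ := by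
    refine Finset.eq_empty_of_forall_notMem fun e he => ?_
    obtain ⟨he, heA, heP, heQ⟩ := mem_crossEdges.1 he
    exact (hedge e he (heA.trans hsub)).elim heP heQ
  have hfin : K.finEdgesIn (A ∩ P ∪ A ∩ Q) = K.finEdgesIn A := by
    ext e
    simp only [mem_finEdgesIn]
    exact ⟨fun ⟨heA, he⟩ => ⟨heA.trans hsub, he⟩, fun ⟨heA, he⟩ =>
      ⟨(hedge e he heA).elim (fun h => h.trans Finset.subset_union_left)
        fun h => h.trans Finset.subset_union_right, he⟩⟩
  have hle : K.finPredim n m (A ∩ P ∪ A ∩ Q) ≤ K.finPredim n m A := by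
    simp only [finPredim, hfin]
    gcongr
  have hmod := finPredim_union_add_inter n m K (A ∩ P) (A ∩ Q)
  rw [hcross, Finset.card_empty, ← Finset.inter_inter_distrib_left] at hmod
  push_cast at hmod
  lia

theorem finPredim_inter_le_of_edgeCover
    (hQ : ∀ X ⊆ Q, K.finPredim n m (X ∩ P) ≤ K.finPredim n m X) (A : Finset W) :
    K.finPredim n m (A ∩ P) ≤ K.finPredim n m A := by
  have hA := finPredim_inter_add_inter_le (n := n) (m := m) hK A
  have hAQ := hQ (A ∩ Q) Finset.inter_subset_right
  rw [Finset.inter_assoc, Finset.inter_comm Q P] at hAQ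
  lia

end EdgeCover

variable {r n m : ℕ} {V : Type*} [DecidableEq V] {H : UHypergraph r V}

/-- The copy of `V` inside `V × Bool` whose layers are prescribed by `s`; two such copies are glued
along the set where their layers agree. -/
def layer (s : V → Bool) (x : V) : V × Bool := (x, s x)

omit [DecidableEq V] in
theorem layer_injective (s : V → Bool) : Function.Injective (layer s) :=
  fun _ _ h => congrArg Prod.fst h

theorem image_fst_image_layer (s : V → Bool) (A : Finset V) :
    (A.image (layer s)).image Prod.fst = A := by
  rw [Finset.image_image]
  exact Finset.image_id

theorem image_layer_inter_image_layer {s t : V → Bool} {B X F : Finset V}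
    (hst : ∀ x, s x = t x ↔ x ∈ B) (hBF : B ⊆ F) :
    X.image (layer s) ∩ F.image (layer t) = (X ∩ B).image (layer s) := by
  ext ⟨x, i⟩
  simp only [layer, Finset.mem_inter, Finset.mem_image, Prod.mk.injEq]
  grind

/-- The free amalgam of the substructures of `H` on `E` and `F`, glued along the set where `s` and
`t` agree. -/
def freeAmalgam (H : UHypergraph r V) (s t : V → Bool) (E F : Finset V) :
    UHypergraph r (V × Bool) where
  edges := {e | ∃ e₀ ∈ H.edges, (e₀ ⊆ E ∧ e = e₀.image (layer s)) ∨
    (e₀ ⊆ F ∧ e = e₀.image (layer t))}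
  card_edge := by
    rintro e ⟨e₀, he₀, ⟨-, rfl⟩ | ⟨-, rfl⟩⟩
    · rw [Finset.card_image_of_injective _ (layer_injective s), H.card_edge _ he₀]
    · rw [Finset.card_image_of_injective _ (layer_injective t), H.card_edge _ he₀]

section FreeAmalgam

variable {s t : V → Bool} {B E F : Finset V}

theorem freeAmalgam_comm : H.freeAmalgam s t E F = H.freeAmalgam t s F E := by
  simp only [freeAmalgam, or_comm]

theorem isoOn_layer_left : IsoOn H (H.freeAmalgam s t E F) (layer s) E := by
  refine ⟨(layer_injective s).injOn, fun e he => ⟨?_, fun h => ⟨e, h, Or.inl ⟨he, rfl⟩⟩⟩⟩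
  rintro ⟨e₀, he₀, ⟨-, h⟩ | ⟨-, h⟩⟩ <;>
  · have := congrArg (Finset.image Prod.fst) h
    rw [image_fst_image_layer, image_fst_image_layer] at this
    rwa [this]

theorem isoOn_layer_right : IsoOn H (H.freeAmalgam s t E F) (layer t) F := by
  rw [freeAmalgam_comm]
  exact isoOn_layer_left

theorem freeAmalgam_edgeCover : ∀ e ∈ (H.freeAmalgam s t E F).edges,
    e ⊆ E.image (layer s) ∨ e ⊆ F.image (layer t) := by
  rintro e ⟨e₀, -, ⟨he, rfl⟩ | ⟨he, rfl⟩⟩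
  · exact Or.inl (Finset.image_subset_image he)
  · exact Or.inr (Finset.image_subset_image he)

variable (hst : ∀ x, s x = t x ↔ x ∈ B) (hBE : B ⊆ E) (hBF : B ⊆ F)
include hst

theorem finPredim_inter_layer_le (hB : H.FinStrong n m B) (hBE : B ⊆ E)
    (A : Finset (V × Bool)) :
    (H.freeAmalgam s t E F).finPredim n m (A ∩ E.image (layer s)) ≤
      (H.freeAmalgam s t E F).finPredim n m A := by
  refine finPredim_inter_le_of_edgeCover freeAmalgam_edgeCover (fun X hX => ?_) A
  obtain ⟨X, hXF, rfl⟩ := Finset.subset_image_iff.1 hX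
  rw [image_layer_inter_image_layer (fun x => eq_comm.trans (hst x)) hBE,
    isoOn_layer_right.finPredim_image hXF,
    isoOn_layer_right.finPredim_image (Finset.inter_subset_left.trans hXF)]
  exact hB.finPredim_inter_le X

theorem finStrong_image_layer_left (hB : H.FinStrong n m B) (hBE : B ⊆ E) :
    (H.freeAmalgam s t E F).FinStrong n m (E.image (layer s)) := fun A hA => by
  simpa only [Finset.inter_eq_right.2 hA] using finPredim_inter_layer_le hst hB hBE A

theorem PredimNonneg.freeAmalgam (hp : H.PredimNonneg n m) (hB : H.FinStrong n m B)
    (hBE : B ⊆ E) : (H.freeAmalgam s t E F).PredimNonneg n m := fun A => by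
  obtain ⟨X, hXE, hX⟩ := Finset.subset_image_iff.1
    (Finset.inter_subset_right : A ∩ E.image (layer s) ⊆ E.image (layer s))
  refine le_trans ?_ (finPredim_inter_layer_le hst hB hBE A)
  rw [← hX, isoOn_layer_left.finPredim_image hXE]
  exact hp X

include hBE hBF

theorem finPredim_freeAmalgam_ge : H.finPredim n m E + H.finPredim n m F ≤
    (H.freeAmalgam s t E F).finPredim n m (E.image (layer s) ∪ F.image (layer t)) +
      H.finPredim n m B := by
  have h := finPredim_inter_add_inter_le (n := n) (m := m)
    (freeAmalgam_edgeCover (H := H) (s := s) (t := t) (E := E) (F := F))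
    (E.image (layer s) ∪ F.image (layer t))
  rwa [Finset.union_inter_cancel_left, Finset.union_inter_cancel_right,
    Finset.inter_eq_right.2 (Finset.inter_subset_left.trans Finset.subset_union_left),
    image_layer_inter_image_layer hst hBF, Finset.inter_eq_right.2 hBE,
    isoOn_layer_left.finPredim_image subset_rfl, isoOn_layer_right.finPredim_image subset_rfl,
    isoOn_layer_left.finPredim_image hBE] at h

end FreeAmalgam

theorem FinStrong.filter_dimClosure (hp : H.PredimNonneg n m) {F B : Finset V}
    (hF : H.FinStrong n m F) [DecidablePred (· ∈ dimClosure (H.finDim n m) B)] :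
    H.FinStrong n m (F.filter (· ∈ dimClosure (H.finDim n m) B)) := by
  obtain ⟨T, hT, hTB, hTs, -⟩ := hp.exists_hull_dimClosure (B := B)
    (T₀ := F.filter (· ∈ dimClosure (H.finDim n m) B)) fun x hx => (Finset.mem_filter.1 hx).2
  have heq : F.filter (· ∈ dimClosure (H.finDim n m) B) = F ∩ T :=
    subset_antisymm (Finset.subset_inter (Finset.filter_subset _ _)
      (Finset.subset_union_left.trans hT)) fun x hx =>
        Finset.mem_filter.2 ⟨(Finset.mem_inter.1 hx).1, hTB (Finset.mem_inter.1 hx).2⟩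
  rw [heq]
  exact hF.inter hTs

namespace IsGeneric

variable (hH : H.IsGeneric n m) (hr : r ≠ 0)
include hH hr

theorem exists_isAut_freeAmalgam {B E F : Finset V} (hB : H.FinStrong n m B)
    (hE : H.FinStrong n m E) (hF : H.FinStrong n m F) (hBE : B ⊆ E) (hBF : B ⊆ F) :
    ∃ p : Equiv.Perm V, H.IsAut p ∧ (∀ x ∈ B, p x = x) ∧
      H.finPredim n m E + H.finPredim n m F ≤
        H.finDim n m (F.image p ∪ E) + H.finPredim n m B := by
  have hp := hH.predimNonneg hr
  let s : V → Bool := fun _ => false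
  let t : V → Bool := fun x => decide (x ∉ B)
  have hst : ∀ x, s x = t x ↔ x ∈ B := fun x => by simp [s, t]
  obtain ⟨α, hα, hαE, hαs⟩ := hH.exists_realization hr hE (hp.freeAmalgam hst hB hBE)
    (D := E.image (layer s) ∪ F.image (layer t)) isoOn_layer_left Finset.subset_union_left
    (finStrong_image_layer_left hst hB hBE)
  have hFs : (H.freeAmalgam s t E F).FinStrong n m (F.image (layer t)) := by
    rw [freeAmalgam_comm]
    exact finStrong_image_layer_left (fun x => eq_comm.trans (hst x)) hB hBF
  have hiso : StrongIso n m H F (α ∘ layer t) := by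
    refine ⟨hF, (hα.mono Finset.subset_union_right).comp isoOn_layer_right, ?_⟩
    rw [← Finset.image_image]
    exact hα.finStrong_image hαs Finset.subset_union_right hFs
  obtain ⟨p, hpa, hpF⟩ := hiso.exists_isAut hH hr
  refine ⟨p, hpa, fun x hx => ?_, ?_⟩
  · have hxst : layer t x = layer s x := congrArg (Prod.mk x) ((hst x).2 hx).symm
    rw [hpF x (hBF hx), Function.comp_apply, hxst, hαE x (hBE hx)]
  · have hE' : Set.EqOn (α ∘ layer s) id E := hαE
    have himage : F.image p ∪ E = (E.image (layer s) ∪ F.image (layer t)).image α := by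
      rw [Finset.image_union, Finset.image_image, Finset.image_image, Finset.image_congr hE',
        Finset.image_id, Finset.union_comm, Finset.image_congr hpF]
    rw [himage, hαs.finDim_eq hp, hα.finPredim_image subset_rfl]
    exact finPredim_freeAmalgam_ge hst hBE hBF

theorem exists_dimIndep (hm : m ≠ 0) (A B C : Finset V) :
    ∃ p : Equiv.Perm V, H.IsAut p ∧ (∀ x ∈ dimClosure (H.finDim n m) B, p x = x) ∧
      DimIndep (H.finDim n m) (A.image p) B C := by
  classical
  have hp := hH.predimNonneg hr
  have hd := hp.isDimension
  obtain ⟨F, hF, hFs, -⟩ := hp.exists_hull (A ∪ B)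
  have hBF : B ⊆ F := Finset.subset_union_right.trans hF
  set B₁ := F.filter (· ∈ dimClosure (H.finDim n m) B)
  have hB₁F : B₁ ⊆ F := Finset.filter_subset _ _
  have hBB₁ : B ⊆ B₁ := fun x hx => Finset.mem_filter.2 ⟨hBF hx, subset_dimClosure _ _ hx⟩
  have hB₁s : H.FinStrong n m B₁ := hFs.filter_dimClosure hp
  have hB₁d : H.finPredim n m B₁ = H.finDim n m B := by
    have hB₁cl : (B₁ : Set V) ⊆ dimClosure (H.finDim n m) B :=
      fun x hx => (Finset.mem_filter.1 hx).2
    rw [← hB₁s.finDim_eq hp, ← hd.union_eq hB₁cl, Finset.union_eq_right.2 hBB₁]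
  obtain ⟨E, hE, hEs, -⟩ := hp.exists_hull (C ∪ B₁)
  have hB₁E : B₁ ⊆ E := Finset.subset_union_right.trans hE
  obtain ⟨q, hq, hqB, hdim⟩ := hH.exists_isAut_freeAmalgam hr hB₁s hEs hFs hB₁E hB₁F
  obtain ⟨p, hpa, hpF, hpB⟩ := hq.exists_eqOn_dimClosure_fixed hH hr hm hFs hBF
    fun x hx hxB => hqB x (Finset.mem_filter.2 ⟨hx, hxB⟩)
  have hBp : B ⊆ F.image p := fun x hx => by
    rw [← hpB x (subset_dimClosure _ _ hx)]
    exact Finset.mem_image_of_mem p (hBF hx)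
  have hind : DimIndep (H.finDim n m) (F.image p) B E := by
    rw [DimIndep, Finset.union_eq_left.2 hBp, Finset.union_eq_right.2 (hBB₁.trans hB₁E),
      hpa.finDim_image hp, hFs.finDim_eq hp, hEs.finDim_eq hp, Finset.image_congr hpF, ← hB₁d]
    lia
  exact ⟨p, hpa, hpB, hind.mono hd ((Finset.image_subset_image
    (Finset.subset_union_left.trans hF)).trans Finset.subset_union_left)
    ((Finset.subset_union_left.trans hE).trans Finset.subset_union_right)⟩

end IsGeneric

end UHypergraph

/-! ### Free points -/

namespace UHypergraph

variable {r n m : ℕ} {V : Type*} [DecidableEq V] {H : UHypergraph r V}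

/-- `a` is free over `X`: adding it to `X` raises the dimension by `n`, the largest possible
amount. -/
def FreeOver (n m : ℕ) (H : UHypergraph r V) (X : Finset V) (a : V) : Prop :=
  H.finDim n m (insert a X) = H.finDim n m X + n

/-- Every finite set has a point which is free over it. -/
def HasFreePoints (n m : ℕ) (H : UHypergraph r V) : Prop :=
  ∀ X, ∃ a, FreeOver n m H X a

theorem FreeOver.notMem (hn : n ≠ 0) {X : Finset V} {a : V} (h : FreeOver n m H X a) : a ∉ X :=
  fun ha => by
    rw [FreeOver, Finset.insert_eq_of_mem ha] at h
    lia

theorem PredimNonneg.finDim_insert_le (hp : H.PredimNonneg n m) (X : Finset V) (a : V) :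
    H.finDim n m (insert a X) ≤ H.finDim n m X + n := by
  obtain ⟨Z, hXZ, hZ⟩ := hp.exists_finPredim_eq_finDim X
  have hle := hp.finDim_le (Finset.insert_subset_insert a hXZ)
  rw [Finset.insert_eq a Z] at hle
  linarith [H.finPredim_submod n m {a} Z, H.finPredim_singleton_le n m a, hp ({a} ∩ Z)]

theorem FreeOver.mono (hp : H.PredimNonneg n m) {X Y : Finset V} {a : V} (hXY : X ⊆ Y)
    (h : FreeOver n m H Y a) : FreeOver n m H X a := by
  have hsub := hp.isDimension.add_le_add_of_subset (A := insert a X) (B := Y) (C := X)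
    (D := insert a Y) (Finset.subset_insert a X) hXY (by grind)
  rw [FreeOver] at h ⊢
  linarith [hp.finDim_insert_le X a]

theorem IsAut.freeOver_image_iff (hp : H.PredimNonneg n m) {p : Equiv.Perm V} (h : H.IsAut p)
    {X : Finset V} {a : V} : FreeOver n m H (X.image p) (p a) ↔ FreeOver n m H X a := by
  rw [FreeOver, FreeOver, ← Finset.image_insert, h.finDim_image hp, h.finDim_image hp]

omit [DecidableEq V] in
theorem PredimNonneg.finDim_empty (hp : H.PredimNonneg n m) (hr : r ≠ 0) :
    H.finDim n m ∅ = 0 := by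
  rw [(hp.finStrong_empty hr).finDim_eq hp, finPredim_empty n m H hr]

/-- An isolated point can be realized in a generic structure, and then made independent from any
given finite set. -/
theorem IsGeneric.hasFreePoints (hH : H.IsGeneric n m) (hr : r ≠ 0) (hm : m ≠ 0) :
    H.HasFreePoints n m := by
  have hp := hH.predimNonneg hr
  intro X
  have hK := predimNonneg_edgeless r n m Unit
  obtain ⟨f, hf, -, hfs⟩ := hH.exists_realization hr (hp.finStrong_empty hr) hK (D := {()})
    (isoOn_empty hr fun _ => ()) (Finset.empty_subset _) (hK.finStrong_empty hr)
  have hdim : H.finDim n m {f ()} = n := by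
    rw [← Finset.image_singleton, hfs.finDim_eq hp, hf.finPredim_image subset_rfl, finPredim]
    simp [edgeless, finEdgesIn]
  obtain ⟨p, hpa, -, hind⟩ := hH.exists_dimIndep hr hm {f ()} ∅ X
  refine ⟨p (f ()), ?_⟩
  have hadd := hind.add_eq hp.isDimension
  rw [Finset.union_empty, Finset.empty_union, hp.finDim_empty hr, hpa.finDim_image hp, hdim,
    Finset.image_singleton, ← Finset.insert_eq] at hadd
  rw [FreeOver]
  lia

theorem HasFreePoints.exists_card_eq (hf : H.HasFreePoints n m) (hp : H.PredimNonneg n m)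
    (hn : n ≠ 0) (D : Finset V) (k : ℕ) :
    ∃ B : Finset V, B.card = k ∧ Disjoint B D ∧
      (∀ Y ⊆ D, H.finDim n m (Y ∪ B) = H.finDim n m Y + k * n) ∧
      ∀ b ∈ B, FreeOver n m H D b := by
  induction k with
  | zero => exact ⟨∅, by simp⟩
  | succ k ih =>
    obtain ⟨B, hBk, hBD, hBdim, hBfree⟩ := ih
    obtain ⟨w, hw⟩ := hf (D ∪ B)
    have hwDB := hw.notMem hn
    refine ⟨insert w B, by rw [Finset.card_insert_of_notMem (by grind), hBk],
      Finset.disjoint_insert_left.2 ⟨by grind, hBD⟩, fun Y hYD => ?_, ?_⟩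
    · have hwY : FreeOver n m H (Y ∪ B) w := hw.mono hp (Finset.union_subset_union_left hYD)
      rw [Finset.union_insert, hwY, hBdim Y hYD]
      push_cast
      ring
    · exact (Finset.forall_mem_insert _ _ _).2 ⟨hw.mono hp Finset.subset_union_left, hBfree⟩

theorem finPredim_insert_add_le {S : Finset V} {w : V} (hw : w ∉ S) {E : Finset (Finset V)}
    (hE : ∀ e ∈ E, e ∈ H.edges ∧ w ∈ e ∧ e ⊆ insert w S) :
    H.finPredim n m (insert w S) + m * E.card ≤ H.finPredim n m S + n := by
  have hdisj : Disjoint (H.finEdgesIn S) E := Finset.disjoint_left.2 fun e heS he =>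
    hw ((mem_finEdgesIn.1 heS).1 (hE e he).2.1)
  have hsub : H.finEdgesIn S ∪ E ⊆ H.finEdgesIn (insert w S) := by
    intro e he
    rw [mem_finEdgesIn]
    rcases Finset.mem_union.1 he with he | he
    · exact ⟨(mem_finEdgesIn.1 he).1.trans (Finset.subset_insert _ _), (mem_finEdgesIn.1 he).2⟩
    · exact ⟨(hE e he).2.2, (hE e he).1⟩
  have hcard : ((H.finEdgesIn S).card + E.card : ℤ) ≤ (H.finEdgesIn (insert w S)).card := by
    exact_mod_cast (Finset.card_union_of_disjoint hdisj).ge.trans (Finset.card_le_card hsub)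
  have hmul := mul_le_mul_of_nonneg_left hcard (Int.natCast_nonneg m)
  rw [finPredim, finPredim, Finset.card_insert_of_notMem hw]
  push_cast
  linarith

theorem FreeOver.notMem_edges (hp : H.PredimNonneg n m) (hn : n ≠ 0) (hm : m ≠ 0)
    {S : Finset V} {w : V} (hS : H.FinStrong n m S) (hw : FreeOver n m H S w) {e : Finset V}
    (hwe : w ∈ e) (heS : e ⊆ insert w S) : e ∉ H.edges := by
  intro he
  have hle := finPredim_insert_add_le (n := n) (m := m) (hw.notMem hn) (E := {e})
    (by simpa using ⟨he, hwe, heS⟩)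
  have hwS := hp.finDim_le (subset_refl (insert w S))
  rw [Finset.card_singleton, Nat.cast_one, mul_one, ← hS.finDim_eq hp] at hle
  rw [FreeOver] at hw
  lia

theorem FreeOver.finStrong_insert (hp : H.PredimNonneg n m) {S : Finset V} {w : V}
    (hS : H.FinStrong n m S) (hw : FreeOver n m H S w) : H.FinStrong n m (insert w S) := by
  refine hp.finStrong_of_finPredim_le ?_
  rw [hw, hS.finDim_eq hp, Finset.insert_eq]
  linarith [H.finPredim_submod n m {w} S, H.finPredim_singleton_le n m w, hp ({w} ∩ S)]

/-! ### Adding an edge -/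

/-- The hypergraph obtained from `H` by adding the edge `e`. -/
def addEdge (H : UHypergraph r V) (e : Finset V) (he : e.card = r) : UHypergraph r V where
  edges := insert e H.edges
  card_edge := by
    rintro f (rfl | hf)
    · exact he
    · exact H.card_edge f hf

section AddEdge

variable {e : Finset V} {he : e.card = r}

omit [DecidableEq V] in
theorem finPredim_addEdge_of_subset (hne : e ∉ H.edges) {A : Finset V} (h : e ⊆ A) :
    (H.addEdge e he).finPredim n m A = H.finPredim n m A - m := by
  classical
  have hein : (H.addEdge e he).finEdgesIn A = insert e (H.finEdgesIn A) := by
    ext f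
    simp only [mem_finEdgesIn, Finset.mem_insert, addEdge, Set.mem_insert_iff]
    grind
  rw [finPredim, hein, Finset.card_insert_of_notMem fun h => hne (mem_finEdgesIn.1 h).2,
    finPredim]
  push_cast
  ring

omit [DecidableEq V] in
theorem finPredim_addEdge_of_not_subset {A : Finset V} (h : ¬ e ⊆ A) :
    (H.addEdge e he).finPredim n m A = H.finPredim n m A := by
  have hein : (H.addEdge e he).finEdgesIn A = H.finEdgesIn A := by
    ext f
    simp only [mem_finEdgesIn, addEdge, Set.mem_insert_iff]
    grind
  rw [finPredim, hein, finPredim]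

theorem isoOn_id_addEdge {S : Finset V} (h : ¬ e ⊆ S) :
    IsoOn H (H.addEdge e he) id S := by
  refine ⟨Function.injective_id.injOn, fun f hf => ?_⟩
  rw [Finset.image_id]
  exact ⟨fun hfe => hfe.resolve_left fun hfe => h (hfe ▸ hf), Or.inr⟩

variable (hp : H.PredimNonneg n m) (hne : e ∉ H.edges) (hme : (m : ℤ) ≤ H.finDim n m e)

include hp hne hme

omit [DecidableEq V] in
theorem PredimNonneg.addEdge : (H.addEdge e he).PredimNonneg n m := by
  intro A
  by_cases hA : e ⊆ A
  · rw [finPredim_addEdge_of_subset hne hA]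
    linarith [hp.finDim_le hA]
  · rw [finPredim_addEdge_of_not_subset hA]
    exact hp A

theorem finDim_addEdge (Y : Finset V) :
    (H.addEdge e he).finDim n m Y = min (H.finDim n m Y) (H.finDim n m (Y ∪ e) - m) := by
  have hp' := hp.addEdge (he := he) hne hme
  refine le_antisymm (le_min ?_ ?_) (le_finDim fun B hB => ?_)
  · obtain ⟨Z, hYZ, hZ⟩ := hp.exists_finPredim_eq_finDim Y
    refine (hp'.finDim_le hYZ).trans ?_
    by_cases heZ : e ⊆ Z
    · rw [finPredim_addEdge_of_subset hne heZ]
      lia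
    · rw [finPredim_addEdge_of_not_subset heZ, hZ]
  · obtain ⟨Z, hYZ, hZ⟩ := hp.exists_finPredim_eq_finDim (Y ∪ e)
    refine (hp'.finDim_le (Finset.subset_union_left.trans hYZ)).trans ?_
    rw [finPredim_addEdge_of_subset hne (Finset.subset_union_right.trans hYZ), hZ]
  · by_cases heB : e ⊆ B
    · rw [finPredim_addEdge_of_subset hne heB]
      exact (min_le_right _ _).trans (sub_le_sub_right
        (hp.finDim_le (Finset.union_subset hB heB)) _)
    · rw [finPredim_addEdge_of_not_subset heB]
      exact (min_le_left _ _).trans (hp.finDim_le hB)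

theorem HasFreePoints.addEdge (hf : H.HasFreePoints n m) :
    (H.addEdge e he).HasFreePoints n m := by
  intro X
  obtain ⟨w, hw⟩ := hf (X ∪ e)
  have hwX : FreeOver n m H X w := hw.mono hp Finset.subset_union_left
  refine ⟨w, ?_⟩
  rw [FreeOver] at hw hwX ⊢
  rw [finDim_addEdge hp hne hme, finDim_addEdge hp hne hme, Finset.insert_union, hw, hwX]
  lia

end AddEdge

section Attach

variable {S T : Finset V} {w : V} (hp : H.PredimNonneg n m) (hmn : m ≤ n)
  (hS : H.FinStrong n m S) (hT : T ⊆ S) (hw : FreeOver n m H S w)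

include hp hmn hT hw

theorem FreeOver.le_finDim_insert : (m : ℤ) ≤ H.finDim n m (insert w T) := by
  have hwT : FreeOver n m H T w := hw.mono hp hT
  rw [FreeOver] at hwT
  linarith [hp.finDim_nonneg T, Int.ofNat_le.2 hmn]

theorem FreeOver.finDim_insert_addEdge {he : (insert w T).card = r}
    (hne : insert w T ∉ H.edges) {Y : Finset V} (hY : Y ⊆ S) :
    (H.addEdge _ he).finDim n m (insert w Y) =
      min (H.finDim n m Y + n) (H.finDim n m (Y ∪ T) + n - m) := by
  have hwY : FreeOver n m H Y w := hw.mono hp hY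
  have hwYT : FreeOver n m H (Y ∪ T) w := hw.mono hp (Finset.union_subset hY hT)
  rw [finDim_addEdge hp hne (hw.le_finDim_insert hp hmn hT), ← Finset.insert_union_distrib, hwY,
    hwYT]

include hS

theorem FreeOver.finStrong_addEdge (hn : n ≠ 0) {he : (insert w T).card = r}
    (hne : insert w T ∉ H.edges) : (H.addEdge _ he).FinStrong n m S := by
  refine (hp.addEdge hne (hw.le_finDim_insert hp hmn hT)).finStrong_of_finPredim_le ?_
  have hwS : ¬ insert w T ⊆ S := fun h => hw.notMem hn (h (Finset.mem_insert_self w T))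
  rw [finPredim_addEdge_of_not_subset hwS, finDim_addEdge hp hne (hw.le_finDim_insert hp hmn hT),
    Finset.union_insert, Finset.union_eq_left.2 hT, hw, hS.finDim_eq hp]
  lia

theorem FreeOver.finStrong_insert_addEdge {he : (insert w T).card = r}
    (hne : insert w T ∉ H.edges) : (H.addEdge _ he).FinStrong n m (insert w S) := by
  refine (hp.addEdge hne (hw.le_finDim_insert hp hmn hT)).finStrong_of_finPredim_le ?_
  rw [finPredim_addEdge_of_subset hne (Finset.insert_subset_insert w hT),
    hw.finDim_insert_addEdge hp hmn hT hne subset_rfl, Finset.union_eq_left.2 hT,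
    ← (hw.finStrong_insert hp hS).finDim_eq hp, hw]
  lia

end Attach

theorem IsGeneric.exists_attached (hH : H.IsGeneric n m) (hr : r ≠ 0) (hn : n ≠ 0) (hm : m ≠ 0)
    (hmn : m ≤ n) {S T : Finset V} (hS : H.FinStrong n m S) (hT : T ⊆ S) (hTr : T.card + 1 = r) :
    ∃ a ∉ S, insert a T ∈ H.edges ∧ ∀ Y ⊆ S, H.finDim n m (insert a Y) =
      min (H.finDim n m Y + n) (H.finDim n m (Y ∪ T) + n - m) := by
  have hp := hH.predimNonneg hr
  obtain ⟨w, hw⟩ := hH.hasFreePoints hr hm S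
  have hwS : w ∉ S := hw.notMem hn
  have he : (insert w T).card = r := by
    rw [Finset.card_insert_of_notMem fun h => hwS (hT h), hTr]
  have hne : insert w T ∉ H.edges := hw.notMem_edges hp hn hm hS
    (Finset.mem_insert_self _ _) (Finset.insert_subset_insert _ hT)
  have hKp := hp.addEdge (he := he) hne (hw.le_finDim_insert hp hmn hT)
  have hwSs := hw.finStrong_insert_addEdge hp hmn hS hT (he := he) hne
  obtain ⟨f, hf, hfS, hfs⟩ := hH.exists_realization hr hS hKp (D := insert w S)
    (isoOn_id_addEdge fun h => hwS (h (Finset.mem_insert_self w T)))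
    (by rw [Finset.image_id]; exact Finset.subset_insert _ _)
    (by rw [Finset.image_id]; exact hw.finStrong_addEdge hp hmn hS hT hn hne)
  have himage : ∀ Y ⊆ S, Y.image f = Y := fun Y hY => by
    have hfY : Set.EqOn f id Y := fun x hx => hfS x (hY hx)
    rw [Finset.image_congr hfY, Finset.image_id]
  refine ⟨f w, fun hfw => ?_, ?_, fun Y hY => ?_⟩
  · rw [hf.1 (Finset.mem_insert_of_mem hfw) (Finset.mem_insert_self w S) (hfS _ hfw)] at hfw
    exact hwS hfw
  · have hedge := (hf.2 (insert w T) (Finset.insert_subset_insert _ hT)).2 (Or.inl rfl)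
    rwa [Finset.image_insert, himage T hT] at hedge
  · have hdim := hf.finDim_image hKp hp hwSs hfs (Finset.insert_subset_insert w hY)
    rw [Finset.image_insert, himage Y hY] at hdim
    rw [hdim, hw.finDim_insert_addEdge hp hmn hT hne hY]

end UHypergraph

/-! ### Nontrivial automorphisms move free points as far as possible -/

namespace UHypergraph

theorem two_le_of_add_lt_mul {r n m : ℕ} (hmr : m + n < r * n) : 2 ≤ r := by
  by_contra! hr
  interval_cases r <;> lia

theorem ne_zero_of_add_lt_mul {r n m : ℕ} (hmr : m + n < r * n) : n ≠ 0 := by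
  rintro rfl
  lia

variable {r n m : ℕ} {V : Type*} [DecidableEq V] {H : UHypergraph r V}

theorem FinStrong.eq_of_insert_mem_edges (hp : H.PredimNonneg n m) (hm : m ≠ 0)
    {S T T' : Finset V} (hS : H.FinStrong n m S) {a : V} (haS : a ∉ S)
    (ha : H.finDim n m S + n ≤ H.finDim n m (insert a S) + m) (hT : T ⊆ S) (hT' : T' ⊆ S)
    (haT : insert a T ∈ H.edges) (haT' : insert a T' ∈ H.edges) : T = T' := by
  by_contra hne
  have hne' : insert a T ≠ insert a T' := fun h => hne <| by
    rw [← Finset.erase_insert fun h => haS (hT h), h, Finset.erase_insert fun h => haS (hT' h)]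
  have hle := finPredim_insert_add_le (n := n) (m := m) haS (E := {insert a T, insert a T'}) (by
    simp only [Finset.mem_insert, Finset.mem_singleton]
    rintro e (rfl | rfl)
    · exact ⟨haT, Finset.mem_insert_self _ _, Finset.insert_subset_insert _ hT⟩
    · exact ⟨haT', Finset.mem_insert_self _ _, Finset.insert_subset_insert _ hT'⟩)
  rw [Finset.card_pair hne', ← hS.finDim_eq hp] at hle
  have haS' := hp.finDim_le (subset_refl (insert a S))
  lia

section Generic

variable (hH : H.IsGeneric n m) (hm : m ≠ 0) (hmn : m ≤ n) (hmr : m + n < r * n)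
  {g : Equiv.Perm V} (hg : H.IsAut g)

include hH hm hmn hmr hg

/-- The point `c` is coded by a point `a` of larger dimension over `X`, attached by an edge to `c`
and to points which are free over everything else. -/
theorem IsAut.apply_eq_self_of_forall_le_finDim {X : Finset V} {l : ℕ}
    (hfix : ∀ a, H.finDim n m X + n ≤ H.finDim n m (insert a X) + l → g a = a) {c : V}
    (hc : H.finDim n m X + n ≤ H.finDim n m (insert c X) + (l + 1)) : g c = c := by
  obtain ⟨k, rfl⟩ := Nat.exists_eq_add_of_le' (two_le_of_add_lt_mul hmr)
  have hn := ne_zero_of_add_lt_mul hmr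
  have hp := hH.predimNonneg (by lia)
  obtain ⟨S₀, hS₀, -, -⟩ := hp.exists_hull (insert c (insert (g c) X))
  obtain ⟨hcS₀, hgcS₀, hXS₀⟩ : c ∈ S₀ ∧ g c ∈ S₀ ∧ X ⊆ S₀ := by
    simpa only [Finset.insert_subset_iff] using hS₀
  obtain ⟨B, hBcard, hBS₀, hBdim, hBfree⟩ :=
    (hH.hasFreePoints (by lia) hm).exists_card_eq hp hn S₀ k
  have hgB : B.image g = B := by
    have hid : Set.EqOn g id B := fun b hb => hfix b <| by
      rw [(hBfree b hb).mono hp hXS₀]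
      lia
    rw [Finset.image_congr hid, Finset.image_id]
  have hcB : c ∉ B := Finset.disjoint_right.1 hBS₀ hcS₀
  obtain ⟨S, hS, hSs, -⟩ := hp.exists_hull (S₀ ∪ B)
  obtain ⟨hS₀S, hBS⟩ := Finset.union_subset_iff.1 hS
  have hcBS : insert c B ⊆ S := Finset.insert_subset (hS₀S hcS₀) hBS
  obtain ⟨a, haS, haB, hadim⟩ := hH.exists_attached (by lia) hn hm hmn hSs hcBS
    (by rw [Finset.card_insert_of_notMem hcB, hBcard])
  have hga : g a = a := hfix a <| by
    have hcBdim := hBdim (insert c X) (Finset.insert_subset hcS₀ hXS₀)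
    rw [Finset.insert_union, ← Finset.union_insert] at hcBdim
    rw [hadim X (hXS₀.trans hS₀S), hcBdim]
    lia
  have hgcB : insert a (insert (g c) B) ∈ H.edges := by
    have hedge := (hg _).2 haB
    rwa [Finset.image_insert, Finset.image_insert, hgB, hga] at hedge
  have haSdim := hadim S subset_rfl
  rw [Finset.union_eq_left.2 hcBS] at haSdim
  exact ((Finset.insert_inj hcB).1 (hSs.eq_of_insert_mem_edges hp hm haS (by lia) hcBS
    (Finset.insert_subset (hS₀S hgcS₀) hBS) haB hgcB)).symm

theorem IsAut.eq_one_of_forall_freeOver {X : Finset V} (h : ∀ a, FreeOver n m H X a → g a = a) :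
    g = 1 := by
  have hp := hH.predimNonneg (by have := two_le_of_add_lt_mul hmr; lia)
  have key (l : ℕ) : ∀ c, H.finDim n m X + n ≤ H.finDim n m (insert c X) + l → g c = c := by
    induction l with
    | zero => exact fun c hc => h c (le_antisymm (hp.finDim_insert_le X c) (by simpa using hc))
    | succ l ih =>
      exact fun c hc => hg.apply_eq_self_of_forall_le_finDim hH hm hmn hmr ih (by simpa using hc)
  ext c
  exact key n c (by linarith [hp.isDimension.mono X (insert c X) (Finset.subset_insert c X)])

end Generic

/-- `a` and `g a` are both free over `X`, and together they raise the dimension of `X` by at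
least `n + β`. -/
structure MovesFreely (n m : ℕ) (H : UHypergraph r V) (g : Equiv.Perm V) (β : ℕ) (X : Finset V)
    (a : V) : Prop where
  freeOver : FreeOver n m H X a
  freeOver_apply : FreeOver n m H X (g a)
  le_finDim : H.finDim n m X + n + β ≤ H.finDim n m (insert a (insert (g a) X))

section MovesFreely

variable {g : Equiv.Perm V} {β : ℕ}

theorem movesFreely_zero (hp : H.PredimNonneg n m) {X : Finset V} {a : V}
    (ha : FreeOver n m H X a) (hga : FreeOver n m H X (g a)) : MovesFreely n m H g 0 X a := by
  refine ⟨ha, hga, ?_⟩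
  have hmono := hp.isDimension.mono (insert a X) (insert a (insert (g a) X))
    (Finset.insert_subset_insert _ (Finset.subset_insert _ _))
  rw [ha] at hmono
  simpa using hmono

theorem IsAut.freeOver_of_union (hp : H.PredimNonneg n m) (hg : H.IsAut g) {X : Finset V} {a : V}
    (ha : FreeOver n m H (X ∪ X.image ⇑g⁻¹) a) : MovesFreely n m H g 0 X a := by
  refine movesFreely_zero hp (ha.mono hp Finset.subset_union_left) ?_
  have hga := (hg.freeOver_image_iff hp).2 (ha.mono hp Finset.subset_union_right)
  rwa [image_image_inv] at hga

theorem MovesFreely.exists_finset (hp : H.PredimNonneg n m) (hn : n ≠ 0)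
    (hβ : ∀ Y, ∃ b, MovesFreely n m H g β Y b) {X : Finset V} {a : V}
    (ha : MovesFreely n m H g β X a) (k : ℕ) :
    ∃ A : Finset V, a ∈ A ∧ A.card = k + 1 ∧
      H.finDim n m (X ∪ A) = H.finDim n m X + (k + 1) * n ∧
      H.finDim n m (X ∪ A.image g) = H.finDim n m X + (k + 1) * n ∧
      H.finDim n m X + (k + 1) * (n + β) ≤ H.finDim n m (X ∪ A ∪ A.image g) ∧
      (g a ∈ A → g a = a) := by
  induction k with
  | zero =>
    refine ⟨{a}, Finset.mem_singleton_self a, rfl, ?_, ?_, ?_, Finset.mem_singleton.1⟩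
    · rw [Finset.union_comm, ← Finset.insert_eq, ha.freeOver]
      ring
    · rw [Finset.image_singleton, Finset.union_comm, ← Finset.insert_eq, ha.freeOver_apply]
      ring
    · have hpair : X ∪ {a} ∪ {g a} = insert a (insert (g a) X) := by grind
      rw [Finset.image_singleton, hpair]
      push_cast
      linarith [ha.le_finDim]
  | succ k ih =>
    obtain ⟨A, haA, hcard, hA, hgA, hAgA, hfix⟩ := ih
    obtain ⟨b, hb⟩ := hβ (X ∪ A ∪ A.image g)
    have hbA := hb.freeOver.notMem hn
    refine ⟨insert b A, Finset.mem_insert_of_mem haA,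
      by rw [Finset.card_insert_of_notMem (by grind), hcard], ?_, ?_, ?_, fun h => ?_⟩
    · rw [Finset.union_insert, hb.freeOver.mono hp (by grind), hA]
      push_cast
      ring
    · rw [Finset.image_insert, Finset.union_insert, hb.freeOver_apply.mono hp (by grind), hgA]
      push_cast
      ring
    · have hinsert : X ∪ insert b A ∪ (insert b A).image g =
          insert b (insert (g b) (X ∪ A ∪ A.image g)) := by
        rw [Finset.image_insert]
        grind
      rw [hinsert]
      push_cast
      linarith [hb.le_finDim]
    · refine hfix (Finset.mem_of_mem_insert_of_ne h ?_)
      rintro rfl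
      exact hbA (Finset.mem_union_right _ (Finset.mem_image_of_mem g haA))

end MovesFreely

theorem finPredim_union_add_inter_le {S T : Finset V} {E : Finset (Finset V)}
    (hE : E ⊆ H.crossEdges S T) :
    H.finPredim n m (S ∪ T) + H.finPredim n m (S ∩ T) + m * E.card ≤
      H.finPredim n m S + H.finPredim n m T := by
  have hcard : (E.card : ℤ) ≤ (H.crossEdges S T).card := by
    exact_mod_cast Finset.card_le_card hE
  have hmul := mul_le_mul_of_nonneg_left hcard (Int.natCast_nonneg m)
  linarith [finPredim_union_add_inter n m H S T]

theorem PredimNonneg.insert_eq_insert_of_mem_edges (hp : H.PredimNonneg n m) {β : ℕ}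
    (hβ : β < m) {X A A' S T : Finset V} {b b' : V} (hS : X ∪ A ∪ A' ⊆ S)
    (hT : insert b (insert b' X) ⊆ T) (hbS : b ∉ S) (hbS' : b' ∉ S)
    (hbA : insert b A ∈ H.edges) (hbA' : insert b' A' ∈ H.edges)
    (hA : H.finDim n m X + m ≤ H.finDim n m (X ∪ A))
    (hA' : H.finDim n m X + m ≤ H.finDim n m (X ∪ A'))
    (hAA' : H.finDim n m X + β + m < H.finDim n m (X ∪ A ∪ A'))
    (hST : H.finPredim n m S + H.finPredim n m T ≤
      H.finPredim n m (S ∪ T) + H.finDim n m X + β + m) :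
    insert b A = insert b' A' := by
  have hcross (hAT : ¬ A ⊆ T) : insert b A ∈ H.crossEdges S T :=
    mem_crossEdges.2 ⟨hbA, by grind, by grind, by grind⟩
  have hcross' (hAT' : ¬ A' ⊆ T) : insert b' A' ∈ H.crossEdges S T :=
    mem_crossEdges.2 ⟨hbA', by grind, by grind, by grind⟩
  have hbound {E : Finset (Finset V)} {Y : Finset V} (hE : E ⊆ H.crossEdges S T)
      (hY : Y ⊆ S ∩ T) : H.finDim n m Y + m * E.card ≤ H.finDim n m X + β + m := by
    linarith [finPredim_union_add_inter_le (n := n) (m := m) hE, hp.finDim_le hY]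
  by_contra hne
  by_cases hAT : A ⊆ T <;> by_cases hAT' : A' ⊆ T
  · have hle := hbound (Finset.empty_subset _) (Y := X ∪ A ∪ A') (by grind)
    rw [Finset.card_empty, Nat.cast_zero, mul_zero] at hle
    lia
  · have hle := hbound (Finset.singleton_subset_iff.2 (hcross' hAT')) (Y := X ∪ A) (by grind)
    rw [Finset.card_singleton, Nat.cast_one, mul_one] at hle
    lia
  · have hle := hbound (Finset.singleton_subset_iff.2 (hcross hAT)) (Y := X ∪ A') (by grind)
    rw [Finset.card_singleton, Nat.cast_one, mul_one] at hle
    lia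
  · have hle := hbound (Finset.insert_subset (hcross hAT)
      (Finset.singleton_subset_iff.2 (hcross' hAT'))) (Y := X) (by grind)
    rw [Finset.card_pair hne] at hle
    lia

section Generic

variable (hH : H.IsGeneric n m) (hr : r ≠ 0) (hm : m ≠ 0) {g : Equiv.Perm V} (hg : H.IsAut g)

include hH hr hm hg

theorem IsAut.exists_attached (hn : n ≠ 0) (hmn : m ≤ n) {X A S : Finset V} (hAr : A.card + 1 = r)
    (hXS : X ⊆ S) (hAS : A ⊆ S) (hA : H.finDim n m X + m ≤ H.finDim n m (X ∪ A))
    (hgA : H.finDim n m X + m ≤ H.finDim n m (X ∪ A.image g)) :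
    ∃ b, b ∉ S ∧ g b ∉ S ∧ insert b A ∈ H.edges ∧ FreeOver n m H X b ∧ FreeOver n m H X (g b) ∧
      H.finDim n m S + n ≤ H.finDim n m (insert b S) + m := by
  have hp := hH.predimNonneg hr
  obtain ⟨S', hS', hSs', -⟩ := hp.exists_hull (S ∪ S.image ⇑g⁻¹)
  obtain ⟨hSS', hgSS'⟩ := Finset.union_subset_iff.1 hS'
  obtain ⟨b, hbS', hbA, hbdim⟩ := hH.exists_attached hr hn hm hmn hSs' (hAS.trans hSS') hAr
  refine ⟨b, fun h => hbS' (hSS' h), fun h => hbS' (hgSS' ?_), hbA, ?_, ?_, ?_⟩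
  · simpa only [perm_inv_apply_self] using Finset.mem_image_of_mem (⇑g⁻¹) h
  · rw [FreeOver, hbdim X (hXS.trans hSS')]
    lia
  · have hunion : H.finDim n m (X.image ⇑g⁻¹ ∪ A) = H.finDim n m (X ∪ A.image g) := by
      rw [← hg.finDim_image hp, Finset.image_union, image_image_inv]
    have hfree : FreeOver n m H (X.image ⇑g⁻¹) b := by
      rw [FreeOver, hbdim _ ((Finset.image_subset_image hXS).trans hgSS'), hunion,
        hg.inv.finDim_image hp]
      lia
    simpa only [image_image_inv] using (hg.freeOver_image_iff hp).2 hfree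
  · rw [hbdim S hSS', Finset.union_eq_left.2 hAS]
    lia

theorem IsAut.exists_movesFreely_zero (X : Finset V) : ∃ a, MovesFreely n m H g 0 X a := by
  obtain ⟨a, ha⟩ := hH.hasFreePoints hr hm (X ∪ X.image ⇑g⁻¹)
  exact ⟨a, hg.freeOver_of_union (hH.predimNonneg hr) ha⟩

omit hr

variable (hmn : m ≤ n) (hmr : m + n < r * n)

include hmn hmr

/-- If `β` is maximal, then a point `b` attached by an edge to a tuple of points which are moved
as far as possible has no room for two distinct edges: the edge at `b` is preserved by `g`. -/
theorem MovesFreely.apply_eq_self {X : Finset V} {β : ℕ} (hβm : β < m)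
    (hmax : ∀ b, ¬ MovesFreely n m H g (β + 1) X b) (hβ : ∀ Y, ∃ b, MovesFreely n m H g β Y b)
    {a : V} (ha : MovesFreely n m H g β X a) : g a = a := by
  obtain ⟨k, rfl⟩ := Nat.exists_eq_add_of_le' (two_le_of_add_lt_mul hmr)
  have hn := ne_zero_of_add_lt_mul hmr
  have hp := hH.predimNonneg (by lia)
  obtain ⟨A, haA, hAcard, hXA, hXgA, hXAgA, hfix⟩ := ha.exists_finset hp hn hβ k
  have hmk : (m : ℤ) < (k + 1) * n := by
    zify at hmr
    linarith
  have hβk : (0 : ℤ) ≤ k * β := by positivity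
  obtain ⟨S, hS, hSs, -⟩ := hp.exists_hull (X ∪ A ∪ A.image g)
  have hAS : A ⊆ S := by grind
  obtain ⟨b, hbS, hgbS, hbA, hbX, hgbX, hbSdim⟩ := hg.exists_attached hH (by lia) hm hn hmn
    (by rw [hAcard]) (by grind : X ⊆ S) hAS (by lia) (by lia)
  obtain ⟨T, hT, -, hTdim⟩ := hp.exists_hull (insert b (insert (g b) X))
  have hTle : H.finPredim n m T ≤ H.finDim n m X + n + β := by
    by_contra! hlt
    exact hmax b ⟨hbX, hgbX, by push_cast; lia⟩
  have hSTle := hp.finDim_le (by grind : insert b S ⊆ S ∪ T)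
  have hedge : insert b A = insert (g b) (A.image g) :=
    hp.insert_eq_insert_of_mem_edges hβm hS hT hbS hgbS hbA
      (by simpa only [Finset.image_insert] using (hg _).2 hbA) (by lia) (by lia)
      (by linarith [hmk])
      (by linarith [hSs.finDim_eq hp])
  refine hfix (Finset.mem_of_mem_insert_of_ne (a := b) ?_ fun h => hbS ?_)
  · rw [hedge]
    exact Finset.mem_insert_of_mem (Finset.mem_image_of_mem g haA)
  · rw [← h]
    exact hS (Finset.mem_union_right _ (Finset.mem_image_of_mem g haA))

theorem IsAut.exists_movesFreely (hg1 : g ≠ 1) {β : ℕ} (hβm : β ≤ m) (X : Finset V) :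
    ∃ a, MovesFreely n m H g β X a := by
  have hr : r ≠ 0 := by have := two_le_of_add_lt_mul hmr; lia
  induction β generalizing X with
  | zero => exact hg.exists_movesFreely_zero hH hr hm X
  | succ β ih =>
    by_contra! hmax
    have hβ := ih (Nat.le_of_succ_le hβm)
    have hfix (a : V) (ha : MovesFreely n m H g β X a) : g a = a :=
      ha.apply_eq_self hH hm hg hmn hmr hβm hmax hβ
    obtain rfl : β = 0 := by
      obtain ⟨a, ha⟩ := hβ X
      have hle := ha.le_finDim
      rw [hfix a ha, Finset.insert_idem, ha.freeOver] at hle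
      lia
    exact hg1 (hg.eq_one_of_forall_freeOver hH hm hmn hmr fun a ha =>
      hfix a (hg.freeOver_of_union (hH.predimNonneg hr) ha))

end Generic

end UHypergraph

/-! ### Adding edges to make a set algebraic -/

theorem exists_add_mul_eq_mul {n m : ℕ} (hnm : n.Coprime m) (hm : m ≠ 0) {a : ℕ} (ha : a ≤ n) :
    ∃ j t : ℕ, a + n * j = m * t ∧ t ≤ n + n * m := by
  obtain ⟨j, hjm, hj⟩ := Nat.exists_mul_mod_eq_of_coprime (a * (m - 1)) hnm hm
  have hdvd : a + n * j ≡ 0 [MOD m] :=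
    calc a + n * j ≡ a + a * (m - 1) [MOD m] := Nat.ModEq.add_left a hj
      _ = a * m := by rw [← mul_one_add, Nat.add_sub_cancel' (Nat.one_le_iff_ne_zero.2 hm)]
      _ ≡ 0 [MOD m] := Nat.modEq_zero_iff_dvd.2 (dvd_mul_left m a)
  obtain ⟨t, ht⟩ := Nat.modEq_zero_iff_dvd.1 hdvd
  refine ⟨j, t, ht, ?_⟩
  calc t ≤ m * t := Nat.le_mul_of_pos_left t (Nat.pos_of_ne_zero hm)
    _ = a + n * j := ht.symm
    _ ≤ n + n * m := by gcongr

namespace UHypergraph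

variable {r n m : ℕ} {V : Type*} {H K K' K'' : UHypergraph r V}

/-- The hypergraph `K'` preserves all equalities `d(Y) = d(Z)` with `Y ⊆ Z` which hold in `K`:
what is algebraic in `K` stays algebraic in `K'`. -/
def PreservesDimEq (n m : ℕ) (K K' : UHypergraph r V) : Prop :=
  ∀ Y Z, Y ⊆ Z → K.finDim n m Y = K.finDim n m Z → K'.finDim n m Y = K'.finDim n m Z

theorem PreservesDimEq.refl (n m : ℕ) (K : UHypergraph r V) : PreservesDimEq n m K K :=
  fun _ _ _ h => h

theorem PreservesDimEq.trans (h : PreservesDimEq n m K K') (h' : PreservesDimEq n m K' K'') :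
    PreservesDimEq n m K K'' :=
  fun Y Z hYZ heq => h' Y Z hYZ (h Y Z hYZ heq)

variable [DecidableEq V]

omit [DecidableEq V] in
theorem preservesDimEq_addEdge (hp : K.PredimNonneg n m) {e : Finset V} {he : e.card = r}
    (hne : e ∉ K.edges) (hme : (m : ℤ) ≤ K.finDim n m e) :
    PreservesDimEq n m K (K.addEdge e he) := by
  classical
  intro Y Z hYZ hd
  have hsub := hp.isDimension.add_le_add_of_subset hYZ
    (Finset.subset_union_left : Y ⊆ Y ∪ e) (by grind : Z ∪ e ⊆ Z ∪ (Y ∪ e))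
  have hmono := hp.isDimension.mono (Y ∪ e) (Z ∪ e) (Finset.union_subset_union_left hYZ)
  rw [finDim_addEdge hp hne hme, finDim_addEdge hp hne hme, hd,
    show K.finDim n m (Y ∪ e) = K.finDim n m (Z ∪ e) by lia]

/-- A supply `C` of auxiliary points in `E₂`, used to make `F` algebraic over `E₂` while leaving it
as free as possible over `E₁`: each of the `N` steps provides at least `r` new points, each of
which raises the dimension over `E₁` and the previous steps by at least `m`. -/
structure IsSupply (n m : ℕ) (H : UHypergraph r V) (E E₁ E₂ F : Finset V) (C : ℕ → Finset V)
    (N : ℕ) : Prop where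
  left_subset : E₁ ⊆ E
  right_subset : E₂ ⊆ E
  mono : Monotone C
  subset_right : ∀ s ≤ N, C s ⊆ E₂
  le_card_sdiff : ∀ s < N, r ≤ (C (s + 1) \ C s).card
  add_le_finDim_insert : ∀ s < N, ∀ c ∈ C (s + 1) \ C s,
    H.finDim n m (E₁ ∪ C s) + m ≤ H.finDim n m (insert c (E₁ ∪ C s))
  notMem : ∀ c ∈ C N, c ∉ F

/-- The hypergraphs `K` obtained from `H` in the course of making `F` algebraic over `E₂` by adding
edges. The set `T` contains the points of `F` outside `E` and the free points used so far, and `s`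
steps of the supply `C` have not been used yet. -/
structure AlgebraizationStage (n m : ℕ) (H : UHypergraph r V) (E E₁ E₂ F : Finset V)
    (C : ℕ → Finset V) (N : ℕ) (k : ℤ) (K : UHypergraph r V) (T : Finset V) (s : ℕ) : Prop where
  predimNonneg : K.PredimNonneg n m
  hasFreePoints : K.HasFreePoints n m
  finDim_eq : ∀ Y ⊆ E, K.finDim n m Y = H.finDim n m Y
  mem_edges_base : ∀ e ⊆ E, e ∈ K.edges ↔ e ∈ H.edges
  mem_edges_target : ∀ e ⊆ F, e ∈ K.edges ↔ e ∈ H.edges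
  le_finDim_union : H.finDim n m (E₁ ∪ C s) + k ≤ K.finDim n m (F ∪ (E₁ ∪ C s))
  finDim_sub_eq : ∀ Y ⊆ T,
    K.finDim n m (E ∪ Y) - H.finDim n m E = K.finDim n m (E₂ ∪ Y) - H.finDim n m E₂
  subset_base : ∀ e ∈ K.edges, e ⊆ E ∪ T → ∀ c ∈ C s, c ∈ e → e ⊆ E
  disjoint : Disjoint T E
  target_subset : F ⊆ E ∪ T
  le : s ≤ N

section Algebraization

variable {E E₁ E₂ F T : Finset V} {C : ℕ → Finset V} {N s t : ℕ} {k : ℤ}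

theorem IsSupply.exists_subset_card_eq (hC : IsSupply n m H E E₁ E₂ F C N)
    (hs : s < N) {i : ℕ} (hi : i ≤ r) :
    ∃ Q ⊆ C (s + 1), Q ⊆ E₂ ∧ Disjoint Q (C s) ∧ Q.card = i ∧
      ∀ c ∈ Q, H.finDim n m (E₁ ∪ C s) + m ≤ H.finDim n m (insert c (E₁ ∪ C s)) := by
  obtain ⟨Q, hQ, hQi⟩ := Finset.exists_subset_card_eq (hi.trans (hC.le_card_sdiff s hs))
  have hQC := hQ.trans Finset.sdiff_subset
  exact ⟨Q, hQC, hQC.trans (hC.subset_right _ hs),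
    Finset.disjoint_left.2 fun c hc => (Finset.mem_sdiff.1 (hQ hc)).2, hQi,
    fun c hc => hC.add_le_finDim_insert s hs c (hQ hc)⟩

variable (hC : IsSupply n m H E E₁ E₂ F C N)

include hC

theorem IsSupply.left_union_subset (hs : s ≤ N) : E₁ ∪ C s ⊆ E :=
  Finset.union_subset hC.left_subset ((hC.subset_right s hs).trans hC.right_subset)

namespace AlgebraizationStage

theorem add_le_finDim_union (h : AlgebraizationStage n m H E E₁ E₂ F C N k K T s) {Q : Finset V}
    (hQ : Q ⊆ E₁ ∪ C s) : H.finDim n m Q + k ≤ K.finDim n m (F ∪ Q) := by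
  have hsub := h.predimNonneg.isDimension.add_le_add_of_subset
    (Finset.subset_union_right : Q ⊆ F ∪ Q) hQ (by grind : F ∪ (E₁ ∪ C s) ⊆ F ∪ Q ∪ (E₁ ∪ C s))
  have hE := hC.left_union_subset h.le
  rw [h.finDim_eq _ hE, h.finDim_eq _ (hQ.trans hE)] at hsub
  linarith [h.le_finDim_union]

theorem mono (h : AlgebraizationStage n m H E E₁ E₂ F C N k K T s) (hts : t ≤ s) :
    AlgebraizationStage n m H E E₁ E₂ F C N k K T t :=
  { h with
    le_finDim_union :=
      h.add_le_finDim_union hC (Finset.union_subset_union subset_rfl (hC.mono hts))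
    subset_base := fun e he heT c hc => h.subset_base e he heT c (hC.mono hts hc)
    le := hts.trans h.le }

theorem addEdge (h : AlgebraizationStage n m H E E₁ E₂ F C N k K T s) {e : Finset V}
    (he : e.card = r) (hne : e ∉ K.edges) (hme : (m : ℤ) ≤ K.finDim n m e)
    (hE : ∀ Y ⊆ E, H.finDim n m Y + m ≤ K.finDim n m (Y ∪ e)) (heE : ¬ e ⊆ E) (heF : ¬ e ⊆ F)
    (hF : H.finDim n m (E₁ ∪ C s) + k + m ≤ K.finDim n m (F ∪ (E₁ ∪ C s) ∪ e)) (heT : e ⊆ E₂ ∪ T)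
    (hes : Disjoint e (C s)) :
    AlgebraizationStage n m H E E₁ E₂ F C N k (K.addEdge e he) T s := by
  have hdim := finDim_addEdge (he := he) h.predimNonneg hne hme
  have hmem {D f : Finset V} (heD : ¬ e ⊆ D) (hf : f ⊆ D) :
      f ∈ (K.addEdge e he).edges ↔ f ∈ K.edges :=
    ⟨fun hf' => hf'.resolve_left fun hfe => heD (hfe ▸ hf), Or.inr⟩
  refine { h with
    predimNonneg := h.predimNonneg.addEdge hne hme
    hasFreePoints := h.hasFreePoints.addEdge h.predimNonneg hne hme
    finDim_eq := fun Y hY => ?_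
    mem_edges_base := fun f hf => (hmem heE hf).trans (h.mem_edges_base f hf)
    mem_edges_target := fun f hf => (hmem heF hf).trans (h.mem_edges_target f hf)
    le_finDim_union := ?_
    finDim_sub_eq := fun Y hY => ?_
    subset_base := ?_ }
  · rw [hdim, ← h.finDim_eq Y hY]
    exact min_eq_left (by linarith [hE Y hY, h.finDim_eq Y hY])
  · rw [hdim]
    exact le_min h.le_finDim_union (by linarith)
  · have hE₂ := hC.right_subset
    have hYE : E ∪ Y ∪ e = E ∪ (Y ∪ e ∩ T) := by grind
    have hYE₂ : E₂ ∪ Y ∪ e = E₂ ∪ (Y ∪ e ∩ T) := by grind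
    have hYe := h.finDim_sub_eq (Y ∪ e ∩ T) (Finset.union_subset hY Finset.inter_subset_right)
    have hY := h.finDim_sub_eq Y hY
    rw [hdim, hdim, hYE, hYE₂]
    lia
  · rintro f (rfl | hf) hfT c hc hcf
    · exact absurd hc (Finset.disjoint_left.1 hes hcf)
    · exact h.subset_base f hf hfT c hc hcf

theorem exists_insert (hn : n ≠ 0) (hm : m ≠ 0)
    (h : AlgebraizationStage n m H E E₁ E₂ F C N k K T s) :
    ∃ w, FreeOver n m K (E ∪ T) w ∧ (∀ e ∈ K.edges, e ⊆ insert w (E ∪ T) → w ∉ e) ∧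
      AlgebraizationStage n m H E E₁ E₂ F C N k K (insert w T) s := by
  have hp := h.predimNonneg
  obtain ⟨Z, hZ, hZs, -⟩ := hp.exists_hull (E ∪ T)
  obtain ⟨w, hwZ⟩ := h.hasFreePoints Z
  have hw := hwZ.mono hp hZ
  have hwET := hw.notMem hn
  have hedge (e : Finset V) (he : e ∈ K.edges) (heT : e ⊆ insert w (E ∪ T)) : w ∉ e := fun hwe =>
    hwZ.notMem_edges hp hn hm hZs hwe (heT.trans (Finset.insert_subset_insert w hZ)) he
  have hE₂ := hC.right_subset
  refine ⟨w, hw, hedge, { h with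
    finDim_sub_eq := fun Y hY => ?_
    subset_base := fun e he heT c => h.subset_base e he ?_ c
    disjoint := Finset.disjoint_insert_left.2 ⟨by grind, h.disjoint⟩
    target_subset := h.target_subset.trans (by grind) }⟩
  · by_cases hwY : w ∈ Y
    · have hY' : Y.erase w ⊆ T := by grind
      have hfree {D : Finset V} (hD : D ⊆ E) :
          K.finDim n m (D ∪ Y) = K.finDim n m (D ∪ Y.erase w) + n := by
        rw [← (hw.mono hp (by grind : D ∪ Y.erase w ⊆ E ∪ T)), ← Finset.union_insert,
          Finset.insert_erase hwY]
      rw [hfree subset_rfl, hfree hE₂]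
      linarith [h.finDim_sub_eq _ hY']
    · exact h.finDim_sub_eq Y (by grind)
  · have := hedge e he (by grind)
    grind

theorem exists_addEdge (hr : 2 ≤ r) (hm : m ≠ 0)
    (h : AlgebraizationStage n m H E E₁ E₂ F C N k K T (s + 1)) {z : V} (hz : z ∈ T)
    (hzm : H.finDim n m E₂ + m ≤ K.finDim n m (insert z E₂)) :
    ∃ K', AlgebraizationStage n m H E E₁ E₂ F C N k K' T s ∧ PreservesDimEq n m K K' ∧
      K'.finDim n m (insert z E₂) = K.finDim n m (insert z E₂) - m := by
  have hd := h.predimNonneg.isDimension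
  have hzE : z ∉ E := Finset.disjoint_left.1 h.disjoint hz
  have hE₂ := hC.right_subset
  obtain ⟨Q, hQC, hQE₂, hQs, hQr, hQdim⟩ := hC.exists_subset_card_eq h.le (Nat.sub_le r 1)
  obtain ⟨c, hc⟩ : Q.Nonempty := Finset.card_pos.1 (by lia)
  have he : (insert z Q).card = r := by rw [Finset.card_insert_of_notMem (by grind)]; lia
  have hs := h.mono hC s.le_succ
  have hCE := (hC.subset_right s hs.le).trans hE₂
  have hne : insert z Q ∉ K.edges := fun hedge =>
    hzE (h.subset_base _ hedge (by grind) c (hQC hc) (by grind) (Finset.mem_insert_self z Q))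
  have hzdim : H.finDim n m E + m ≤ K.finDim n m (insert z E) := by
    have := h.finDim_sub_eq {z} (Finset.singleton_subset_iff.2 hz)
    rw [Finset.union_comm, ← Finset.insert_eq, Finset.union_comm, ← Finset.insert_eq] at this
    lia
  have hE (Y) (hY : Y ⊆ E) : H.finDim n m Y + m ≤ K.finDim n m (Y ∪ insert z Q) := by
    have := hd.add_le_add_of_subset hY (Finset.subset_union_left : Y ⊆ Y ∪ insert z Q)
      (by grind : insert z E ⊆ E ∪ (Y ∪ insert z Q))
    rw [h.finDim_eq _ subset_rfl, h.finDim_eq _ hY] at this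
    lia
  have hme : (m : ℤ) ≤ K.finDim n m (insert z Q) := by
    have := hE ∅ (Finset.empty_subset E)
    rwa [← h.finDim_eq ∅ (Finset.empty_subset E), h.predimNonneg.finDim_empty (by lia), zero_add,
      Finset.empty_union] at this
  have hF : H.finDim n m (E₁ ∪ C s) + k + m ≤ K.finDim n m (F ∪ (E₁ ∪ C s) ∪ insert z Q) := by
    have hsub : insert c (E₁ ∪ C s) ⊆ E₁ ∪ C (s + 1) := by
      have := hC.mono s.le_succ
      grind
    have := hd.mono (F ∪ insert c (E₁ ∪ C s)) (F ∪ (E₁ ∪ C s) ∪ insert z Q) (by grind)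
    linarith [hQdim c hc, h.add_le_finDim_union hC hsub]
  refine ⟨_, hs.addEdge hC he hne hme hE (by grind) ?_ hF (by grind) ?_,
    preservesDimEq_addEdge h.predimNonneg hne hme, ?_⟩
  · exact fun heF => hC.notMem c (hC.mono h.le (hQC hc)) (heF (Finset.mem_insert_of_mem hc))
  · exact Finset.disjoint_insert_left.2 ⟨fun hzC => hzE (hCE hzC), hQs⟩
  · rw [finDim_addEdge h.predimNonneg hne hme,
      Finset.union_eq_left.2 (Finset.insert_subset_insert z hQE₂)]
    lia

theorem exists_insert_addEdge (hr : 2 ≤ r) (hn : n ≠ 0) (hm : m ≠ 0) (hmn : m ≤ n)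
    (h : AlgebraizationStage n m H E E₁ E₂ F C N k K T (s + 1)) {z : V} (hz : z ∈ T)
    (hzm : K.finDim n m (insert z E₂) ≤ H.finDim n m E₂ + m) :
    ∃ w K', AlgebraizationStage n m H E E₁ E₂ F C N k K' (insert w T) s ∧
      PreservesDimEq n m K K' ∧
      K'.finDim n m (insert w E₂) = K.finDim n m (insert z E₂) + n - m ∧
      K'.finDim n m (insert w (insert z E₂)) = K.finDim n m (insert z E₂) + n - m := by
  have hp := h.predimNonneg
  have hzE : z ∉ E := Finset.disjoint_left.1 h.disjoint hz
  have hE₂ := hC.right_subset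
  obtain ⟨Q, -, hQE₂, hQs, hQr, -⟩ := hC.exists_subset_card_eq h.le (Nat.sub_le r 2)
  have hs := h.mono hC s.le_succ
  have hCE := (hC.subset_right s hs.le).trans hE₂
  have hE₁C := hC.left_union_subset hs.le
  obtain ⟨w, hw, hwedge, hsw⟩ := hs.exists_insert hC hn hm
  have hwET := hw.notMem hn
  have hzQ : insert z Q ⊆ E ∪ T := by grind
  have he : (insert w (insert z Q)).card = r := by
    rw [Finset.card_insert_of_notMem (by grind), Finset.card_insert_of_notMem (by grind)]
    lia
  have hne : insert w (insert z Q) ∉ K.edges := fun hedge =>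
    hwedge _ hedge (by grind) (Finset.mem_insert_self w _)
  have hme := hw.le_finDim_insert hp hmn hzQ
  have hwdim (Y) (hY : Y ⊆ E ∪ T) :
      K.finDim n m Y + n ≤ K.finDim n m (Y ∪ insert w (insert z Q)) := by
    rw [Finset.union_insert, hw.mono hp (Finset.union_subset hY hzQ)]
    linarith [hp.isDimension.mono Y (Y ∪ insert z Q) Finset.subset_union_left]
  have hE (Y) (hY : Y ⊆ E) :
      H.finDim n m Y + m ≤ K.finDim n m (Y ∪ insert w (insert z Q)) := by
    linarith [hwdim Y (hY.trans Finset.subset_union_left), h.finDim_eq Y hY]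
  have hF := hwdim (F ∪ (E₁ ∪ C s))
    (Finset.union_subset h.target_subset (hE₁C.trans Finset.subset_union_left))
  refine ⟨w, _, hsw.addEdge hC he hne hme hE (by grind) ?_ ?_ (by grind) ?_,
    preservesDimEq_addEdge hp hne hme, ?_, ?_⟩
  · exact fun heF => hwET (h.target_subset (heF (Finset.mem_insert_self w _)))
  · linarith [hs.le_finDim_union]
  · refine Finset.disjoint_insert_left.2 ⟨fun hwC => ?_,
      Finset.disjoint_insert_left.2 ⟨fun hzC => hzE (hCE hzC), hQs⟩⟩
    exact hwET (Finset.mem_union_left T (hCE hwC))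
  · rw [hw.finDim_insert_addEdge hp hmn hzQ hne (hE₂.trans Finset.subset_union_left),
      Finset.union_insert, Finset.union_eq_left.2 hQE₂, h.finDim_eq E₂ hE₂]
    lia
  · rw [hw.finDim_insert_addEdge hp hmn hzQ hne (by grind),
      Finset.union_eq_left.2 (Finset.insert_subset_insert z hQE₂)]
    lia

theorem finDim_le_insert (h : AlgebraizationStage n m H E E₁ E₂ F C N k K T s) (z : V) :
    H.finDim n m E₂ ≤ K.finDim n m (insert z E₂) := by
  rw [← h.finDim_eq E₂ hC.right_subset]
  exact h.predimNonneg.isDimension.mono E₂ (insert z E₂) (Finset.subset_insert z E₂)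

/-- While the codimension `κ` of `z` over `E₂` is at least `m`, an edge through `z` lowers it by
`m`; otherwise `z` is linked to a free point, whose codimension becomes `κ + n - m` and which is
treated in its place. -/
theorem exists_algebraic (hr : 2 ≤ r) (hn : n ≠ 0) (hm : m ≠ 0) (hmn : m ≤ n)
    (h : AlgebraizationStage n m H E E₁ E₂ F C N k K T (s + t)) {z : V} (hz : z ∈ T) {κ : ℤ} {j : ℕ}
    (hκ : K.finDim n m (insert z E₂) = H.finDim n m E₂ + κ) (hj : κ + n * j = m * t) :
    ∃ K' T', T ⊆ T' ∧ AlgebraizationStage n m H E E₁ E₂ F C N k K' T' s ∧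
      PreservesDimEq n m K K' ∧ K'.finDim n m (insert z E₂) = H.finDim n m E₂ := by
  induction t generalizing K T z κ j with
  | zero =>
    have : (0 : ℤ) ≤ n * j := by positivity
    rw [Nat.cast_zero, mul_zero] at hj
    exact ⟨K, T, subset_rfl, h, .refl n m K, by linarith [h.finDim_le_insert hC z]⟩
  | succ t ih =>
    push_cast at hj
    obtain hκm | hκm := le_or_gt (m : ℤ) κ
    · obtain ⟨K₁, h₁, hK₁, hdim⟩ := h.exists_addEdge hC hr hm hz (by lia)
      obtain ⟨K', T', hT', h', hK', hz'⟩ := ih h₁ hz (κ := κ - m) (j := j) (by lia) (by lia)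
      exact ⟨K', T', hT', h', hK₁.trans hK', hz'⟩
    obtain rfl | j := j
    · have : (0 : ℤ) ≤ m * t := by positivity
      lia
    obtain ⟨w, K₁, h₁, hK₁, hw, hwz⟩ := h.exists_insert_addEdge hC hr hn hm hmn hz (by lia)
    obtain ⟨K', T', hT', h', hK', hw'⟩ := ih h₁ (Finset.mem_insert_self w T) (κ := κ + n - m)
      (j := j) (by lia) (by lia)
    refine ⟨K', T', (Finset.subset_insert w T).trans hT', h', hK₁.trans hK', le_antisymm ?_
      (h'.finDim_le_insert hC z)⟩
    calc K'.finDim n m (insert z E₂) ≤ K'.finDim n m (insert w (insert z E₂)) :=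
          h'.predimNonneg.isDimension.mono _ _ (Finset.subset_insert w _)
      _ = K'.finDim n m (insert w E₂) := .symm <|
          hK' _ _ (Finset.insert_subset_insert w (Finset.subset_insert z E₂)) (by lia)
      _ = H.finDim n m E₂ := hw'

theorem exists_forall_algebraic (hr : 2 ≤ r) (hn : n ≠ 0) (hm : m ≠ 0) (hmn : m ≤ n)
    (hnm : n.Coprime m) {B : Finset V}
    (h : AlgebraizationStage n m H E E₁ E₂ F C N k K T (s + (n + n * m) * B.card)) (hB : B ⊆ T) :
    ∃ K' T', T ⊆ T' ∧ AlgebraizationStage n m H E E₁ E₂ F C N k K' T' s ∧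
      PreservesDimEq n m K K' ∧ ∀ z ∈ B, K'.finDim n m (insert z E₂) = H.finDim n m E₂ := by
  induction B using Finset.induction_on generalizing s with
  | empty => exact ⟨K, T, subset_rfl, by simpa using h, .refl n m K, by simp⟩
  | insert b B hb ih =>
    rw [Finset.card_insert_of_notMem hb, mul_add_one, add_comm (_ * _), ← add_assoc] at h
    obtain ⟨K₁, T₁, hT₁, h₁, hK₁, hdim₁⟩ := ih h ((Finset.subset_insert b B).trans hB)
    obtain ⟨a, ha⟩ := Int.le.dest (h₁.finDim_le_insert hC b)
    have han : a ≤ n := by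
      have := h₁.predimNonneg.finDim_insert_le E₂ b
      rw [h₁.finDim_eq _ hC.right_subset] at this
      lia
    obtain ⟨j, t, hjt, ht⟩ := exists_add_mul_eq_mul hnm hm han
    obtain ⟨K₂, T₂, hT₂, h₂, hK₂, hb₂⟩ := (h₁.mono hC (Nat.add_le_add_left ht s)).exists_algebraic
      hC hr hn hm hmn (hT₁ (hB (Finset.mem_insert_self b B))) ha.symm (mod_cast hjt)
    refine ⟨K₂, T₂, hT₁.trans hT₂, h₂, hK₁.trans hK₂, Finset.forall_mem_insert _ _ _ |>.2
      ⟨hb₂, fun z hz => ?_⟩⟩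
    have := hK₂ E₂ (insert z E₂) (Finset.subset_insert z E₂)
      (by rw [hdim₁ z hz, h₁.finDim_eq _ hC.right_subset])
    rw [← this, h₂.finDim_eq _ hC.right_subset]

end AlgebraizationStage

end Algebraization

end UHypergraph

/-! ### Algebraic conjugates -/

namespace UHypergraph

variable {r n m : ℕ} {V : Type*} [DecidableEq V] {H : UHypergraph r V}

section Supply

variable {g : Equiv.Perm V} {β : ℕ} {X : Finset V}

theorem exists_seq_movesFreely (h : ∀ Y, ∃ a, MovesFreely n m H g β Y a) (X : Finset V) :
    ∃ c : ℕ → V, ∀ i, MovesFreely n m H g β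
      (X ∪ (Finset.range i).image (g ∘ c) ∪ (Finset.range i).image c) (c i) := by
  choose mv hmv using h
  let Y : ℕ → Finset V := fun i => Nat.rec X (fun _ Z => insert (mv Z) (insert (g (mv Z)) Z)) i
  have hY (i : ℕ) : Y i = X ∪ (Finset.range i).image (g ∘ mv ∘ Y) ∪
      (Finset.range i).image (mv ∘ Y) := by
    induction i with
    | zero => simp [Y]
    | succ i ih =>
      have hsucc : Y (i + 1) = insert (mv (Y i)) (insert (g (mv (Y i))) (Y i)) := rfl
      rw [hsucc, Finset.range_add_one, Finset.image_insert, Finset.image_insert,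
        Finset.union_insert, Finset.union_insert, Finset.insert_union, ← ih]
      rfl
  exact ⟨mv ∘ Y, fun i => hY i ▸ hmv (Y i)⟩

variable {c : ℕ → V} (hc : ∀ i, MovesFreely n m H g β
  (X ∪ (Finset.range i).image (g ∘ c) ∪ (Finset.range i).image c) (c i))
include hc

theorem injective_of_movesFreely (hn : n ≠ 0) : Function.Injective c := by
  refine .of_lt_imp_ne fun i j hij h => (hc j).freeOver.notMem hn ?_
  rw [← h]
  exact Finset.mem_union_right _ (Finset.mem_image_of_mem c (Finset.mem_range.2 hij))

/-- The gain `β` in dimension over the images of the preceding points is not lost when images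
of later points are added, as these are free. -/
theorem add_le_finDim_insert_of_movesFreely (hp : H.PredimNonneg n m) {i L : ℕ} (hL : i < L) :
    H.finDim n m (X ∪ (Finset.range L).image (g ∘ c) ∪ (Finset.range i).image c) + β ≤
      H.finDim n m
        (insert (c i) (X ∪ (Finset.range L).image (g ∘ c) ∪ (Finset.range i).image c)) := by
  induction L, hL using Nat.le_induction with
  | base =>
    rw [Finset.range_add_one, Finset.image_insert, Finset.union_insert, Finset.insert_union]
    have hle := hp.finDim_insert_le
      (X ∪ (Finset.range i).image (g ∘ c) ∪ (Finset.range i).image c) (g (c i))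
    have hgain := (hc i).le_finDim
    rw [Function.comp_apply]
    linarith
  | succ L hL ih =>
    rw [Finset.range_add_one, Finset.image_insert, Finset.union_insert, Finset.insert_union,
      Finset.insert_comm]
    have hci : c i ∈ (Finset.range L).image c :=
      Finset.mem_image_of_mem c (Finset.mem_range.2 hL)
    have hiL : (Finset.range i).image c ⊆ (Finset.range L).image c :=
      Finset.image_subset_image (Finset.range_subset_range.2 (Nat.le_of_lt hL))
    have hfree := (hc L).freeOver_apply.mono hp (Finset.insert_subset
      (Finset.mem_union_right _ hci) (Finset.union_subset_union subset_rfl hiL))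
    have hle := hp.finDim_insert_le
      (X ∪ (Finset.range L).image (g ∘ c) ∪ (Finset.range i).image c) (g (c L))
    rw [Function.comp_apply, hfree]
    linarith

theorem add_le_finDim_insert_of_mem_sdiff (hp : H.PredimNonneg n m) {j k L : ℕ} (hkL : k ≤ L)
    {a : V} (ha : a ∈ (Finset.range k).image c \ (Finset.range j).image c) :
    H.finDim n m (X ∪ (Finset.range L).image (g ∘ c) ∪ (Finset.range j).image c) + β ≤
      H.finDim n m
        (insert a (X ∪ (Finset.range L).image (g ∘ c) ∪ (Finset.range j).image c)) := by
  obtain ⟨hak, haj⟩ := Finset.mem_sdiff.1 ha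
  obtain ⟨i, hi, rfl⟩ := Finset.mem_image.1 hak
  have hji : j ≤ i := by
    by_contra! h
    exact haj (Finset.mem_image_of_mem c (Finset.mem_range.2 h))
  have hsub : X ∪ (Finset.range L).image (g ∘ c) ∪ (Finset.range j).image c ⊆
      X ∪ (Finset.range L).image (g ∘ c) ∪ (Finset.range i).image c :=
    Finset.union_subset_union subset_rfl
      (Finset.image_subset_image (Finset.range_subset_range.2 hji))
  have hgain := add_le_finDim_insert_of_movesFreely hc hp ((Finset.mem_range.1 hi).trans_le hkL)
  have hsubmod := hp.isDimension.add_le_add_of_subset (Finset.subset_insert (c i) _) hsub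
    (Finset.insert_subset (Finset.mem_union_left _ (Finset.mem_insert_self _ _))
      Finset.subset_union_right)
  linarith

end Supply

section Generic

variable (hH : H.IsGeneric n m) (hm : m ≠ 0) (hmn : m ≤ n) (hmr : m + n < r * n)
  {g : Equiv.Perm V} (hg : H.IsAut g) (hg1 : g ≠ 1)
include hH hm hmn hmr hg hg1

theorem exists_supply {X X' : Finset V} (hX : X ⊆ X') :
    ∃ C : ℕ → Finset V, Monotone C ∧ (∀ s, r ≤ (C (s + 1) \ C s).card) ∧
      (∀ s, ∀ c ∈ C s, c ∉ dimClosure (H.finDim n m) X) ∧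
      ∀ N, ∀ s < N, ∀ c ∈ C (s + 1) \ C s, H.finDim n m (X' ∪ (C N).image g ∪ C s) + m ≤
        H.finDim n m (insert c (X' ∪ (C N).image g ∪ C s)) := by
  have hn := ne_zero_of_add_lt_mul hmr
  have hp := hH.predimNonneg fun hr => by simp [hr] at hmr
  obtain ⟨c, hc⟩ := exists_seq_movesFreely
    (fun Y => hg.exists_movesFreely hH hm hmn hmr hg1 le_rfl Y) X'
  have hinj := injective_of_movesFreely hc hn
  refine ⟨fun s => (Finset.range (r * s)).image c, fun s t hst => ?_, fun s => ?_,
    fun s x hx hxX => ?_, fun N s hs x hx => ?_⟩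
  · exact Finset.image_subset_image (Finset.range_subset_range.2 (Nat.mul_le_mul_left _ hst))
  · rw [← Finset.image_sdiff _ _ hinj, Finset.card_image_of_injective _ hinj]
    refine le_trans ?_ (Finset.le_card_sdiff _ _)
    rw [Finset.card_range, Finset.card_range, Nat.mul_succ]
    lia
  · obtain ⟨i, -, rfl⟩ := Finset.mem_image.1 hx
    have hfree : FreeOver n m H X (c i) := (hc i).freeOver.mono hp (hX.trans
      (Finset.subset_union_left.trans Finset.subset_union_left))
    have := hfree.symm.trans hxX
    lia
  · rw [Finset.image_image]
    exact add_le_finDim_insert_of_mem_sdiff hc hp (Nat.mul_le_mul_left r hs) hx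

end Generic

end UHypergraph

namespace UHypergraph

variable {r n m : ℕ} {V : Type*} [DecidableEq V] {H K : UHypergraph r V}

section Algebraization

variable {X E E₁ E₂ F : Finset V} {C : ℕ → Finset V} {N : ℕ}
  (hp : H.PredimNonneg n m) (hF : H.FinStrong n m F) (hXF : X ⊆ F)
  (hi : DimIndep (H.finDim n m) F X E)
include hp hF hXF hi

theorem subset_or_subset_of_dimIndep (hm : m ≠ 0) (hE : H.FinStrong n m E) (hXE : X ⊆ E)
    {e : Finset V} (he : e ∈ H.edges) (heEF : e ⊆ E ∪ F) : e ⊆ E ∨ e ⊆ F := by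
  refine hp.subset_or_subset_of_mem_edges ?_ hm he heEF
  have heq := hi.sub_eq hp.isDimension subset_rfl hXE subset_rfl
  rw [Finset.union_eq_right.2 hXF] at heq
  have hle := hp.finDim_le (Finset.subset_inter hXE hXF)
  rw [← hE.finDim_eq hp, ← hF.finDim_eq hp]
  linarith

theorem IsSupply.algebraizationStage (hC : IsSupply n m H E E₁ E₂ F C N) (hm : m ≠ 0)
    (hfree : H.HasFreePoints n m) (hE : H.FinStrong n m E) (hX₁ : X ⊆ E₁) (hX₂ : X ⊆ E₂) :
    AlgebraizationStage n m H E E₁ E₂ F C N (H.finDim n m F - H.finDim n m X) H (F \ E) N where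
  predimNonneg := hp
  hasFreePoints := hfree
  finDim_eq _ _ := rfl
  mem_edges_base _ _ := Iff.rfl
  mem_edges_target _ _ := Iff.rfl
  le_finDim_union := by
    have heq := hi.sub_eq hp.isDimension (hC.left_union_subset le_rfl)
      (hX₁.trans Finset.subset_union_left) subset_rfl
    rw [Finset.union_eq_right.2 hXF, Finset.union_comm] at heq
    linarith
  finDim_sub_eq Y hY := by
    have hYF := hY.trans Finset.sdiff_subset
    rw [hi.sub_eq hp.isDimension subset_rfl (hX₁.trans hC.left_subset) hYF,
      hi.sub_eq hp.isDimension hC.right_subset hX₂ hYF]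
  subset_base e he heEF c hc hce :=
    (subset_or_subset_of_dimIndep hp hF hXF hi hm hE (hX₁.trans hC.left_subset) he
      (heEF.trans (Finset.union_subset_union subset_rfl Finset.sdiff_subset))).resolve_right
      fun heF => hC.notMem c hc (heF hce)
  disjoint := Finset.sdiff_disjoint
  target_subset := by
    rw [Finset.union_sdiff_self_eq_union]
    exact Finset.subset_union_right
  le := le_rfl

end Algebraization

/-- The structure `K` is obtained from `H` by adding edges so as to make `F` algebraic over `E₂`
without destroying the independence of `F` from `E₁` over `X`; both `F` and the ambient set `E` of
`E₁` and `E₂` retain their induced structures, and are strong. -/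
structure Algebraizes (n m : ℕ) (H K : UHypergraph r V) (X E E₁ E₂ F : Finset V) : Prop where
  predimNonneg : K.PredimNonneg n m
  isoOn_base : IsoOn H K id E
  isoOn_target : IsoOn H K id F
  finStrong_base : K.FinStrong n m E
  finStrong_target : K.FinStrong n m F
  finDim_union_eq : K.finDim n m (E₂ ∪ F) = H.finDim n m E₂
  le_finDim_union : H.finDim n m F + H.finDim n m E₁ ≤ K.finDim n m (F ∪ E₁) + H.finDim n m X

variable {X E E₁ E₂ F : Finset V}

theorem isoOn_id_of_mem_edges_iff {A : Finset V}
    (h : ∀ e ⊆ A, e ∈ K.edges ↔ e ∈ H.edges) : IsoOn H K id A :=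
  ⟨Function.injective_id.injOn, fun e he => by rw [Finset.image_id, h e he]⟩

theorem IsoOn.finPredim_eq {A : Finset V} (h : IsoOn H K id A) :
    K.finPredim n m A = H.finPredim n m A := by
  rw [← h.finPredim_image subset_rfl, Finset.image_id]

theorem IsSupply.exists_algebraizes {C : ℕ → Finset V} {N : ℕ}
    (hC : IsSupply n m H E E₁ E₂ F C N) (hN : (n + n * m) * F.card ≤ N) (hr : 2 ≤ r) (hn : n ≠ 0)
    (hm : m ≠ 0) (hmn : m ≤ n) (hnm : n.Coprime m) (hp : H.PredimNonneg n m)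
    (hfree : H.HasFreePoints n m) (hE : H.FinStrong n m E) (hF : H.FinStrong n m F) (hXF : X ⊆ F)
    (hX₁ : X ⊆ E₁) (hX₂ : X ⊆ E₂) (hi : DimIndep (H.finDim n m) F X E) :
    ∃ K, Algebraizes n m H K X E E₁ E₂ F := by
  have hXE : X ⊆ E := hX₂.trans hC.right_subset
  have hcard : 0 + (n + n * m) * (F \ E).card ≤ N := by
    rw [Nat.zero_add]
    exact (Nat.mul_le_mul_left _ (Finset.card_le_card Finset.sdiff_subset)).trans hN
  have hstage := (hC.algebraizationStage hp hF hXF hi hm hfree hE hX₁ hX₂).mono hC hcard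
  obtain ⟨K, T, -, hK, -, halg⟩ :=
    hstage.exists_forall_algebraic hC hr hn hm hmn hnm subset_rfl
  have hd := hK.predimNonneg.isDimension
  have hisoE := isoOn_id_of_mem_edges_iff hK.mem_edges_base
  have hisoF := isoOn_id_of_mem_edges_iff hK.mem_edges_target
  have hKE₂ := hK.finDim_eq E₂ hC.right_subset
  have hle : H.finDim n m E₁ + (H.finDim n m F - H.finDim n m X) ≤ K.finDim n m (F ∪ E₁) :=
    hK.add_le_finDim_union hC Finset.subset_union_left
  refine ⟨K, hK.predimNonneg, hisoE, hisoF, hK.predimNonneg.finStrong_of_finPredim_le ?_,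
    hK.predimNonneg.finStrong_of_finPredim_le ?_, ?_, by linarith⟩
  · rw [hisoE.finPredim_eq, hK.finDim_eq E subset_rfl, hE.finDim_eq hp]
  · have hsubmod := hd.add_le_add_of_subset hXF hX₁ (subset_refl (F ∪ E₁))
    rw [hK.finDim_eq X hXE, hK.finDim_eq E₁ hC.left_subset] at hsubmod
    rw [hisoF.finPredim_eq, ← hF.finDim_eq hp]
    linarith
  · rw [← hKE₂]
    refine hd.union_eq fun x hx => ?_
    rw [hd.mem_dimClosure_iff, hKE₂]
    by_cases hxE : x ∈ E
    · have hxX : x ∈ dimClosure (H.finDim n m) X := hi.dimClosure_inter_subset hp.isDimension hXF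
        hXE ⟨subset_dimClosure _ _ hx, subset_dimClosure _ _ hxE⟩
      rw [hK.finDim_eq _ (Finset.insert_subset hxE hC.right_subset)]
      exact hp.isDimension.mem_dimClosure_iff.1 (hp.isDimension.dimClosure_mono hX₂ hxX)
    · exact (halg x (Finset.mem_sdiff.2 ⟨hx, hxE⟩)).le

theorem Algebraizes.exists_isAut (hK : Algebraizes n m H K X E E₁ E₂ F) (hH : H.IsGeneric n m)
    (hr : r ≠ 0) (hE : H.FinStrong n m E) (hF : H.FinStrong n m F) :
    ∃ p : Equiv.Perm V, H.IsAut p ∧ (∀ x ∈ F, x ∈ E → p x = x) ∧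
      ∀ Y ⊆ E, H.finDim n m (F.image p ∪ Y) = K.finDim n m (F ∪ Y) := by
  obtain ⟨D, hEFD, hD, -⟩ := hK.predimNonneg.exists_hull (E ∪ F)
  have hED : E ⊆ D := Finset.subset_union_left.trans hEFD
  have hFD : F ⊆ D := Finset.subset_union_right.trans hEFD
  obtain ⟨f, hf, hfE, hfD⟩ := hH.exists_realization hr hE hK.predimNonneg (D := D)
    hK.isoOn_base (by rwa [Finset.image_id]) (by rw [Finset.image_id]; exact hK.finStrong_base)
  have hfF : StrongIso n m H F f :=
    ⟨hF, IsoOn.comp (by rw [Finset.image_id']; exact hf.mono hFD) hK.isoOn_target,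
      hf.finStrong_image hfD hFD hK.finStrong_target⟩
  obtain ⟨p, hp, hpF⟩ := hfF.exists_isAut hH hr
  refine ⟨p, hp, fun x hxF hxE => (hpF x hxF).trans (hfE x hxE), fun Y hY => ?_⟩
  have hid : Set.EqOn f id Y := fun x hx => hfE x (hY hx)
  rw [Finset.image_congr (g := f) hpF,
    ← hf.finDim_image hK.predimNonneg (hH.predimNonneg hr) hD hfD
      (Finset.union_subset hFD (hY.trans hED)),
    Finset.image_union, Finset.image_congr hid, Finset.image_id]

theorem Algebraizes.exists_isAut_fixed (hK : Algebraizes n m H K X E E₁ E₂ F)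
    (hH : H.IsGeneric n m) (hr : r ≠ 0) (hm : m ≠ 0) (hE : H.FinStrong n m E)
    (hF : H.FinStrong n m F) (hE₁ : E₁ ⊆ E) (hE₂ : E₂ ⊆ E) (hXF : X ⊆ F) (hX₁ : X ⊆ E₁)
    (hXE : ∀ x ∈ F, x ∈ dimClosure (H.finDim n m) X → x ∈ E) :
    ∃ p : Equiv.Perm V, H.IsAut p ∧ (∀ x ∈ dimClosure (H.finDim n m) X, p x = x) ∧
      (F.image p : Set V) ⊆ dimClosure (H.finDim n m) E₂ ∧
      DimIndep (H.finDim n m) (F.image p) X E₁ := by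
  have hp := hH.predimNonneg hr
  obtain ⟨q, hq, hqid, hqdim⟩ := hK.exists_isAut hH hr hE hF
  obtain ⟨p, hpa, hpF, hpX⟩ := hq.exists_eqOn_dimClosure_fixed hH hr hm hF hXF fun x hx hxX =>
    hqid x hx (hXE x hx hxX)
  have hpq : F.image p = F.image q := Finset.image_congr hpF
  have hXp : X ⊆ F.image p := fun x hx => Finset.mem_image.2
    ⟨x, hXF hx, hpX x (subset_dimClosure _ _ hx)⟩
  refine ⟨p, hpa, hpX, ?_, ?_⟩
  · refine hp.isDimension.subset_dimClosure_of_union_le ?_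
    rw [Finset.union_comm, hpq, hqdim E₂ hE₂, Finset.union_comm, hK.finDim_union_eq]
  · rw [DimIndep, Finset.union_eq_left.2 hXp, Finset.union_eq_right.2 hX₁, hpa.finDim_image hp,
      hpq, hqdim E₁ hE₁]
    exact hK.le_finDim_union

section Generic

variable (hH : H.IsGeneric n m) (hm : m ≠ 0) (hmn : m ≤ n) (hmr : m + n < r * n)
  {g : Equiv.Perm V} (hg : H.IsAut g) (hg1 : g ≠ 1)
include hH hm hmn hmr hg hg1

theorem IsAut.exists_isSupply {X X' : Finset V} (hXX' : X ⊆ X') (hXF : X ⊆ F) (N : ℕ) :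
    ∃ (h : Equiv.Perm V) (C : ℕ → Finset V) (E : Finset V), H.IsAut h ∧
      (∀ x ∈ dimClosure (H.finDim n m) X, h x = x) ∧ DimIndep (H.finDim n m) (F.image h) X E ∧
      H.FinStrong n m E ∧ (∀ x ∈ F, x ∈ dimClosure (H.finDim n m) X → x ∈ E) ∧
      IsSupply n m H E (X' ∪ (C N).image g) (X ∪ C N) (F.image h) C N := by
  classical
  have hr := two_le_of_add_lt_mul hmr
  have hp := hH.predimNonneg (by lia)
  obtain ⟨C, hCmono, hCcard, hCX, hCgain⟩ := exists_supply hH hm hmn hmr hg hg1 hXX'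
  obtain ⟨E, hsub, hE, -⟩ := hp.exists_hull ((X' ∪ (C N).image g) ∪ (X ∪ C N) ∪
    F.filter (· ∈ dimClosure (H.finDim n m) X))
  obtain ⟨⟨hE₁, hE₂⟩, hFE⟩ : (X' ∪ (C N).image g ⊆ E ∧ X ∪ C N ⊆ E) ∧
      F.filter (· ∈ dimClosure (H.finDim n m) X) ⊆ E := by
    simpa only [Finset.union_subset_iff] using hsub
  obtain ⟨h, hh, hhX, hi⟩ := hH.exists_dimIndep (by lia) hm F X E
  have hXF' : X ⊆ F.image h := fun x hx => Finset.mem_image.2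
    ⟨x, hXF hx, hhX x (subset_dimClosure _ _ hx)⟩
  refine ⟨h, C, E, hh, hhX, hi, hE, fun x hx hxX => hFE (Finset.mem_filter.2 ⟨hx, hxX⟩),
    { left_subset := hE₁
      right_subset := hE₂
      mono := hCmono
      subset_right := fun s hs => (hCmono hs).trans Finset.subset_union_right
      le_card_sdiff := fun s _ => hCcard s
      add_le_finDim_insert := hCgain N
      notMem := fun c hc hcF => hCX N c hc <|
        hi.dimClosure_inter_subset hp.isDimension hXF' (Finset.subset_union_left.trans hE₂)
          ⟨subset_dimClosure _ _ hcF, subset_dimClosure _ _ (hE₂ (Finset.mem_union_right _ hc))⟩ }⟩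

theorem IsAut.exists_algebraic_conj (hnm : n.Coprime m) (X A : Finset V) :
    ∃ (h : Equiv.Perm V) (B E₁ E₂ : Finset V), H.IsAut h ∧
      (∀ x ∈ dimClosure (H.finDim n m) X, h x = x) ∧ A.image h ⊆ B ∧ X ⊆ B ∧
      X ∪ X.image g ∪ X.image ⇑g⁻¹ ⊆ E₁ ∧ E₂.image g ⊆ E₁ ∧
      (B : Set V) ⊆ dimClosure (H.finDim n m) E₂ ∧ DimIndep (H.finDim n m) B X E₁ := by
  have hr := two_le_of_add_lt_mul hmr
  have hr0 : r ≠ 0 := by lia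
  have hp := hH.predimNonneg hr0
  obtain ⟨F, hAXF, hF, -⟩ := hp.exists_hull (A ∪ X)
  obtain ⟨hAF, hXF⟩ := Finset.union_subset_iff.1 hAXF
  let X' := X ∪ X.image g ∪ X.image ⇑g⁻¹
  have hXX' : X ⊆ X' := Finset.subset_union_left.trans Finset.subset_union_left
  have hgX : X.image g ⊆ X' := Finset.subset_union_right.trans Finset.subset_union_left
  obtain ⟨h, C, E, hh, hhX, hi, hE, hFE, hC⟩ := hg.exists_isSupply hH hm hmn hmr hg1 hXX' hXF
    ((n + n * m) * F.card)
  have hXh : X.image h = X := (Finset.image_congr fun x hx =>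
    hhX x (subset_dimClosure _ _ hx)).trans Finset.image_id
  have hXF' : X ⊆ F.image h := hXh ▸ Finset.image_subset_image hXF
  have hX₁ : X ⊆ X' ∪ (C ((n + n * m) * F.card)).image g := hXX'.trans Finset.subset_union_left
  have hF' := hh.finStrong_image hF
  obtain ⟨K, hK⟩ := hC.exists_algebraizes (Nat.mul_le_mul_left _ Finset.card_image_le) hr
    (ne_zero_of_add_lt_mul hmr) hm hmn hnm hp (hH.hasFreePoints hr0 hm) hE hF' hXF' hX₁
    Finset.subset_union_left hi
  have hfix : ∀ x ∈ F.image h, x ∈ dimClosure (H.finDim n m) X → x ∈ E := by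
    intro x hx hxX
    obtain ⟨y, hy, rfl⟩ := Finset.mem_image.1 hx
    have hyX : h y = y := h.injective (hhX _ hxX)
    exact hyX.symm ▸ hFE y hy (hyX ▸ hxX)
  obtain ⟨p, hpa, hpX, hcl, hpi⟩ := hK.exists_isAut_fixed hH hr0 hm hE hF' hC.left_subset
    hC.right_subset hXF' hX₁ hfix
  refine ⟨p * h, (F.image h).image p, _, _, hpa.mul hh, fun x hx => ?_, ?_, fun x hx => ?_,
    Finset.subset_union_left, ?_, hcl, hpi⟩
  · rw [Equiv.Perm.mul_apply, hhX x hx, hpX x hx]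
  · rw [Equiv.Perm.coe_mul, ← Finset.image_image]
    exact Finset.image_subset_image (Finset.image_subset_image hAF)
  · exact Finset.mem_image.2 ⟨x, hXF' hx, hpX x (subset_dimClosure _ _ hx)⟩
  · rw [Finset.image_union]
    exact Finset.union_subset_union_left hgX

end Generic

end UHypergraph

/-! ### The action of the stabilizer -/

namespace UHypergraph

variable {r n m : ℕ} {V : Type*} [DecidableEq V] {H : UHypergraph r V}

theorem IsAut.dimIndep_image {g : Equiv.Perm V} (hg : H.IsAut g) (hp : H.PredimNonneg n m)
    {X B : Finset V} (hXB : X ⊆ B) (hB : DimIndep (H.finDim n m) B X (B.image g))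
    (hX : DimIndep (H.finDim n m) B X (X.image ⇑g⁻¹)) :
    DimIndep (H.finDim n m) (B.image g) (X.image g) (X ∪ B) := by
  have hd := hp.isDimension
  have hgX : X.image g ⊆ B.image g := Finset.image_subset_image hXB
  have h₁ := hB.add_eq hd
  have h₂ := (hB.mono_right hd (hgX.trans Finset.subset_union_right)).add_eq hd
  have h₃ := hX.add_eq hd
  have hBX : H.finDim n m (B ∪ X.image ⇑g⁻¹) = H.finDim n m (B.image g ∪ X) := by
    rw [← hg.finDim_image hp, Finset.image_union, image_image_inv]
  have hXX : H.finDim n m (X ∪ X.image ⇑g⁻¹) = H.finDim n m (X.image g ∪ X) := by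
    rw [← hg.finDim_image hp, Finset.image_union, image_image_inv]
  rw [Finset.union_eq_left.2 hXB] at h₁ h₂ h₃
  rw [hBX, hXX] at h₃
  rw [DimIndep, Finset.union_eq_left.2 hgX, Finset.union_eq_right.2 hXB, Finset.union_comm _ B,
    Finset.union_comm _ B, hg.finDim_image hp, hg.finDim_image hp]
  rw [Finset.union_comm X] at h₁ h₂
  linarith

theorem IsAut.exists_moved_conj {g : Equiv.Perm V} (hg : H.IsAut g) (hg1 : g ≠ 1)
    (hH : H.IsGeneric n m) (hm : m ≠ 0) (hmn : m ≤ n) (hmr : m + n < r * n)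
    (hnm : n.Coprime m) (X A : Finset V) :
    ∃ h : Equiv.Perm V, H.IsAut h ∧ (∀ x ∈ dimClosure (H.finDim n m) X, h x = x) ∧
      DimIndep (H.finDim n m) (A.image h) X (X.image g ∪ (A.image h).image g) ∧
      DimIndep (H.finDim n m) ((A.image h).image g) (X.image g) (X ∪ A.image h) := by
  have hr := two_le_of_add_lt_mul hmr
  have hp := hH.predimNonneg (by lia)
  have hd := hp.isDimension
  obtain ⟨h, B, E₁, E₂, hh, hhX, hAB, hXB, hXE₁, hE₂₁, hcl, hi⟩ :=
    hg.exists_algebraic_conj hH hm hmn hmr hg1 hnm X A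
  have hgAB : (A.image h).image g ⊆ B.image g := Finset.image_subset_image hAB
  have hgXB : X.image g ⊆ B.image g := Finset.image_subset_image hXB
  have hgB : (B.image g : Set V) ⊆ dimClosure (H.finDim n m) E₁ := by
    rw [Finset.coe_image]
    rintro _ ⟨x, hx, rfl⟩
    exact hd.dimClosure_mono hE₂₁ ((hg.mem_dimClosure_image hp).2 (hcl hx))
  have hBgB : DimIndep (H.finDim n m) B X (B.image g) :=
    hi.of_subset_dimClosure_right hd (hgB.trans (hd.dimClosure_mono Finset.subset_union_right))
  have hBX : DimIndep (H.finDim n m) B X (X.image ⇑g⁻¹) :=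
    hi.mono_right hd ((Finset.subset_union_right.trans hXE₁).trans Finset.subset_union_right)
  refine ⟨h, hh, hhX, hBgB.mono hd (hAB.trans Finset.subset_union_left) ?_,
    (hg.dimIndep_image hp hXB hBgB hBX).mono hd (hgAB.trans Finset.subset_union_left) ?_⟩
  · exact (Finset.union_subset hgXB hgAB).trans Finset.subset_union_right
  · exact (Finset.union_subset_union_right hAB).trans Finset.subset_union_right

theorem isAut_coe {X : Set V} (g : H.autFixing X) : H.IsAut (g : Equiv.Perm V) :=
  isAut_iff_isEmbedding.2 g.2.1

theorem exists_coe_eq (hp : H.PredimNonneg n m) {p : Equiv.Perm V} (hpa : H.IsAut p) {B : Finset V}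
    (h : ∀ x ∈ dimClosure (H.finDim n m) B, p x = x) :
    ∃ g : H.autFixing (H.clD n m ∅), (g : Equiv.Perm V) = p := by
  refine ⟨⟨p, isAut_iff_isEmbedding.1 hpa, fun x hx => h x ?_⟩, rfl⟩
  rw [hp.clD_empty] at hx
  exact hp.isDimension.dimClosure_mono B.empty_subset hx

omit [DecidableEq V] in
theorem exists_smul_eq_of_chain (hp : H.PredimNonneg n m)
    (p : ℕ → H.autFixing (H.clD n m ∅)) (F : ℕ → Finset V) (hF : Monotone F)
    (hcov : ∀ x, ∃ i, x ∈ F i) (hpF : ∀ i, ∀ x ∈ F i, p (i + 1) • x = p i • x)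
    (hinv : ∀ y, ∃ i, (p i)⁻¹ • y ∈ F i) :
    ∃ g : H.autFixing (H.clD n m ∅), ∀ i, ∀ x ∈ F i, g • x = p i • x := by
  classical
  obtain ⟨q, hq, hqF⟩ := exists_isAut_of_chain (H := H) (f := fun i x => p i • x) hF
    hcov hpF (fun i => (isAut_coe (p i)).isoOn _) fun y =>
      (hinv y).imp fun i hi => ⟨_, hi, smul_inv_smul _ _⟩
  obtain ⟨g, rfl⟩ := exists_coe_eq (B := ∅) hp hq fun x hx => by
    obtain ⟨i, hi⟩ := hcov x
    rw [hqF i x hi]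
    exact (p i).2.2 x (by rwa [hp.clD_empty])
  exact ⟨g, hqF⟩

theorem dimAction (hH : H.IsGeneric n m) (hm : m ≠ 0) (hmn : m ≤ n) (hmr : m + n < r * n)
    (hnm : n.Coprime m) : DimAction (H.autFixing (H.clD n m ∅)) (H.finDim n m) := by
  have hr : r ≠ 0 := by have := two_le_of_add_lt_mul hmr; lia
  have hp := hH.predimNonneg hr
  exact
  { isDimension := hp.isDimension
    dim_smul := fun g A => (isAut_coe g).finDim_image hp A
    exists_indep := fun A B C => by
      obtain ⟨p, hpa, hpB, hi⟩ := hH.exists_dimIndep hr hm A B C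
      obtain ⟨g, rfl⟩ := exists_coe_eq hp hpa hpB
      exact ⟨g, hpB, hi⟩
    exists_extension := fun A B C h hBA hBC hfix hA hhA => by
      obtain ⟨k, hk, hkA, hkC⟩ :=
        (isAut_coe h).exists_of_dimIndep hH hr hm hBA hBC hfix hA hhA
      obtain ⟨g, rfl⟩ := exists_coe_eq hp hk hkC
      exact ⟨g, hkA, hkC⟩
    exists_moved := fun f hf X A => by
      have hf1 : (f : Equiv.Perm V) ≠ 1 := fun h => hf (Subtype.ext h)
      obtain ⟨p, hpa, hpX, hind⟩ :=
        (isAut_coe f).exists_moved_conj hf1 hH hm hmn hmr hnm X A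
      obtain ⟨g, rfl⟩ := exists_coe_eq hp hpa hpX
      exact ⟨g, hpX, hind⟩
    exists_limit := exists_smul_eq_of_chain hp
    fixesClosure_empty := fun g x hx => g.2.2 x (by rwa [hp.clD_empty]) }

omit [DecidableEq V] in
theorem nontrivial_autFixing (hH : H.IsGeneric n m) (hr : r ≠ 0) (hn : n ≠ 0) (hm : m ≠ 0) :
    Nontrivial (H.autFixing (H.clD n m ∅)) := by
  classical
  have hp := hH.predimNonneg hr
  obtain ⟨w, hw⟩ := hH.hasFreePoints hr hm ∅
  obtain ⟨h, hh, hfix, hi⟩ := hH.exists_dimIndep hr hm {w} ∅ {w}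
  obtain ⟨g, hg⟩ := exists_coe_eq hp hh hfix
  refine ⟨g, 1, fun hg1 => ?_⟩
  have h1 : h = 1 := by rw [← hg, hg1, OneMemClass.coe_one]
  rw [FreeOver, insert_empty_eq] at hw
  rw [h1, DimIndep, Equiv.Perm.coe_one, Finset.image_id, Finset.union_empty, Finset.empty_union,
    Finset.union_self, hw] at hi
  lia

end UHypergraph

end

theorem theorem4p15 (r n m : ℕ) (hn : 1 ≤ n) (hm : 1 ≤ m) (hnm : Nat.Coprime n m)
    (hr : (r = 2 ∧ m < n) ∨ (3 ≤ r ∧ m ≤ n))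
    {V : Type*} (M₀ : UHypergraph r V) (hM₀ : M₀.IsGeneric n m) :
    IsSimpleGroup (M₀.autFixing (M₀.clD n m ∅)) ∧
    ∀ g : M₀.autFixing (M₀.clD n m ∅), g ≠ 1 →
      ∀ k : M₀.autFixing (M₀.clD n m ∅),
        ∃ l : List (M₀.autFixing (M₀.clD n m ∅)), l.length = 96 ∧
          (∀ x ∈ l, IsConj g x ∨ IsConj g⁻¹ x) ∧ l.prod = k := by
  classical
  have hm₀ : m ≠ 0 := Nat.one_le_iff_ne_zero.1 hm
  have hmn : m ≤ n := hr.elim (fun h => h.2.le) fun h => h.2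
  have hmr : m + n < r * n := by
    rcases hr with ⟨rfl, hlt⟩ | ⟨hr3, -⟩
    · lia
    · nlinarith
  have hact := UHypergraph.dimAction hM₀ hm₀ hmn hmr hnm
  have := hM₀.countable
  have := UHypergraph.nontrivial_autFixing hM₀ (by lia) (Nat.one_le_iff_ne_zero.1 hn) hm₀
  have hprod (g : M₀.autFixing (M₀.clD n m ∅)) (hg : g ≠ 1) (k : M₀.autFixing (M₀.clD n m ∅)) :=
    hact.exists_list_prod_eq hg k 44
  exact ⟨isSimpleGroup_of_exists_list fun g hg k => (hprod g hg k).imp fun _ hl => hl.2, hprod⟩
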